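/- A binary tree here is a finite rooted tree in which every internal node has one or two children. Let $W=\{w_1,\dots,w_n\}$, $n\ge 1$, be a multiset of real numbers (weights). Given a binary tree with $n$ leaves to which the weights in $W$ are assigned one-to-one, each internal node gets weight $1$ plus the maximum of its children's weights; the weight of the root is then $\max_i (w_i+\ell_i)$, where $\ell_i$ is the depth of the leaf with weight $w_i$. The tree is a minimax tree for $W$ if the weight of its root is as small as possible among all such trees. Consider a word RAM with $b$-bit words, $b\ge 1$. It has the usual unit-time operations on words (arithmetic modulo $2^b$, integer division and remainder, bitwise operations, shifts, comparison, jumps, indirect memory access), and additional cells for real numbers with the unit-time operations of copying, addition, subtraction and comparison of reals, computing the floor of a real whose value is a natural number fitting into a constant number of words, and converting a natural number stored in a constant number of words to a real. A natural number that does not fit into one word, in particular an address, is stored in a constant number of words, as its digits in base $2^b$. The input is $n$, in base $2^b$, together with $w_1,\dots,w_n$ in $n$ consecutive real cells; all other cells are initially $0$. **Theorem.** On a word RAM with $\Omega(\log n)$-bit words, a minimax tree for a given multiset of $n$ real weights can be built in $O(n)$ time. Precisely: for every constant $c>0$ there are a program $P$ and constants $k$ and $C$ such that, for all integers $n\ge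 1$ and $b\ge 1$ with $b\ge c\log_2 n$ and all real weights $w_1,\dots,w_n$, the program $P$, run with $b$-bit words on input $w_1,\dots,w_n$, halts after at most $C n$ steps with a minimax tree for $\{w_1,\dots,w_n\}$ in its memory. The tree is stored as linked records with $k$-word pointers, each leaf recording the index $i$ of its weight $w_i$ and each index occurring at exactly one leaf. -/

import Mathlib

/-! ### Binary trees and minimax trees -/

/-- Binary trees with labelled leaves; every internal node has one or two children. -/
inductive BinTree (α : Type*) where
  | leaf (a : α) : BinTree α
  | one (t : BinTree α) : BinTree α
  | two (l r : BinTree α) : BinTree α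

namespace BinTree

/-- The multiset of the labels of the leaves. -/
def leaves {α : Type*} : BinTree α → Multiset α
  | leaf a => {a}
  | one t => t.leaves
  | two l r => l.leaves + r.leaves

/-- Relabel the leaves. -/
def map {α β : Type*} (f : α → β) : BinTree α → BinTree β
  | leaf a => leaf (f a)
  | one t => one (t.map f)
  | two l r => two (l.map f) (r.map f)

/-- The weight of the root, when the label of each leaf is its weight and each internal node has
weight equal to the maximum of its children's weights plus one. -/
noncomputable def weight : BinTree ℝ → ℝ
  | leaf x => x
  | one t => t.weight + 1
  | two l r => max l.weight r.weight + 1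

/-- The multiset of all pairs (label of a leaf, depth of that leaf), where the root of the tree is
considered to have depth `d`. -/
def leafDepths {α : Type*} : BinTree α → ℕ → Multiset (α × ℕ)
  | leaf a, d => {(a, d)}
  | one t, d => t.leafDepths (d + 1)
  | two l r, d => l.leafDepths (d + 1) + r.leafDepths (d + 1)

theorem isGreatest_weight_add (t : BinTree ℝ) (d : ℕ) :
    IsGreatest {y | ∃ q ∈ t.leafDepths d, y = q.1 + q.2} (t.weight + d) := by
  induction t generalizing d with
  | leaf x => simp [leafDepths, weight, IsGreatest, upperBounds]
  | one t ih =>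
    have h := ih (d + 1)
    push_cast at h
    simpa [leafDepths, weight, add_assoc, add_comm, add_left_comm] using h
  | two l r ihl ihr =>
    have h := (ihl (d + 1)).union (ihr (d + 1))
    have e : max (l.weight + ((d + 1 : ℕ) : ℝ)) (r.weight + ((d + 1 : ℕ) : ℝ))
        = (two l r).weight + d := by
      rw [max_add_add_right]; simp only [weight]; push_cast; ring
    rw [e] at h
    have e2 : {y | ∃ q ∈ (two l r).leafDepths d, y = q.1 + q.2}
        = {y | ∃ q ∈ l.leafDepths (d + 1), y = q.1 + q.2} ∪
          {y | ∃ q ∈ r.leafDepths (d + 1), y = q.1 + q.2} := by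
      apply Set.ext
      intro y
      simp only [leafDepths, Multiset.mem_add, Set.mem_ofPred_eq, Set.mem_union, or_and_right,
        exists_or]
    rw [e2]
    exact h

/-- The weight of the root is the maximum of (weight of a leaf) + (depth of that leaf). -/
theorem isGreatest_weight (t : BinTree ℝ) :
    IsGreatest {y | ∃ q ∈ t.leafDepths 0, y = q.1 + q.2} t.weight := by
  simpa using isGreatest_weight_add t 0

/-- `t` is a minimax tree for the multiset `W` of weights. -/
def IsMinimax (W : Multiset ℝ) (t : BinTree ℝ) : Prop :=
  t.leaves = W ∧ ∀ t' : BinTree ℝ, t'.leaves = W → t.weight ≤ t'.weight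

end BinTree

/-! ### A word RAM with `w`-bit words that can also hold real numbers

Words are elements of `BitVec w`. Besides word registers and word memory there are real registers
and real memory. A natural number too large for one word is spread over a fixed list of registers
(or over consecutive memory cells) as its base-`2 ^ w` digits, least significant digit first; such
lists serve as addresses and in conversions. All other integer instructions act on single words. -/

namespace WordRAM

/-- Binary operations on words. -/
inductive Op where
  | add | sub | mul | div | mod | and | or | xor | shl | shr | lt

/-- Arithmetic is modulo `2 ^ w` on unsigned words; `lt` yields `1` or `0`. -/
def Op.eval {w : ℕ} : Op → BitVec w → BitVec w → BitVec w
  | .add, a, b => a + b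
  | .sub, a, b => a - b
  | .mul, a, b => a * b
  | .div, a, b => a / b
  | .mod, a, b => a % b
  | .and, a, b => a &&& b
  | .or, a, b => a ||| b
  | .xor, a, b => a ^^^ b
  | .shl, a, b => a <<< b
  | .shr, a, b => a >>> b
  | .lt, a, b => if a < b then 1 else 0

/-- Instructions. Registers are named by natural numbers. -/
inductive Instr where
  /-- set word register `d` to the constant `v` (modulo `2 ^ w`) -/
  | const (d v : ℕ)
  /-- set word register `d` to the result of `o` on word registers `a` and `b` -/
  | op (o : Op) (d a b : ℕ)
  /-- copy the word memory cell with address `as` to word register `d` -/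
  | load (d : ℕ) (as : List ℕ)
  /-- copy word register `a` to the word memory cell with address `as` -/
  | store (as : List ℕ) (a : ℕ)
  /-- jump to instruction `l` -/
  | jump (l : ℕ)
  /-- jump to instruction `l` if word register `a` is zero -/
  | jumpZero (a l : ℕ)
  /-- copy the real memory cell with address `as` to real register `d` -/
  | rload (d : ℕ) (as : List ℕ)
  /-- copy real register `a` to the real memory cell with address `as` -/
  | rstore (as : List ℕ) (a : ℕ)
  /-- set real register `d` to the sum of real registers `a` and `b` -/
  | radd (d a b : ℕ)
  /-- set real register `d` to real register `a` minus real register `b` -/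
  | rsub (d a b : ℕ)
  /-- jump to instruction `l` if real register `a` is less than real register `b` -/
  | rjumpLt (a b l : ℕ)
  /-- set the word registers `ds` to the digits of the floor of real register `a`; they are set to
  zero if that floor is not a natural number with at most as many digits -/
  | floor (ds : List ℕ) (a : ℕ)
  /-- set real register `d` to the number whose digits are in the word registers `as` -/
  | cast (d : ℕ) (as : List ℕ)

/-- A program is a finite list of instructions. -/
abbrev Program := List Instr

/-- A configuration of the machine with `w`-bit words. -/
structure Config (w : ℕ) where
  /-- number of the next instruction -/
  pc : ℕ
  /-- word registers -/
  reg : ℕ → BitVec w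
  /-- word memory -/
  mem : ℕ → BitVec w
  /-- real registers -/
  rreg : ℕ → ℝ
  /-- real memory -/
  rmem : ℕ → ℝ

/-- The number whose base-`2 ^ w` digits are in the registers of the given list. -/
def num {w : ℕ} (reg : ℕ → BitVec w) : List ℕ → ℕ
  | [] => 0
  | a :: as => (reg a).toNat + 2 ^ w * num reg as

/-- Write the base-`2 ^ w` digits of `v` to the registers of the given list. -/
def setNum {w : ℕ} (reg : ℕ → BitVec w) : List ℕ → ℕ → (ℕ → BitVec w)
  | [], _ => reg
  | d :: ds, v => setNum (Function.update reg d (BitVec.ofNat w v)) ds (v / 2 ^ w)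

open Classical in
/-- The effect of one instruction. -/
noncomputable def exec {w : ℕ} (s : Config w) : Instr → Config w
  | .const d v => { s with pc := s.pc + 1, reg := Function.update s.reg d (BitVec.ofNat w v) }
  | .op o d a b =>
    { s with pc := s.pc + 1, reg := Function.update s.reg d (o.eval (s.reg a) (s.reg b)) }
  | .load d as =>
    { s with pc := s.pc + 1, reg := Function.update s.reg d (s.mem (num s.reg as)) }
  | .store as a =>
    { s with pc := s.pc + 1, mem := Function.update s.mem (num s.reg as) (s.reg a) }
  | .jump l => { s with pc := l }
  | .jumpZero a l => { s with pc := if s.reg a = 0 then l else s.pc + 1 }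
  | .rload d as =>
    { s with pc := s.pc + 1, rreg := Function.update s.rreg d (s.rmem (num s.reg as)) }
  | .rstore as a =>
    { s with pc := s.pc + 1, rmem := Function.update s.rmem (num s.reg as) (s.rreg a) }
  | .radd d a b =>
    { s with pc := s.pc + 1, rreg := Function.update s.rreg d (s.rreg a + s.rreg b) }
  | .rsub d a b =>
    { s with pc := s.pc + 1, rreg := Function.update s.rreg d (s.rreg a - s.rreg b) }
  | .rjumpLt a b l => { s with pc := if s.rreg a < s.rreg b then l else s.pc + 1 }
  | .floor ds a =>
    { s with
      pc := s.pc + 1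
      reg := setNum s.reg ds
        (if 0 ≤ s.rreg a ∧ s.rreg a < (2 : ℝ) ^ (w * ds.length) then ⌊s.rreg a⌋₊ else 0) }
  | .cast d as =>
    { s with pc := s.pc + 1, rreg := Function.update s.rreg d (num s.reg as : ℝ) }

/-- The machine has halted when there is no next instruction. -/
def Halted {w : ℕ} (P : Program) (s : Config w) : Prop := P.length ≤ s.pc

/-- One step of the machine: one instruction is executed, unless the machine has halted. -/
noncomputable def step {w : ℕ} (P : Program) (s : Config w) : Config w :=
  match P[s.pc]? with
  | none => s
  | some i => exec s i

/-- The initial configuration on input `x 0, …, x (n - 1)`: the weights are in the real memory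
cells `0, …, n - 1`, the digits of `n` are in the word memory cells `0, 1, …`, and everything else
is zero. -/
def start (w : ℕ) {n : ℕ} (x : Fin n → ℝ) : Config w where
  pc := 0
  reg := fun _ => 0
  mem := fun a => BitVec.ofNat w (n / 2 ^ (w * a))
  rreg := fun _ => 0
  rmem := fun a => if h : a < n then x ⟨a, h⟩ else 0

/-- The number whose base-`2 ^ w` digits are in the `k` consecutive memory cells from `a` on. -/
def readNum {w : ℕ} (mem : ℕ → BitVec w) : ℕ → ℕ → ℕ
  | 0, _ => 0
  | k + 1, a => (mem a).toNat + 2 ^ w * readNum mem k (a + 1)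

/-- A tree is stored at address `p` as a record with two flag cells (is the root internal? has it
a second child?), followed by one or two `k`-word fields: for a leaf its label, for an internal
node the addresses of the records of its children. -/
def Stores {w : ℕ} (k : ℕ) (mem : ℕ → BitVec w) : ℕ → BinTree ℕ → Prop
  | p, .leaf i => mem p = 0 ∧ readNum mem k (p + 2) = i
  | p, .one t => mem p ≠ 0 ∧ mem (p + 1) = 0 ∧ Stores k mem (readNum mem k (p + 2)) t
  | p, .two l r => mem p ≠ 0 ∧ mem (p + 1) ≠ 0 ∧ Stores k mem (readNum mem k (p + 2)) l ∧
      Stores k mem (readNum mem k (p + 2 + k)) r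

/-- Started on `x 0, …, x (n - 1)` with `w`-bit words, the program `P` halts after at most `N`
steps, and then the memory holds a binary tree with each of the indices `0, …, n - 1` at exactly
one leaf that becomes a minimax tree for the multiset of the `x i` when each leaf `i` is given the
weight `x i`. The address of the root is in the first `k` cells. -/
def BuildsMinimaxTree (P : Program) (k w : ℕ) {n : ℕ} (x : Fin n → ℝ) (N : ℕ) : Prop :=
  ∃ m ≤ N, Halted P ((step P)^[m] (start w x)) ∧
    ∃ t : BinTree (Fin n),
      Stores k ((step P)^[m] (start w x)).mem
        (readNum ((step P)^[m] (start w x)).mem k 0) (t.map Fin.val) ∧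
      t.leaves = Finset.univ.val ∧
      (t.map x).IsMinimax (Finset.univ.val.map x)

end WordRAM

/-! Shifting all weights shifts the weight of every tree, so the largest weight `mx` may be moved to
`n`; weights that become negative are then replaced by `0`. Apart from the shift, the optimum is
unchanged: every tree has weight at least `n` after the shift, while clamped leaves can be arranged
without unary nodes and then force a weight of at most `n - 1` (`BinTree.exists_clamp`). Let `u i`,
between `0` and `n`, be the new weights.

Rounding relative to a real `p` gives Kraft's inequality: the sum of `2 ^ ⌈u i - p⌉` over the leaves
is at most `2 ^ ⌈weight - p⌉` (`BinTree.sum_zpow_le`). For `0 ≤ p < 1` the exponent is `⌊u i⌋`, plus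
one if the fractional part of `u i` exceeds `p`. Let `m₀` be the least natural number with `∑ 2 ^ ⌊u
i⌋ ≤ 2 ^ m₀`, and `φ` the smallest fractional part with `∑ 2 ^ ⌈u i - φ⌉ ≤ 2 ^ m₀`. Kraft's
inequality for a suitable `p` shows that no tree weighs less than `m₀ + φ` (`IsFrac.le_weight`).
Conversely, put leaf `i` at level `⌈u i - φ⌉` and pair roots level by level, lifting a leftover root
by a unary node. A tree at level `v` then weighs at most `v + φ`, and the bound on the Kraft sum
leaves a single root at level `m₀` (`wp_pairStmt`). So `m₀ + φ` is the optimum, and the tree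
obtained is minimax (`IsFrac.isMinimax`).

Everything takes linear time. Powers of two are kept as reals, so a table up to `2 ^ (2 * n)` costs
one addition per entry. Finding `φ` is weighted selection: item `i` has the fractional part as key
and `2 ^ ⌊u i⌋` as weight, and `φ` is the smallest key above which the total weight is at most `2 ^
m₀ - ∑ 2 ^ ⌊u i⌋`. Prune and search with medians of medians solves this (`wp_selectStmt`). Levels
are at most `m₀ ≤ 2 * n`, so leaves are distributed to buckets without sorting, and each level
causes at most one unary node, so there are `O(n)` nodes.

The algorithm is written in a small structured language whose variables, natural and real, live in
real registers and whose arrays live in real memory; word memory only holds the input size and the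
output. A compiler is proved correct with constant slowdown (`Runs.simulates`). As `n ≤ 2 ^ (w * K)`
for a constant `K ≥ 1 / c`, a constant number `k` of digits suffices for all addresses. -/

/-! ### A structured language over natural and real variables and arrays -/

namespace RealRAM

open WordRAM

/-- The parameters of a run: number of digits of a pointer, word length, and the input. -/
structure Env where
  k : ℕ
  w : ℕ
  n : ℕ
  x : ℕ → ℝ

/-- A state: natural and real variables, eight natural and eight real arrays, the word memory,
and the number of steps performed so far. -/
structure St (E : Env) where
  nv : ℕ → ℕ
  rv : ℕ → ℝ
  na : Fin 8 → ℕ → ℕ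
  ra : Fin 8 → ℕ → ℝ
  out : ℕ → BitVec E.w
  tm : ℕ

variable {E : Env}

/-- Expressions for natural numbers. -/
inductive NExp where
  | lit (v : ℕ)
  | var (i : ℕ)
  | add (a b : NExp)
  | sub (a b : NExp)
  | mulc (c : ℕ) (a : NExp)
  | arr (j : Fin 8) (a : NExp)

namespace NExp

/-- The value of an expression. -/
def eval (s : St E) : NExp → ℕ
  | lit v => v
  | var i => s.nv i
  | add a b => a.eval s + b.eval s
  | sub a b => a.eval s - b.eval s
  | mulc c a => c * a.eval s
  | arr j a => s.na j (a.eval s)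

/-- No subtraction is truncated and all array cells are addressable. -/
def Ok (s : St E) : NExp → Prop
  | lit _ => True
  | var _ => True
  | add a b => a.Ok s ∧ b.Ok s
  | sub a b => a.Ok s ∧ b.Ok s ∧ b.eval s ≤ a.eval s
  | mulc _ a => a.Ok s
  -- All sixteen array cells with this index, which lie behind the input, have `k`-digit addresses.
  | arr _ a => a.Ok s ∧ E.n + 16 * (a.eval s + 1) ≤ 2 ^ (E.w * E.k)

end NExp

/-- Expressions for real numbers; `inp a` is the weight with index `a`. -/
inductive RExp where
  | var (i : ℕ)
  | nat (a : NExp)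
  | add (a b : RExp)
  | sub (a b : RExp)
  | arr (j : Fin 8) (a : NExp)
  | inp (a : NExp)

namespace RExp

/-- The value of an expression. -/
def eval (s : St E) : RExp → ℝ
  | var i => s.rv i
  | nat a => (a.eval s : ℝ)
  | add a b => a.eval s + b.eval s
  | sub a b => a.eval s - b.eval s
  | arr j a => s.ra j (a.eval s)
  | inp a => E.x (a.eval s)

/-- All natural subexpressions are fine and all array cells are addressable. -/
def Ok (s : St E) : RExp → Prop
  | var _ => True
  | nat a => a.Ok s
  | add a b => a.Ok s ∧ b.Ok s
  | sub a b => a.Ok s ∧ b.Ok s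
  | arr _ a => a.Ok s ∧ E.n + 16 * (a.eval s + 1) ≤ 2 ^ (E.w * E.k)
  | inp a => a.Ok s ∧ a.eval s < E.n ∧ E.n ≤ 2 ^ (E.w * E.k)

end RExp

/-- Tests. -/
inductive Cond where
  | nlt (a b : NExp)
  | rlt (a b : RExp)

/-- The test succeeds. -/
def Cond.Holds (s : St E) : Cond → Prop
  | nlt a b => a.eval s < b.eval s
  | rlt a b => a.eval s < b.eval s

/-- The expressions of a test are fine. -/
def Cond.Ok (s : St E) : Cond → Prop
  | nlt a b => a.Ok s ∧ b.Ok s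
  | rlt a b => a.Ok s ∧ b.Ok s

/-- Basic statements. `out j a e` writes the `j`-th digit of `e` to the word cell `a`. -/
inductive Prim where
  | nset (i : ℕ) (e : NExp)
  | rset (i : ℕ) (e : RExp)
  | floor (i : ℕ) (e : RExp)
  | nput (j : Fin 8) (a e : NExp)
  | rput (j : Fin 8) (a : NExp) (e : RExp)
  | out (j : ℕ) (a e : NExp)

/-- Count one step. -/
def St.tick (s : St E) : St E := { s with tm := s.tm + 1 }

/-- The effect of a basic statement. -/
noncomputable def Prim.run (s : St E) : Prim → St E
  | nset i e => { s with nv := Function.update s.nv i (e.eval s), tm := s.tm + 1 }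
  | rset i e => { s with rv := Function.update s.rv i (e.eval s), tm := s.tm + 1 }
  | floor i e => { s with nv := Function.update s.nv i ⌊e.eval s⌋₊, tm := s.tm + 1 }
  | nput j a e =>
    { s with
      na := Function.update s.na j (Function.update (s.na j) (a.eval s) (e.eval s))
      tm := s.tm + 1 }
  | rput j a e =>
    { s with
      ra := Function.update s.ra j (Function.update (s.ra j) (a.eval s) (e.eval s))
      tm := s.tm + 1 }
  | out j a e =>
    { s with
      out := Function.update s.out (a.eval s) (BitVec.ofNat E.w (e.eval s / 2 ^ (E.w * j)))
      tm := s.tm + 1 }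

/-- A basic statement can be carried out by the machine. -/
def Prim.Ok (s : St E) : Prim → Prop
  | nset _ e => e.Ok s
  | rset _ e => e.Ok s
  | floor _ e => e.Ok s ∧ 0 ≤ e.eval s ∧ e.eval s < (2 : ℝ) ^ (E.w * E.k)
  | nput _ a e => a.Ok s ∧ e.Ok s ∧ E.n + 16 * (a.eval s + 1) ≤ 2 ^ (E.w * E.k)
  | rput _ a e => a.Ok s ∧ e.Ok s ∧ E.n + 16 * (a.eval s + 1) ≤ 2 ^ (E.w * E.k)
  | out j a e => a.Ok s ∧ e.Ok s ∧ j < E.k ∧ a.eval s < 2 ^ (E.w * E.k) ∧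
      e.eval s < 2 ^ (E.w * E.k)

/-- Statements. -/
inductive Stmt where
  | prim (p : Prim)
  | seq (a b : Stmt)
  | ite (c : Cond) (a b : Stmt)
  | loop (c : Cond) (a : Stmt)

/-- Big-step semantics. -/
inductive Runs : Stmt → St E → St E → Prop where
  | prim {p s} : p.Ok s → Runs (.prim p) s (p.run s)
  | seq {a b s s' s''} : Runs a s s' → Runs b s' s'' → Runs (.seq a b) s s''
  | ite_true {c a b s s'} : c.Ok s → c.Holds s → Runs a s.tick s' → Runs (.ite c a b) s s'
  | ite_false {c a b s s'} : c.Ok s → ¬ c.Holds s → Runs b s.tick s' → Runs (.ite c a b) s s'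
  | loop_true {c a s s' s''} : c.Ok s → c.Holds s → Runs a s.tick s' →
      Runs (.loop c a) s' s'' → Runs (.loop c a) s s''
  | loop_false {c a s} : c.Ok s → ¬ c.Holds s → Runs (.loop c a) s s.tick

theorem Runs.tm_le {S : Stmt} {s s' : St E} (h : Runs S s s') : s.tm ≤ s'.tm := by
  induction h with
  | @prim p s _ => cases p <;> simp [Prim.run]
  | seq _ _ h1 h2 => exact h1.trans h2
  | ite_true _ _ _ h => exact (Nat.le_succ _).trans h
  | ite_false _ _ _ h => exact (Nat.le_succ _).trans h
  | loop_true _ _ _ _ h1 h2 => exact ((Nat.le_succ _).trans h1).trans h2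
  | loop_false _ _ => exact Nat.le_succ _

/-! ### Weakest preconditions and the loop rule -/

/-- Weakest preconditions. -/
def wp (S : Stmt) (s : St E) (Q : St E → Prop) : Prop := ∃ s', Runs S s s' ∧ Q s'

theorem wp.mono {S : Stmt} {s : St E} {Q Q' : St E → Prop} (h : wp S s Q)
    (hQ : ∀ s', Q s' → Q' s') : wp S s Q' :=
  let ⟨s', h1, h2⟩ := h
  ⟨s', h1, hQ s' h2⟩

theorem wp.seq {a b : Stmt} {s : St E} {R Q : St E → Prop} (h : wp a s R)
    (hR : ∀ s', R s' → wp b s' Q) : wp (.seq a b) s Q :=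
  let ⟨s', h1, h2⟩ := h
  let ⟨s'', h3, h4⟩ := hR s' h2
  ⟨s'', .seq h1 h3, h4⟩

theorem wp_prim {p : Prim} {s : St E} {Q : St E → Prop} :
    wp (.prim p) s Q ↔ p.Ok s ∧ Q (p.run s) := by
  constructor
  · rintro ⟨s', h, hQ⟩
    cases h with
    | prim h => exact ⟨h, hQ⟩
  · rintro ⟨h, hQ⟩
    exact ⟨_, .prim h, hQ⟩

theorem wp_seq {a b : Stmt} {s : St E} {Q : St E → Prop} :
    wp (.seq a b) s Q ↔ wp a s (fun s' => wp b s' Q) := by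
  constructor
  · rintro ⟨s', h, hQ⟩
    cases h with
    | seq h1 h2 => exact ⟨_, h1, _, h2, hQ⟩
  · rintro ⟨s', h, s'', h', hQ⟩
    exact ⟨_, .seq h h', hQ⟩

theorem wp_ite {c : Cond} {a b : Stmt} {s : St E} {Q : St E → Prop} :
    wp (.ite c a b) s Q ↔
      c.Ok s ∧ (c.Holds s → wp a s.tick Q) ∧ (¬ c.Holds s → wp b s.tick Q) := by
  constructor
  · rintro ⟨s', h, hQ⟩
    cases h with
    | ite_true h0 h1 h2 => exact ⟨h0, fun _ => ⟨_, h2, hQ⟩, fun h => absurd h1 h⟩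
    | ite_false h0 h1 h2 => exact ⟨h0, fun h => absurd h h1, fun _ => ⟨_, h2, hQ⟩⟩
  · rintro ⟨h0, h1, h2⟩
    by_cases h : c.Holds s
    · obtain ⟨s', h3, h4⟩ := h1 h
      exact ⟨s', .ite_true h0 h h3, h4⟩
    · obtain ⟨s', h3, h4⟩ := h2 h
      exact ⟨s', .ite_false h0 h h3, h4⟩

/-- Loops are treated with an invariant `I` and a potential `V` that pays for the steps. -/
theorem wp_loop {c : Cond} {a : Stmt} {s : St E} {Q : St E → Prop} (I : St E → Prop)
    (V : St E → ℕ) (h0 : I s)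
    (hstep : ∀ s, I s → c.Ok s ∧ (c.Holds s →
      wp a s.tick (fun s' => I s' ∧ s'.tm + V s' ≤ s.tm + V s)))
    (hQ : ∀ s', I s' → ¬ c.Holds s' → s'.tm + V s' ≤ s.tm + V s → Q s'.tick) :
    wp (.loop c a) s Q := by
  -- The body starts from `s.tick`, so `tm` grows in every round and the inequality forces `V` to
  -- drop. Termination and the time bound thus come from the same potential.
  induction hV : V s using Nat.strong_induction_on generalizing s with
  | _ v ih =>
    obtain ⟨hok, hb⟩ := hstep s h0
    by_cases h : c.Holds s
    · obtain ⟨s1, hr, hI, ht⟩ := hb h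
      have htm := hr.tm_le
      have : s.tick.tm = s.tm + 1 := rfl
      obtain ⟨s2, hr2, hQ2⟩ := ih (V s1) (by omega) (s := s1) hI
        (fun s' hI' hc' ht' => hQ s' hI' hc' (by omega)) rfl
      exact ⟨s2, .loop_true hok h hr hr2, hQ2⟩
    · exact ⟨_, .loop_false hok h, hQ s h0 h le_rfl⟩

/-! ### Compilation -/

/-- Digit registers. -/
def valRegs (k : ℕ) : List ℕ := List.range' 0 k

/-- Address registers. -/
def adrRegs (k : ℕ) : List ℕ := List.range' k k

/-- The real registers `0`, `3`, `6` hold `0`, `1`, `n`; temporaries and variables interleave. -/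
def tmpReg (t : ℕ) : ℕ := 3 * t + 9

/-- Turn the index in a temporary into the address of an array cell. -/
def compAdr (k t d : ℕ) : List Instr :=
  -- Four doublings multiply the index by `16`: eight natural arrays (even `d`) and eight real
  -- arrays (odd `d`) are interleaved behind the input cells.
  List.replicate 4 (.radd (tmpReg t) (tmpReg t) (tmpReg t)) ++
    (.radd (tmpReg t) (tmpReg t) 6 :: (List.replicate d (.radd (tmpReg t) (tmpReg t) 3) ++
      [.floor (adrRegs k) (tmpReg t)]))

/-- Code that computes a natural expression into the temporary `t`. -/
def NExp.comp (k : ℕ) : NExp → ℕ → List Instr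
  | lit v, t => .radd (tmpReg t) 0 0 :: List.replicate v (.radd (tmpReg t) (tmpReg t) 3)
  | var i, t => [.radd (tmpReg t) (3 * i + 1) 0]
  | add a b, t => a.comp k t ++ (b.comp k (t + 1) ++
      [.radd (tmpReg t) (tmpReg t) (tmpReg (t + 1))])
  | sub a b, t => a.comp k t ++ (b.comp k (t + 1) ++
      [.rsub (tmpReg t) (tmpReg t) (tmpReg (t + 1))])
  | mulc c a, t => a.comp k (t + 1) ++ (.radd (tmpReg t) 0 0 ::
      List.replicate c (.radd (tmpReg t) (tmpReg t) (tmpReg (t + 1))))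
  | arr j a, t => a.comp k t ++ (compAdr k t (2 * j) ++ [.rload (tmpReg t) (adrRegs k)])

/-- Code that computes a real expression into the temporary `t`. -/
def RExp.comp (k : ℕ) : RExp → ℕ → List Instr
  | var i, t => [.radd (tmpReg t) (3 * i + 2) 0]
  | nat a, t => a.comp k t
  | add a b, t => a.comp k t ++ (b.comp k (t + 1) ++
      [.radd (tmpReg t) (tmpReg t) (tmpReg (t + 1))])
  | sub a b, t => a.comp k t ++ (b.comp k (t + 1) ++
      [.rsub (tmpReg t) (tmpReg t) (tmpReg (t + 1))])
  | arr j a, t => a.comp k t ++ (compAdr k t (2 * j + 1) ++ [.rload (tmpReg t) (adrRegs k)])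
  | inp a, t => a.comp k t ++ [.floor (adrRegs k) (tmpReg t), .rload (tmpReg t) (adrRegs k)]

/-- Code that computes the two sides of a test into the temporaries `0` and `1`. -/
def Cond.comp (k : ℕ) : Cond → List Instr
  | nlt a b => a.comp k 0 ++ b.comp k 1
  | rlt a b => a.comp k 0 ++ b.comp k 1

/-- Code for a basic statement. -/
def Prim.comp (k : ℕ) : Prim → List Instr
  | nset i e => e.comp k 0 ++ [.radd (3 * i + 1) (tmpReg 0) 0]
  | rset i e => e.comp k 0 ++ [.radd (3 * i + 2) (tmpReg 0) 0]
  | floor i e => e.comp k 0 ++ [.floor (valRegs k) (tmpReg 0), .cast (3 * i + 1) (valRegs k)]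
  | nput j a e => e.comp k 0 ++ (a.comp k 1 ++ (compAdr k 1 (2 * j) ++
      [.rstore (adrRegs k) (tmpReg 0)]))
  | rput j a e => e.comp k 0 ++ (a.comp k 1 ++ (compAdr k 1 (2 * j + 1) ++
      [.rstore (adrRegs k) (tmpReg 0)]))
  | out j a e => e.comp k 0 ++ (a.comp k 1 ++ [.floor (valRegs k) (tmpReg 0),
      .floor (adrRegs k) (tmpReg 1), .store (adrRegs k) j])

/-- The length of the code for a statement. -/
def Stmt.size (k : ℕ) : Stmt → ℕ
  | prim p => (p.comp k).length
  | seq a b => a.size k + b.size k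
  | ite c a b => (c.comp k).length + 1 + (b.size k + 1 + a.size k)
  | .loop c a => (c.comp k).length + 2 + (a.size k + 1)

/-- Code for a statement, to be placed at position `o`. -/
def Stmt.comp (k : ℕ) : Stmt → ℕ → List Instr
  | prim p, _ => p.comp k
  | seq a b, o => a.comp k o ++ b.comp k (o + a.size k)
  | ite c a b, o =>
    let l := o + ((c.comp k).length + 1)
    -- The code for failure comes first; success jumps over it and over the jump that ends it.
    (c.comp k ++ [.rjumpLt (tmpReg 0) (tmpReg 1) (l + (b.size k + 1))]) ++
      (b.comp k l ++ (.jump (l + (b.size k + 1 + a.size k)) ::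
        a.comp k (l + b.size k + 1)))
  | .loop c a, o =>
    let l := o + ((c.comp k).length + 2)
    (c.comp k ++ [.rjumpLt (tmpReg 0) (tmpReg 1) l, .jump (l + (a.size k + 1))]) ++
      (a.comp k l ++ [.jump o])

theorem Stmt.length_comp (k : ℕ) (S : Stmt) (o : ℕ) : (S.comp k o).length = S.size k := by
  induction S generalizing o with
  | prim p => rfl
  | seq a b iha ihb => simp [comp, size, iha, ihb]
  | ite c a b iha ihb => simp [comp, size, iha, ihb]; omega
  | loop c a iha => simp [comp, size, iha]; omega

/-- Bound for the number of machine steps per step of a statement. -/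
def Stmt.slow (k : ℕ) : Stmt → ℕ
  | prim p => (p.comp k).length
  | seq a b => a.slow k + b.slow k
  | ite c a b => (c.comp k).length + 2 + a.slow k + b.slow k
  | .loop c a => (c.comp k).length + 3 + a.slow k

/-! ### Correctness of the compilation -/

/-- The code `l` occurs in `P` at position `o`. -/
def CodeAt (P : Program) (o : ℕ) (l : List Instr) : Prop :=
  ∀ i < l.length, P[o + i]? = l[i]?

theorem CodeAt.append {P : Program} {o : ℕ} {l l' : List Instr} (h : CodeAt P o (l ++ l')) :
    CodeAt P o l ∧ CodeAt P (o + l.length) l' := by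
  constructor
  · intro i hi
    rw [h i (by simp; omega), List.getElem?_append_left hi]
  · intro i hi
    rw [add_assoc, h (l.length + i) (by simp; omega), List.getElem?_append_right (by omega)]
    simp

theorem CodeAt.cons {P : Program} {o : ℕ} {i : Instr} {l : List Instr}
    (h : CodeAt P o (i :: l)) : P[o]? = some i ∧ CodeAt P (o + 1) l := by
  refine ⟨by simpa using h 0 (by simp), ?_⟩
  have := (CodeAt.append (l := [i]) (l' := l) (by simpa using h)).2
  simpa using this

/-- All instructions of the list are followed by the next one. -/
def Straight (l : List Instr) : Prop :=
  ∀ i ∈ l, ∀ (w : ℕ) (c : Config w), (exec c i).pc = c.pc + 1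

namespace Straight

@[simp] theorem nil : Straight [] := by simp [Straight]

@[simp] theorem append {l l' : List Instr} : Straight (l ++ l') ↔ Straight l ∧ Straight l' := by
  simp [Straight, or_imp, forall_and]

theorem cons {i : Instr} {l : List Instr} :
    Straight (i :: l) ↔ Straight [i] ∧ Straight l := by
  simp [Straight]

@[simp] theorem replicate {v : ℕ} {i : Instr} (h : Straight [i]) :
    Straight (List.replicate v i) := by
  intro j hj
  obtain rfl := List.eq_of_mem_replicate hj
  exact h j (by simp)

@[simp] theorem radd (d a b : ℕ) : Straight [.radd d a b] := by simp [Straight, exec]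
@[simp] theorem rsub (d a b : ℕ) : Straight [.rsub d a b] := by simp [Straight, exec]
@[simp] theorem floor (d : List ℕ) (a : ℕ) : Straight [.floor d a] := by simp [Straight, exec]
@[simp] theorem cast (d : ℕ) (a : List ℕ) : Straight [.cast d a] := by simp [Straight, exec]
@[simp] theorem const (d a : ℕ) : Straight [.const d a] := by simp [Straight, exec]
@[simp] theorem load (d : ℕ) (a : List ℕ) : Straight [.load d a] := by simp [Straight, exec]
@[simp] theorem store (d : ℕ) (a : List ℕ) : Straight [.store a d] := by simp [Straight, exec]
@[simp] theorem rload (d : ℕ) (a : List ℕ) : Straight [.rload d a] := by simp [Straight, exec]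
@[simp] theorem rstore (d : ℕ) (a : List ℕ) : Straight [.rstore a d] := by
  simp [Straight, exec]

theorem pc_foldl {w : ℕ} {l : List Instr} (hl : Straight l) (c : Config w) :
    (l.foldl exec c).pc = c.pc + l.length := by
  induction l generalizing c with
  | nil => rfl
  | cons i l ih =>
    rw [List.foldl_cons, ih (cons.1 hl).2, hl i (by simp)]
    simp; omega

theorem iterate {w : ℕ} {P : Program} {l : List Instr} (hl : Straight l)
    (c : Config w) (h : CodeAt P c.pc l) : (step P)^[l.length] c = l.foldl exec c := by
  induction l generalizing c with
  | nil => rfl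
  | cons i l ih =>
    obtain ⟨h1, h2⟩ := h.cons
    rw [List.length_cons, Function.iterate_succ_apply, List.foldl_cons]
    have : step P c = exec c i := by simp [step, h1]
    rw [this]
    exact ih (cons.1 hl).2 _ (by rwa [hl i (by simp)])

theorem compAdr (k t d : ℕ) : Straight (compAdr k t d) := by
  simp [RealRAM.compAdr, cons (l := _ ++ _), cons (l := _ :: _)]

theorem nexp (k : ℕ) (e : NExp) (t : ℕ) : Straight (e.comp k t) := by
  induction e generalizing t with
  | lit | var => simp [NExp.comp, cons (l := List.replicate _ _)]
  | add a b iha ihb | sub a b iha ihb => simp [NExp.comp, iha, ihb]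
  | mulc c a ih => simp [NExp.comp, ih, cons (l := List.replicate _ _)]
  | arr j a ih => simp [NExp.comp, ih, compAdr]

theorem rexp (k : ℕ) (e : RExp) (t : ℕ) : Straight (e.comp k t) := by
  induction e generalizing t with
  | var => simp [RExp.comp]
  | nat a => exact nexp k a t
  | add a b iha ihb | sub a b iha ihb => simp [RExp.comp, iha, ihb]
  | arr j a => simp [RExp.comp, nexp, compAdr]
  | inp a => simp [RExp.comp, nexp, cons (l := [_])]

theorem cond (k : ℕ) (b : Cond) : Straight (b.comp k) := by
  cases b <;> simp [Cond.comp, nexp, rexp]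

theorem prim (k : ℕ) (p : Prim) : Straight (p.comp k) := by
  cases p <;> simp [Prim.comp, nexp, rexp, compAdr, cons (l := _ :: _)]

end Straight

theorem setNum_of_notMem {w : ℕ} (reg : ℕ → BitVec w) (ds : List ℕ) (v : ℕ) {r : ℕ}
    (h : r ∉ ds) : setNum reg ds v r = reg r := by
  induction ds generalizing reg v with
  | nil => rfl
  | cons d ds ih =>
    simp only [List.mem_cons, not_or] at h
    rw [setNum, ih _ _ h.2, Function.update_of_ne h.1]

theorem num_setNum {w : ℕ} (reg : ℕ → BitVec w) (ds : List ℕ) (hd : ds.Nodup) (v : ℕ)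
    (hv : v < 2 ^ (w * ds.length)) : num (setNum reg ds v) ds = v := by
  induction ds generalizing reg v with
  | nil => simp at hv; simp [num, hv]
  | cons d ds ih =>
    rw [List.nodup_cons] at hd
    have hv' : v / 2 ^ w < 2 ^ (w * ds.length) := by
      rw [Nat.div_lt_iff_lt_mul (by positivity), ← pow_add]
      simpa [mul_add] using hv
    rw [setNum, num, ih _ hd.2 _ hv', setNum_of_notMem _ _ _ hd.1, Function.update_self,
      BitVec.toNat_ofNat, Nat.mod_add_div]

theorem setNum_range' {w : ℕ} (reg : ℕ → BitVec w) (a k v j : ℕ) (hj : j < k) :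
    setNum reg (List.range' a k) v (a + j) = BitVec.ofNat w (v / 2 ^ (w * j)) := by
  induction k generalizing reg a v j with
  | zero => omega
  | succ k ih =>
    rw [List.range'_succ, setNum]
    cases j with
    | zero =>
      rw [setNum_of_notMem _ _ _ (by simp [List.mem_range']; omega)]
      simp
    | succ j =>
      have := ih (Function.update reg a (BitVec.ofNat w v)) (a + 1) (v / 2 ^ w) j (by omega)
      rw [show a + (j + 1) = a + 1 + j by omega, this, Nat.div_div_eq_div_mul, ← pow_add]
      congr 3; ring

theorem num_congr {w : ℕ} (reg reg' : ℕ → BitVec w) (l : List ℕ)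
    (h : ∀ r ∈ l, reg r = reg' r) : num reg l = num reg' l := by
  induction l with
  | nil => rfl
  | cons a l ih => simp_all [num]

/-- The machine configuration `c` represents the state `s`. -/
structure Rel (s : St E) (c : Config E.w) : Prop where
  mem : c.mem = s.out
  zero : c.rreg 0 = 0
  one : c.rreg 3 = 1
  size : c.rreg 6 = E.n
  nv : ∀ i, c.rreg (3 * i + 1) = s.nv i
  rv : ∀ i, c.rreg (3 * i + 2) = s.rv i
  inp : ∀ a < E.n, c.rmem a = E.x a
  na : ∀ (j : Fin 8) i, c.rmem (E.n + 16 * i + 2 * j) = s.na j i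
  ra : ∀ (j : Fin 8) i, c.rmem (E.n + 16 * i + (2 * j + 1)) = s.ra j i

/-- Between `c` and `c'` only word registers and temporaries from `t` on have changed. -/
structure Pres (t : ℕ) {w : ℕ} (c c' : Config w) : Prop where
  mem : c'.mem = c.mem
  rmem : c'.rmem = c.rmem
  rreg : ∀ r, r % 3 ≠ 0 ∨ r < tmpReg t → c'.rreg r = c.rreg r

theorem Pres.trans {t : ℕ} {w : ℕ} {c c' c'' : Config w} (h : Pres t c c') (h' : Pres t c' c'') :
    Pres t c c'' :=
  ⟨h'.mem.trans h.mem, h'.rmem.trans h.rmem, fun r hr => (h'.rreg r hr).trans (h.rreg r hr)⟩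

theorem Pres.mono {t t' : ℕ} {w : ℕ} {c c' : Config w} (h : Pres t' c c') (ht : t ≤ t') :
    Pres t c c' :=
  ⟨h.mem, h.rmem, fun r hr => h.rreg r (by unfold tmpReg at *; omega)⟩

theorem Rel.of_pres {s : St E} {t : ℕ} {c c' : Config E.w} (h : Rel s c) (h' : Pres t c c') :
    Rel s c' where
  mem := h'.mem.trans h.mem
  zero := (h'.rreg _ (by unfold tmpReg; omega)).trans h.zero
  one := (h'.rreg _ (by unfold tmpReg; omega)).trans h.one
  size := (h'.rreg _ (by unfold tmpReg; omega)).trans h.size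
  nv i := (h'.rreg _ (by omega)).trans (h.nv i)
  rv i := (h'.rreg _ (by omega)).trans (h.rv i)
  inp a ha := by rw [h'.rmem, h.inp a ha]
  na j i := by rw [h'.rmem, h.na]
  ra j i := by rw [h'.rmem, h.ra]

theorem foldl_replicate_radd {w : ℕ} (c : Config w) (v d a : ℕ) (h : a ≠ d) :
    (List.replicate v (Instr.radd d d a)).foldl exec c =
      { c with
        pc := c.pc + v
        rreg := Function.update c.rreg d (c.rreg d + v * c.rreg a) } := by
  induction v generalizing c with
  | zero => simp
  | succ v ih =>
    rw [List.replicate_succ, List.foldl_cons, ih]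
    simp only [exec, Function.update_self, Function.update_of_ne h, Function.update_idem]
    congr 1
    · omega
    · congr 1; push_cast; ring

/-- The temporary `t` gets the value `v`. -/
structure Computes (t : ℕ) (v : ℝ) {w : ℕ} (c c' : Config w) : Prop extends Pres t c c' where
  val : c'.rreg (tmpReg t) = v

theorem pres_update {w : ℕ} (t : ℕ) (c : Config w) (p : ℕ) (g : ℕ → BitVec w) (t' : ℕ)
    (ht : t ≤ t') (v : ℝ) :
    Pres t c { c with pc := p, reg := g, rreg := Function.update c.rreg (tmpReg t') v } :=
  ⟨rfl, rfl, fun r hr => Function.update_of_ne (by unfold tmpReg at *; omega) _ _⟩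

/-- This is how a natural number kept in a real register becomes an address: with at most `k` digits
it passes the range test of the floor instruction. -/
theorem num_floor {w : ℕ} (reg : ℕ → BitVec w) (a k : ℕ) (v : ℕ) (hv : v < 2 ^ (w * k)) :
    num (setNum reg (List.range' a k)
      (if 0 ≤ (v : ℝ) ∧ (v : ℝ) < (2 : ℝ) ^ (w * (List.range' a k).length) then ⌊(v : ℝ)⌋₊ else 0))
      (List.range' a k) = v := by
  have : 0 ≤ (v : ℝ) ∧ (v : ℝ) < (2 : ℝ) ^ (w * (List.range' a k).length) := by
    refine ⟨by positivity, ?_⟩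
    rw [List.length_range']
    exact_mod_cast hv
  rw [if_pos this, Nat.floor_natCast]
  exact num_setNum _ _ (List.nodup_range' (step := 1)) _ (by simpa using hv)

/-- After `compAdr` the address registers hold the address of an array cell. -/
theorem foldl_compAdr {c : Config E.w} (t d i : ℕ) (h1 : c.rreg 3 = 1) (h2 : c.rreg 6 = E.n)
    (h : c.rreg (tmpReg t) = i) (hd : d < 16) (hi : E.n + 16 * (i + 1) ≤ 2 ^ (E.w * E.k)) :
    Pres t c ((compAdr E.k t d).foldl exec c) ∧
      num ((compAdr E.k t d).foldl exec c).reg (adrRegs E.k) = E.n + 16 * i + d := by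
  have n3 : (3 : ℕ) ≠ tmpReg t := by unfold tmpReg; omega
  have n6 : (6 : ℕ) ≠ tmpReg t := by unfold tmpReg; omega
  have e : (List.replicate 4 (Instr.radd (tmpReg t) (tmpReg t) (tmpReg t))).foldl exec c =
      { c with
        pc := c.pc + 4
        rreg := Function.update c.rreg (tmpReg t) (16 * c.rreg (tmpReg t)) } := by
    simp only [List.replicate, List.foldl_cons, List.foldl_nil, exec, Function.update_self,
      Function.update_idem]
    congr 2; ring
  rw [compAdr, List.foldl_append, e, List.foldl_cons, List.foldl_append,
    foldl_replicate_radd _ _ _ _ n3]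
  simp only [List.foldl_cons, List.foldl_nil, exec, Function.update_self, Function.update_idem,
    Function.update_of_ne n6, Function.update_of_ne n3, h1, h2, h]
  constructor
  · exact pres_update _ _ _ _ _ le_rfl _
  · rw [show (16 * (i : ℝ) + E.n + d * 1) = ((E.n + 16 * i + d : ℕ) : ℝ) by push_cast; ring]
    exact num_floor _ _ _ _ (by omega)

/-- The left operand waits in temporary `t` while the right one is computed in `t + 1` and above, so
it survives. Real subtraction is correct because `Ok` excludes truncation. -/
theorem NExp.foldl_comp (s : St E) (e : NExp) (t : ℕ) (c : Config E.w) (hc : Rel s c)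
    (he : e.Ok s) : Computes t (e.eval s) c ((e.comp E.k t).foldl exec c) := by
  induction e generalizing t c with
  | lit v =>
    have n3 : (3 : ℕ) ≠ tmpReg t := by unfold tmpReg; omega
    rw [comp, List.foldl_cons, foldl_replicate_radd _ _ _ _ n3]
    simp only [exec, Function.update_idem]
    refine ⟨pres_update _ _ _ _ _ le_rfl _, ?_⟩
    simp [hc.zero, hc.one, Function.update_of_ne n3, eval]
  | var i =>
    refine ⟨pres_update _ _ _ _ _ le_rfl _, ?_⟩
    simp [comp, exec, hc.zero, hc.nv, eval]
  | add a b iha ihb =>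
    have ha := iha t c hc he.1
    have hb := ihb (t + 1) _ (hc.of_pres ha.toPres) he.2
    rw [comp, List.foldl_append, List.foldl_append]
    refine ⟨(ha.toPres.trans (hb.toPres.mono (by omega))).trans
      (pres_update _ _ _ _ _ le_rfl _), ?_⟩
    simp only [List.foldl_cons, List.foldl_nil, exec, Function.update_self, hb.val, eval]
    rw [hb.rreg _ (by unfold tmpReg; omega), ha.val]
    push_cast; ring
  | sub a b iha ihb =>
    have ha := iha t c hc he.1
    have hb := ihb (t + 1) _ (hc.of_pres ha.toPres) he.2.1
    rw [comp, List.foldl_append, List.foldl_append]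
    refine ⟨(ha.toPres.trans (hb.toPres.mono (by omega))).trans
      (pres_update _ _ _ _ _ le_rfl _), ?_⟩
    simp only [List.foldl_cons, List.foldl_nil, exec, Function.update_self, hb.val, eval]
    rw [hb.rreg _ (by unfold tmpReg; omega), ha.val, Nat.cast_sub he.2.2]
  | mulc m a ih =>
    have ha := ih (t + 1) c hc he
    have hr := hc.of_pres ha.toPres
    have n3 : tmpReg (t + 1) ≠ tmpReg t := by unfold tmpReg; omega
    rw [comp, List.foldl_append, List.foldl_cons, foldl_replicate_radd _ _ _ _ n3]
    simp only [exec, Function.update_idem]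
    refine ⟨(ha.toPres.mono (by omega)).trans (pres_update _ _ _ _ _ le_rfl _), ?_⟩
    simp [Function.update_of_ne n3, hr.zero, ha.val, eval]
  | arr j a ih =>
    have ha := ih t c hc he.1
    have hr := hc.of_pres ha.toPres
    have hA := foldl_compAdr t (2 * j) _ hr.one hr.size ha.val (by omega) he.2
    have hr2 := hr.of_pres hA.1
    rw [comp, List.foldl_append, List.foldl_append]
    refine ⟨(ha.toPres.trans hA.1).trans (pres_update _ _ _ _ _ le_rfl _), ?_⟩
    simp only [List.foldl_cons, List.foldl_nil, exec, Function.update_self, hA.2, hr2.na, eval]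

theorem RExp.foldl_comp (s : St E) (e : RExp) (t : ℕ) (c : Config E.w) (hc : Rel s c)
    (he : e.Ok s) : Computes t (e.eval s) c ((e.comp E.k t).foldl exec c) := by
  induction e generalizing t c with
  | var i =>
    refine ⟨pres_update _ _ _ _ _ le_rfl _, ?_⟩
    simp [comp, exec, hc.zero, hc.rv, eval]
  | nat a => exact a.foldl_comp s t c hc he
  | add a b iha ihb =>
    have ha := iha t c hc he.1
    have hb := ihb (t + 1) _ (hc.of_pres ha.toPres) he.2
    rw [comp, List.foldl_append, List.foldl_append]
    refine ⟨(ha.toPres.trans (hb.toPres.mono (by omega))).trans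
      (pres_update _ _ _ _ _ le_rfl _), ?_⟩
    simp only [List.foldl_cons, List.foldl_nil, exec, Function.update_self, hb.val, eval]
    rw [hb.rreg _ (by unfold tmpReg; omega), ha.val]
  | sub a b iha ihb =>
    have ha := iha t c hc he.1
    have hb := ihb (t + 1) _ (hc.of_pres ha.toPres) he.2
    rw [comp, List.foldl_append, List.foldl_append]
    refine ⟨(ha.toPres.trans (hb.toPres.mono (by omega))).trans
      (pres_update _ _ _ _ _ le_rfl _), ?_⟩
    simp only [List.foldl_cons, List.foldl_nil, exec, Function.update_self, hb.val, eval]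
    rw [hb.rreg _ (by unfold tmpReg; omega), ha.val]
  | arr j a =>
    have ha := a.foldl_comp s t c hc he.1
    have hr := hc.of_pres ha.toPres
    have hA := foldl_compAdr t (2 * j + 1) _ hr.one hr.size ha.val (by omega) he.2
    have hr2 := hr.of_pres hA.1
    rw [comp, List.foldl_append, List.foldl_append]
    refine ⟨(ha.toPres.trans hA.1).trans (pres_update _ _ _ _ _ le_rfl _), ?_⟩
    simp only [List.foldl_cons, List.foldl_nil, exec, Function.update_self, hA.2, hr2.ra, eval]
  | inp a =>
    have ha := a.foldl_comp s t c hc he.1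
    have hr := hc.of_pres ha.toPres
    rw [comp, List.foldl_append]
    refine ⟨ha.toPres.trans (pres_update _ _ _ _ _ le_rfl _), ?_⟩
    simp only [List.foldl_cons, List.foldl_nil, exec, Function.update_self, ha.val, eval]
    rw [adrRegs, num_floor _ _ _ _ (he.2.1.trans_le he.2.2), hr.inp _ he.2.1]

/-- Shared by assignment and floor. Natural variables occupy exactly the registers congruent to `1`
modulo `3`, so constants, real variables and temporaries are not hit. -/
theorem Rel.nset {s : St E} {c c' : Config E.w} (h : Rel s c) {i v : ℕ} {t : ℕ}
    (hm : c'.mem = c.mem) (hrm : c'.rmem = c.rmem)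
    (hr : c'.rreg = Function.update c.rreg (3 * i + 1) v) :
    Rel { s with nv := Function.update s.nv i v, tm := t } c' where
  mem := hm.trans h.mem
  zero := by rw [hr, Function.update_of_ne (by omega), h.zero]
  one := by rw [hr, Function.update_of_ne (by omega), h.one]
  size := by rw [hr, Function.update_of_ne (by omega), h.size]
  nv j := by
    by_cases hj : j = i
    · simp [hj, hr]
    · rw [hr, Function.update_of_ne (by omega), h.nv]; simp [hj]
  rv j := by rw [hr, Function.update_of_ne (by omega), h.rv]
  inp a ha := by rw [hrm, h.inp a ha]
  na j i := by rw [hrm, h.na]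
  ra j i := by rw [hrm, h.ra]

/-- For array writes the point is that an address `E.n + 16 * i + d` with `d < 16` determines `i`
and `d`, that the parity of `d` separates natural from real arrays, and that the input lies below
`E.n`. -/
theorem Prim.foldl_comp (s : St E) (p : Prim) (c : Config E.w) (hc : Rel s c) (hp : p.Ok s) :
    Rel (p.run s) ((p.comp E.k).foldl exec c) := by
  cases p with
  | nset i e =>
    have ha := e.foldl_comp s 0 c hc hp
    have hr := hc.of_pres ha.toPres
    rw [comp, List.foldl_append]
    refine hr.nset rfl rfl ?_
    simp [exec, ha.val, hr.zero]
  | rset i e =>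
    have ha := e.foldl_comp s 0 c hc hp
    have hr := hc.of_pres ha.toPres
    rw [comp, List.foldl_append]
    simp only [List.foldl_cons, List.foldl_nil, exec, ha.val, hr.zero, add_zero, run]
    constructor
    · exact hr.mem
    · simp [hr.zero]
    · dsimp only; rw [Function.update_of_ne (by omega), hr.one]
    · dsimp only; rw [Function.update_of_ne (by omega), hr.size]
    · intro j; dsimp only; rw [Function.update_of_ne (by omega), hr.nv]
    · intro j
      by_cases hj : j = i
      · simp [hj]
      · dsimp only; rw [Function.update_of_ne (by omega), hr.rv]; simp [hj]
    · exact hr.inp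
    · exact hr.na
    · exact hr.ra
  | floor i e =>
    have ha := e.foldl_comp s 0 c hc hp.1
    have hr := hc.of_pres ha.toPres
    rw [comp, List.foldl_append]
    refine hr.nset rfl rfl ?_
    simp only [List.foldl_cons, List.foldl_nil, exec, ha.val]
    congr 2
    rw [if_pos (by simpa only [valRegs, List.length_range'] using hp.2)]
    refine num_setNum _ _ (List.nodup_range' (step := 1)) _ ?_
    simp only [List.length_range']
    rw [Nat.floor_lt hp.2.1]
    exact_mod_cast hp.2.2
  | nput j a e =>
    have he := e.foldl_comp s 0 c hc hp.2.1
    have hr := hc.of_pres he.toPres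
    have ha := a.foldl_comp s 1 _ hr hp.1
    have hr2 := hr.of_pres ha.toPres
    have hA := foldl_compAdr 1 (2 * j) _ hr2.one hr2.size ha.val (by omega) hp.2.2
    have hr3 := hr2.of_pres hA.1
    rw [comp, List.foldl_append, List.foldl_append, List.foldl_append]
    simp only [List.foldl_cons, List.foldl_nil, exec, hA.2]
    rw [hA.1.rreg _ (by unfold tmpReg; omega), ha.rreg _ (by unfold tmpReg; omega), he.val]
    constructor
    · exact hr3.mem
    · exact hr3.zero
    · exact hr3.one
    · exact hr3.size
    · exact hr3.nv
    · exact hr3.rv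
    · intro b hb; dsimp only; rw [Function.update_of_ne (by omega), hr3.inp _ hb]
    · intro j' i
      dsimp only [run]
      by_cases hj : j' = j
      · subst hj
        by_cases hi : i = a.eval s
        · simp [hi]
        · rw [Function.update_of_ne (by omega), hr3.na]; simp [hi]
      · have : (j' : ℕ) ≠ j := fun h => hj (Fin.ext h)
        rw [Function.update_of_ne (by omega), hr3.na]; simp [hj]
    · intro j' i
      dsimp only [run]
      rw [Function.update_of_ne (by omega), hr3.ra]
  | rput j a e =>
    have he := e.foldl_comp s 0 c hc hp.2.1
    have hr := hc.of_pres he.toPres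
    have ha := a.foldl_comp s 1 _ hr hp.1
    have hr2 := hr.of_pres ha.toPres
    have hA := foldl_compAdr 1 (2 * j + 1) _ hr2.one hr2.size ha.val (by omega) hp.2.2
    have hr3 := hr2.of_pres hA.1
    rw [comp, List.foldl_append, List.foldl_append, List.foldl_append]
    simp only [List.foldl_cons, List.foldl_nil, exec, hA.2]
    rw [hA.1.rreg _ (by unfold tmpReg; omega), ha.rreg _ (by unfold tmpReg; omega), he.val]
    constructor
    · exact hr3.mem
    · exact hr3.zero
    · exact hr3.one
    · exact hr3.size
    · exact hr3.nv
    · exact hr3.rv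
    · intro b hb; dsimp only; rw [Function.update_of_ne (by omega), hr3.inp _ hb]
    · intro j' i
      dsimp only [run]
      rw [Function.update_of_ne (by omega), hr3.na]
    · intro j' i
      dsimp only [run]
      by_cases hj : j' = j
      · subst hj
        by_cases hi : i = a.eval s
        · simp [hi]
        · rw [Function.update_of_ne (by omega), hr3.ra]; simp [hi]
      · have : (j' : ℕ) ≠ j := fun h => hj (Fin.ext h)
        rw [Function.update_of_ne (by omega), hr3.ra]; simp [hj]
  | out j a e =>
    have he := e.foldl_comp s 0 c hc hp.2.1
    have hr := hc.of_pres he.toPres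
    have ha := a.foldl_comp s 1 _ hr hp.1
    have hr2 := hr.of_pres ha.toPres
    obtain ⟨-, -, hj, ha', he'⟩ := hp
    rw [comp, List.foldl_append, List.foldl_append]
    simp only [List.foldl_cons, List.foldl_nil, exec, ha.val]
    rw [ha.rreg _ (by unfold tmpReg; omega), he.val]
    have e2 : (if 0 ≤ ((e.eval s : ℕ) : ℝ) ∧
        ((e.eval s : ℕ) : ℝ) < (2 : ℝ) ^ (E.w * (valRegs E.k).length)
        then ⌊((e.eval s : ℕ) : ℝ)⌋₊ else 0) = e.eval s := by
      rw [if_pos, Nat.floor_natCast]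
      refine ⟨by positivity, ?_⟩
      rw [valRegs, List.length_range']
      exact_mod_cast he'
    rw [e2]
    constructor
    · dsimp only [run]
      rw [adrRegs, num_floor _ _ _ _ ha', hr2.mem, setNum_of_notMem _ _ _ (by simp; omega),
        valRegs]
      have := setNum_range'
        (List.foldl exec (List.foldl exec c (e.comp E.k 0)) (a.comp E.k 1)).reg 0 E.k
        (e.eval s) j hj
      rw [zero_add] at this
      rw [this]
    · exact hr2.zero
    · exact hr2.one
    · exact hr2.size
    · exact hr2.nv
    · exact hr2.rv
    · exact hr2.inp
    · exact hr2.na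
    · exact hr2.ra

theorem Cond.foldl_comp (s : St E) (b : Cond) (c : Config E.w) (hc : Rel s c) (hb : b.Ok s) :
    Rel s ((b.comp E.k).foldl exec c) ∧
      (((b.comp E.k).foldl exec c).rreg (tmpReg 0) < ((b.comp E.k).foldl exec c).rreg (tmpReg 1)
        ↔ b.Holds s) := by
  cases b with
  | nlt a b =>
    have ha := a.foldl_comp s 0 c hc hb.1
    have hr := hc.of_pres ha.toPres
    have hb' := b.foldl_comp s 1 _ hr hb.2
    rw [comp, List.foldl_append, hb'.val, hb'.rreg _ (by unfold tmpReg; omega), ha.val]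
    exact ⟨hr.of_pres hb'.toPres, by simp [Holds]⟩
  | rlt a b =>
    have ha := a.foldl_comp s 0 c hc hb.1
    have hr := hc.of_pres ha.toPres
    have hb' := b.foldl_comp s 1 _ hr hb.2
    rw [comp, List.foldl_append, hb'.val, hb'.rreg _ (by unfold tmpReg; omega), ha.val]
    exact ⟨hr.of_pres hb'.toPres, by simp [Holds]⟩

theorem Rel.tick {s : St E} {c : Config E.w} (h : Rel s c) : Rel s.tick c :=
  ⟨h.mem, h.zero, h.one, h.size, h.nv, h.rv, h.inp, h.na, h.ra⟩

theorem Rel.pc {s : St E} {c : Config E.w} (h : Rel s c) (p : ℕ) : Rel s { c with pc := p } :=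
  ⟨h.mem, h.zero, h.one, h.size, h.nv, h.rv, h.inp, h.na, h.ra⟩

/-- The compiled code of a test together with the following conditional jump. -/
theorem Cond.iterate_comp {s : St E} {b : Cond} {c : Config E.w} (hc : Rel s c) (hb : b.Ok s)
    {P : Program} {l : ℕ}
    (hP : CodeAt P c.pc (b.comp E.k ++ [.rjumpLt (tmpReg 0) (tmpReg 1) l])) :
    ∃ c', (step P)^[(b.comp E.k).length + 1] c = c' ∧ Rel s c' ∧ (b.Holds s → c'.pc = l) ∧
      (¬ b.Holds s → c'.pc = c.pc + ((b.comp E.k).length + 1)) := by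
  obtain ⟨h1, h2⟩ := hP.append
  obtain ⟨h3, h4⟩ := b.foldl_comp s c hc hb
  have hpc := (Straight.cond E.k b).pc_foldl c
  refine ⟨_, rfl, ?_⟩
  rw [Function.iterate_succ_apply', (Straight.cond E.k b).iterate c h1]
  have : step P ((b.comp E.k).foldl exec c) =
      exec ((b.comp E.k).foldl exec c) (.rjumpLt (tmpReg 0) (tmpReg 1) l) := by
    rw [step, hpc, h2.cons.1]
  rw [this]
  refine ⟨h3.pc _, fun h => if_pos (h4.2 h), fun h => (if_neg (mt h4.1 h)).trans ?_⟩
  omega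

/-- Compiled statements simulate statements. -/
theorem Runs.simulates {S : Stmt} {s s' : St E} (h : Runs S s s') {D : ℕ} (hD : S.slow E.k ≤ D)
    {P : Program} {c : Config E.w} (hP : CodeAt P c.pc (S.comp E.k c.pc)) (hc : Rel s c) :
    ∃ m, ((step P)^[m] c).pc = c.pc + S.size E.k ∧ Rel s' ((step P)^[m] c) ∧
      m + D * s.tm ≤ D * s'.tm := by
  -- The inequality `m + D * s.tm ≤ D * s'.tm` is additive along a run: each tick of the clock pays
  -- for `D` machine steps, which covers a basic statement or a test with its jumps.
  induction h generalizing c with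
  | @prim p s hp =>
    refine ⟨(p.comp E.k).length, ?_⟩
    rw [(Straight.prim E.k p).iterate c hP]
    refine ⟨(Straight.prim E.k p).pc_foldl c, p.foldl_comp s c hc hp, ?_⟩
    have : (p.run s).tm = s.tm + 1 := by cases p <;> rfl
    rw [this, mul_add, mul_one]
    have : (p.comp E.k).length ≤ D := hD
    omega
  | @seq a b s s1 s2 h1 h2 ih1 ih2 =>
    simp only [Stmt.slow] at hD
    obtain ⟨hPa, hPb⟩ := CodeAt.append hP
    obtain ⟨m1, hpc, hr, ht⟩ := ih1 (by omega) hPa hc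
    obtain ⟨m2, hpc2, hr2, ht2⟩ := ih2 (c := (step P)^[m1] c) (by omega)
      (by rw [hpc]; rwa [Stmt.length_comp] at hPb) hr
    refine ⟨m2 + m1, ?_⟩
    rw [Function.iterate_add_apply]
    exact ⟨by rw [hpc2, hpc, Stmt.size]; omega, hr2, by omega⟩
  | @ite_true b S1 S2 s s1 hok hb h ih =>
    simp only [Stmt.slow] at hD
    obtain ⟨hP1, hP2⟩ := CodeAt.append hP
    obtain ⟨c1, hc1, hr1, hpt, -⟩ := Cond.iterate_comp hc hok hP1
    have hP3 := ((CodeAt.append hP2).2.cons).2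
    rw [Stmt.length_comp] at hP3
    obtain ⟨m, hpc, hr, ht⟩ := ih (c := c1) (by omega) (by
      rw [hpt hb]
      convert hP3 using 1
      · simp; omega
      · congr 1) hr1.tick
    refine ⟨m + ((b.comp E.k).length + 1), ?_⟩
    rw [Function.iterate_add_apply, hc1]
    refine ⟨by rw [hpc, hpt hb, Stmt.size]; omega, hr, ?_⟩
    simp only [St.tick, mul_add, mul_one] at ht
    omega
  | @ite_false b S1 S2 s s1 hok hb h ih =>
    simp only [Stmt.slow] at hD
    obtain ⟨hP1, hP2⟩ := CodeAt.append hP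
    obtain ⟨c1, hc1, hr1, -, hpf⟩ := Cond.iterate_comp hc hok hP1
    obtain ⟨hP3, hP4⟩ := CodeAt.append hP2
    obtain ⟨m, hpc, hr, ht⟩ := ih (c := c1) (by omega) (by
      rw [hpf hb]
      convert hP3 using 1
      simp) hr1.tick
    have hj := hP4.cons.1
    rw [Stmt.length_comp] at hj
    refine ⟨1 + (m + ((b.comp E.k).length + 1)), ?_⟩
    rw [Function.iterate_add_apply, Function.iterate_add_apply, hc1, Function.iterate_one]
    have : step P ((step P)^[m] c1) = exec ((step P)^[m] c1)
        (.jump (c.pc + ((b.comp E.k).length + 1) + (S2.size E.k + 1 + S1.size E.k))) := by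
      rw [step, hpc, hpf hb]
      simp only [List.length_append, List.length_singleton] at hj
      rw [hj]
    rw [this]
    refine ⟨by simp only [exec, Stmt.size]; omega, hr.pc _, ?_⟩
    simp only [St.tick, mul_add, mul_one] at ht
    omega
  | @loop_true b S s s1 s2 hok hb h1 h2 ih1 ih2 =>
    simp only [Stmt.slow] at hD
    have hP0 := hP
    obtain ⟨hP1, hP2⟩ := CodeAt.append hP
    obtain ⟨hP3, hP4⟩ := CodeAt.append hP2
    obtain ⟨c1, hc1, hr1, hpt, -⟩ := Cond.iterate_comp hc hok
      (CodeAt.append (l := b.comp E.k ++ [.rjumpLt (tmpReg 0) (tmpReg 1) _])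
        (l' := [.jump _]) (by simpa using hP1)).1
    obtain ⟨m, hpc, hr, ht⟩ := ih1 (c := c1) (by omega) (by
      rw [hpt hb]
      convert hP3 using 1
      simp) hr1.tick
    have hj := hP4.cons.1
    rw [Stmt.length_comp] at hj
    have hs : step P ((step P)^[m] c1) = exec ((step P)^[m] c1) (.jump c.pc) := by
      rw [step, hpc, hpt hb]
      simp only [List.length_append, List.length_cons, List.length_nil] at hj
      simp only [zero_add, Nat.reduceAdd] at hj
      rw [hj]
    obtain ⟨m2, hpc2, hr2, ht2⟩ := ih2 (c := exec ((step P)^[m] c1) (.jump c.pc))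
      (by simp only [Stmt.slow]; omega) hP0 (hr.pc _)
    refine ⟨m2 + (1 + (m + ((b.comp E.k).length + 1))), ?_⟩
    rw [Function.iterate_add_apply, Function.iterate_add_apply, Function.iterate_add_apply, hc1,
      Function.iterate_one, hs]
    refine ⟨hpc2, hr2, ?_⟩
    simp only [St.tick, mul_add, mul_one] at ht
    omega
  | @loop_false b S s hok hb =>
    simp only [Stmt.slow] at hD
    obtain ⟨hP1, hP2⟩ := CodeAt.append hP
    obtain ⟨hP5, hP6⟩ := CodeAt.append
      (l := b.comp E.k ++ [.rjumpLt (tmpReg 0) (tmpReg 1) _])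
        (l' := [.jump _]) (by simpa using hP1)
    obtain ⟨c1, hc1, hr1, -, hpf⟩ := Cond.iterate_comp hc hok hP5
    have hj := hP6.cons.1
    refine ⟨1 + ((b.comp E.k).length + 1), ?_⟩
    rw [Function.iterate_add_apply, hc1, Function.iterate_one]
    have : step P c1 = exec c1
        (.jump (c.pc + ((b.comp E.k).length + 2) + (S.size E.k + 1))) := by
      rw [step, hpf hb]
      simp only [List.length_append, List.length_singleton] at hj
      rw [hj]
    rw [this]
    refine ⟨by simp only [exec, Stmt.size]; omega, hr1.tick.pc _, ?_⟩
    simp only [St.tick, mul_add, mul_one]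
    omega

/-! ### Start of a program -/

/-- One step of reading the size of the input. -/
def readStep (k j : ℕ) : List Instr :=
  [.floor (adrRegs k) (tmpReg 0), .load j (adrRegs k), .radd (tmpReg 0) (tmpReg 0) 3]

/-- Read the first `m` digits of the size of the input. -/
def readDigits (k : ℕ) : ℕ → List Instr
  | 0 => []
  | m + 1 => readDigits k m ++ readStep k m

/-- Set up the real constants and the size of the input. -/
def prologue (k : ℕ) : List Instr :=
  [.const (2 * k) 1, .cast 3 [2 * k]] ++ (readDigits k k ++
    -- Register `6` is the constant `n`; register `1` is natural variable `0`.
    [.cast 6 (valRegs k), .cast 1 (valRegs k)])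

theorem straight_readDigits (k m : ℕ) : Straight (readDigits k m) := by
  induction m with
  | zero => simp [readDigits]
  | succ m ih => simp [readDigits, readStep, ih, Straight.cons (l := _ :: _)]

theorem straight_prologue (k : ℕ) : Straight (prologue k) := by
  simp [prologue, straight_readDigits, Straight.cons (l := _ :: _), Straight.cons (l := _ ++ _)]

/-- A real temporary counts the addresses `0, 1, …`; `hk` makes them representable. The address
registers start at `k`, so the digits already read are not overwritten. -/
theorem foldl_readDigits (c : Config E.w) (h1 : c.rreg 3 = 1) (h0 : c.rreg (tmpReg 0) = 0)
    (m : ℕ) (hm : m ≤ E.k) (hk : E.k ≤ 2 ^ (E.w * E.k)) :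
    Pres 0 c ((readDigits E.k m).foldl exec c) ∧
      ((readDigits E.k m).foldl exec c).rreg (tmpReg 0) = m ∧
      ∀ i < m, ((readDigits E.k m).foldl exec c).reg i = c.mem i := by
  induction m with
  | zero => exact ⟨⟨rfl, rfl, fun _ _ => rfl⟩, by simp [readDigits, h0], by simp⟩
  | succ m ih =>
    obtain ⟨hp, ht, hd⟩ := ih (by omega)
    rw [readDigits, List.foldl_append]
    simp only [readStep, List.foldl_cons, List.foldl_nil, exec, ht]
    refine ⟨hp.trans (pres_update _ _ _ _ _ le_rfl _), ?_, ?_⟩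
    · rw [hp.rreg 3 (by unfold tmpReg; omega), h1]; simp
    · intro i hi
      by_cases h : i = m
      · subst h
        rw [adrRegs, num_floor _ _ _ _ (by omega), hp.mem]; simp
      · simp only [Function.update_of_ne h]
        rw [setNum_of_notMem _ _ _ (by simp [adrRegs]; omega), hd i (by omega)]

/-- The state in which the main statement is run. -/
def init (E : Env) : St E where
  nv := fun i => if i = 0 then E.n else 0
  rv := fun _ => 0
  na := fun _ _ => 0
  ra := fun _ _ => 0
  out := fun a => BitVec.ofNat E.w (E.n / 2 ^ (E.w * a))
  tm := 0

theorem num_valRegs {w : ℕ} (reg : ℕ → BitVec w) (k v : ℕ) (hv : v < 2 ^ (w * k))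
    (h : ∀ i < k, reg i = BitVec.ofNat w (v / 2 ^ (w * i))) : num reg (valRegs k) = v := by
  rw [num_congr reg (setNum reg (valRegs k) v)]
  · exact num_setNum _ _ (List.nodup_range' (step := 1)) _ (by simpa [valRegs] using hv)
  · intro r hr
    have hr : r < k := by simpa [valRegs] using hr
    have := setNum_range' reg 0 k v r hr
    rw [zero_add] at this
    rw [valRegs, this, h r hr]

theorem rel_prologue (hw : 1 ≤ E.w) (hk : E.k ≤ 2 ^ (E.w * E.k))
    (hn : E.n < 2 ^ (E.w * E.k)) (c : Config E.w)
    (hmem : c.mem = (init E).out) (hr : c.rreg = fun _ => 0)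
    (hrm : c.rmem = fun a => if a < E.n then E.x a else 0) :
    Rel (init E) ((prologue E.k).foldl exec c) := by
  rw [prologue, List.foldl_append, List.foldl_append]
  set c1 := [Instr.const (2 * E.k) 1, .cast 3 [2 * E.k]].foldl exec c with hc1
  have h3 : c1.rreg = Function.update (fun _ => 0) 3 1 := by
    have : 1 % 2 ^ E.w = 1 := Nat.mod_eq_of_lt (Nat.one_lt_two_pow (by omega))
    simp [hc1, exec, num, hr, this]
  obtain ⟨hp, -, hd⟩ := foldl_readDigits c1 (by simp [h3]) (by simp [h3, tmpReg]) E.k le_rfl hk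
  set c2 := (readDigits E.k E.k).foldl exec c1
  have hm2 : c2.mem = (init E).out := by rw [hp.mem, hc1]; simp [exec, hmem]
  have hrm2 : c2.rmem = fun a => if a < E.n then E.x a else 0 := by
    rw [hp.rmem, hc1]; simp [exec, hrm]
  have hnum : num c2.reg (valRegs E.k) = E.n := by
    refine num_valRegs _ _ _ hn fun i hi => ?_
    rw [hd i hi, hc1]
    simp [exec, hmem, init]
  have hz : ∀ r, r % 3 ≠ 0 ∨ r < 9 → c2.rreg r = if r = 3 then 1 else 0 := by
    intro r hr
    rw [hp.rreg r (by unfold tmpReg; omega), h3]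
    simp [Function.update_apply]
  simp only [List.foldl_cons, List.foldl_nil, exec, hnum]
  constructor
  · exact hm2
  · simp [hz]
  · simp [hz]
  · simp
  · intro i
    dsimp only [init]
    rw [Function.update_apply, Function.update_apply]
    split_ifs with h1 h2
    · rfl
    · omega
    · omega
    · omega
    · omega
    · rw [hz _ (by omega), if_neg (by omega)]; simp
  · intro i
    dsimp only [init]
    rw [Function.update_of_ne (by omega), Function.update_of_ne (by omega), hz _ (by omega),
      if_neg (by omega)]
  · intro a ha; simp [hrm2, ha]
  · intro j i; simp only [hrm2, init]; rw [if_neg (by omega)]; simp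
  · intro j i; simp only [hrm2, init]; rw [if_neg (by omega)]

/-- The machine program for a statement. -/
def program (k : ℕ) (S : Stmt) : Program := prologue k ++ S.comp k (prologue k).length

/-- A statement that runs from the initial state yields a halting machine computation. -/
theorem program_halts {k w n : ℕ} (x : Fin n → ℝ) (S : Stmt) (hw : 1 ≤ w)
    (hk : k ≤ 2 ^ (w * k)) (hn : n < 2 ^ (w * k)) {T : ℕ} {Q : (ℕ → BitVec w) → Prop}
    (h : wp S (init ⟨k, w, n, fun a => if h : a < n then x ⟨a, h⟩ else 0⟩)
      (fun s => s.tm ≤ T ∧ Q s.out)) :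
    ∃ m ≤ (prologue k).length + S.slow k * T,
      Halted (program k S) ((step (program k S))^[m] (start w x)) ∧
        Q ((step (program k S))^[m] (start w x)).mem := by
  obtain ⟨s, hr, ht, hQ⟩ := h
  obtain ⟨hP1, hP2⟩ := CodeAt.append (P := program k S) (o := 0) (l := prologue k)
    (l' := S.comp k (prologue k).length) (by intro i _; simp [program])
  have e1 := (straight_prologue k).iterate (start w x) hP1
  have e2 := (straight_prologue k).pc_foldl (start w x)
  have hrel := rel_prologue (E := ⟨k, w, n, fun a => if h : a < n then x ⟨a, h⟩ else 0⟩)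
    hw hk hn (start w x) rfl rfl
    (by funext a; by_cases h : a < n <;> simp [start, h])
  have e3 : ((prologue k).foldl exec (start w x)).pc = (prologue k).length := by
    rw [e2]; simp [start]
  obtain ⟨m, hpc, hrel', hm⟩ := hr.simulates le_rfl (P := program k S) (by
    rw [e3]; simpa using hP2) hrel
  refine ⟨m + (prologue k).length, ?_, ?_⟩
  · have : S.slow k * s.tm ≤ S.slow k * T := Nat.mul_le_mul_left _ ht
    simp only [init, mul_zero] at hm
    omega
  · rw [Function.iterate_add_apply, e1]
    refine ⟨?_, by rw [hrel'.mem]; exact hQ⟩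
    rw [Halted, hpc, e3]
    simp [program, Stmt.length_comp]

/-! ### Preparation: powers of two, maximum, integral and fractional parts -/

infixr:60 " ;; " => Stmt.seq

/-- `x ← e` for natural variables. -/
abbrev Stmt.nset (i : ℕ) (e : NExp) : Stmt := .prim (.nset i e)
/-- `x ← e` for real variables. -/
abbrev Stmt.rset (i : ℕ) (e : RExp) : Stmt := .prim (.rset i e)
/-- `x[a] ← e` for natural arrays. -/
abbrev Stmt.nput (j : Fin 8) (a e : NExp) : Stmt := .prim (.nput j a e)
/-- `x[a] ← e` for real arrays. -/
abbrev Stmt.rput (j : Fin 8) (a : NExp) (e : RExp) : Stmt := .prim (.rput j a e)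
/-- Do nothing. -/
abbrev Stmt.skip : Stmt := .prim (.nset 0 (.var 0))
/-- Increment a natural variable. -/
abbrev Stmt.incr (i : ℕ) : Stmt := .prim (.nset i (.add (.var i) (.lit 1)))

attribute [simp] wp_prim wp_seq wp_ite Prim.Ok Prim.run NExp.Ok NExp.eval RExp.Ok RExp.eval
  Cond.Ok Cond.Holds St.tick

open Stmt

/-- Real array `0` becomes a table of powers of two. -/
def powersStmt : Stmt :=
  rput 0 (.lit 0) (.nat (.lit 1)) ;; nset 1 (.lit 0) ;;
  loop (.nlt (.var 1) (.mulc 2 (.var 0)))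
    (rput 0 (.add (.var 1) (.lit 1)) (.add (.arr 0 (.var 1)) (.arr 0 (.var 1))) ;; incr 1)

/-- The size of the input is in place and the table of powers of two is filled. -/
structure Powers (s : St E) : Prop where
  size : s.nv 0 = E.n
  pow : ∀ j ≤ 2 * E.n, s.ra 0 j = 2 ^ j
  head : ∀ v, s.na 3 v = 0

/-- The largest powers have about `2 * n` bits, too many for a constant number of words, but as
reals they cost one addition each. The hypothesis on array `3` is carried along because these zeros
will serve as the empty lists of all levels. -/
theorem wp_powersStmt (hL : 1000 * E.n ≤ 2 ^ (E.w * E.k)) (hn : 1 ≤ E.n) (s : St E)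
    (hs : s.nv 0 = E.n) (hh : ∀ v, s.na 3 v = 0) :
    wp powersStmt s (fun s' => Powers s' ∧ s'.tm ≤ s.tm + 20 * E.n) := by
  simp only [powersStmt, wp_seq, wp_prim, Prim.Ok, Prim.run, NExp.Ok, NExp.eval, RExp.Ok, RExp.eval,
    true_and]
  refine ⟨by omega, ?_⟩
  refine wp_loop (fun s' => s'.nv 0 = E.n ∧ s'.nv 1 ≤ 2 * E.n ∧
    (∀ j ≤ s'.nv 1, s'.ra 0 j = 2 ^ j) ∧ ∀ v, s'.na 3 v = 0)
    (fun s' => 3 * (2 * E.n - s'.nv 1)) ?_ ?_ ?_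
  · simp [hs, hh]
  · rintro s' ⟨h0, h1, h2, h3⟩
    refine ⟨by simp, fun h => ?_⟩
    simp only [Cond.Holds, NExp.eval, h0] at h
    simp
    refine ⟨by omega, ⟨h0, by omega, fun j hj => ?_, h3⟩, by omega⟩
    by_cases hj' : j = s'.nv 1 + 1
    · subst hj'; simp [h2, pow_succ]; ring
    · rw [Function.update_of_ne hj', h2 _ (by omega)]
  · rintro s' ⟨h0, h1, h2, h3⟩ h ht
    simp [h0] at h ht ⊢
    refine ⟨⟨h0, fun j hj => h2 j (by omega), h3⟩, by omega⟩

/-- Real variable `0` becomes the maximum of the input. -/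
def maxStmt : Stmt :=
  rset 0 (.inp (.lit 0)) ;; nset 1 (.lit 1) ;;
  loop (.nlt (.var 1) (.var 0))
    (ite (.rlt (.var 0) (.inp (.var 1))) (rset 0 (.inp (.var 1))) skip ;; incr 1)

theorem wp_maxStmt (hL : 1000 * E.n ≤ 2 ^ (E.w * E.k)) (hn : 1 ≤ E.n) (s : St E)
    (hs : Powers s) :
    wp maxStmt s (fun s' => Powers s' ∧ ((∀ i < E.n, E.x i ≤ s'.rv 0) ∧
      ∃ i < E.n, E.x i = s'.rv 0) ∧ s'.tm ≤ s.tm + 20 * E.n) := by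
  simp only [maxStmt, wp_seq, wp_prim, Prim.Ok, Prim.run, NExp.Ok, NExp.eval, RExp.Ok, RExp.eval,
    true_and]
  refine ⟨⟨by omega, by omega⟩, ?_⟩
  refine wp_loop (fun s' => Powers s' ∧ s'.nv 1 ≤ E.n ∧ (∀ i < s'.nv 1, E.x i ≤ s'.rv 0) ∧
    ∃ i < E.n, E.x i = s'.rv 0) (fun s' => 4 * (E.n - s'.nv 1)) ?_ ?_ ?_
  · refine ⟨⟨by simp [hs.size], by simpa using hs.pow, hs.head⟩, by simpa using hn, ?_,
      0, by omega, by simp⟩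
    simp
  · rintro s' ⟨h0, h1, h2, h3⟩
    refine ⟨by simp, fun h => ?_⟩
    simp only [Cond.Holds, NExp.eval, h0.size] at h
    simp only [wp_seq, wp_ite, wp_prim, Prim.Ok, Prim.run, NExp.Ok, NExp.eval, RExp.Ok, RExp.eval,
      true_and, St.tick, Cond.Ok, Cond.Holds, Function.update_eq_self]
    refine ⟨⟨h, by omega⟩, fun hlt => ⟨⟨h, by omega⟩, ?_⟩, fun hlt => ?_⟩
    · refine ⟨⟨⟨by simp [h0.size], h0.pow, h0.head⟩, by simpa using h, ?_, _, h,
        by simp⟩, by simp; omega⟩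
      intro i hi
      simp at hi ⊢
      rcases hi.lt_or_eq with hi | rfl
      · exact (h2 i hi).trans hlt.le
      · exact le_rfl
    · refine ⟨⟨⟨by simp [h0.size], h0.pow, h0.head⟩, by simpa using h, ?_, h3⟩, by simp; omega⟩
      intro i hi
      simp at hi ⊢
      rcases hi.lt_or_eq with hi | rfl
      · exact h2 i hi
      · exact not_lt.1 hlt
  · rintro s' ⟨h0, h1, h2, h3⟩ h ht
    simp [h0.size] at h ht ⊢
    exact ⟨⟨h0.size, h0.pow, h0.head⟩, ⟨fun i hi => h2 i (by omega), h3⟩, by omega⟩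

/-- The weights, shifted and clamped to `[0, n]`. -/
noncomputable def Env.u (E : Env) (mx : ℝ) (i : ℕ) : ℝ := max (E.x i - mx + E.n) 0

/-- Compute integral parts (natural array `0`), fractional parts (real arrays `1` and `2`), the
corresponding powers of two (real array `3`) and their sum (real variable `2`). -/
def partsStmt : Stmt :=
  rset 2 (.nat (.lit 0)) ;; nset 1 (.lit 0) ;;
  loop (.nlt (.var 1) (.var 0))
    (rset 1 (.add (.sub (.inp (.var 1)) (.var 0)) (.nat (.var 0))) ;;
    ite (.rlt (.var 1) (.nat (.lit 0))) (rset 1 (.nat (.lit 0))) skip ;;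
    .prim (.floor 2 (.var 1)) ;;
    nput 0 (.var 1) (.var 2) ;;
    rput 1 (.var 1) (.sub (.var 1) (.nat (.var 2))) ;;
    rput 2 (.var 1) (.sub (.var 1) (.nat (.var 2))) ;;
    rput 3 (.var 1) (.arr 0 (.var 2)) ;;
    rset 2 (.add (.var 2) (.arr 0 (.var 2))) ;;
    incr 1)

/-- The integral and fractional parts of `u` are in place for all indices below `m`. -/
structure Parts (u : ℕ → ℝ) (m : ℕ) (s : St E) : Prop extends Powers s where
  int : ∀ i < m, s.na 0 i = ⌊u i⌋₊
  frac : ∀ i < m, s.ra 1 i = u i - ⌊u i⌋₊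
  key : ∀ i < m, s.ra 2 i = u i - ⌊u i⌋₊
  wt : ∀ i < m, s.ra 3 i = 2 ^ ⌊u i⌋₊
  sum : s.rv 2 = ∑ i ∈ Finset.range m, 2 ^ ⌊u i⌋₊

/-- Since `mx` bounds the input, `E.u mx` lies between `0` and `n`; its floor is therefore a legal
operand of the machine and an index into the table of powers. The fractional parts are stored twice
because selection overwrites one copy. -/
theorem wp_partsStmt (hL : 1000 * E.n ≤ 2 ^ (E.w * E.k)) (s : St E)
    (hs : Powers s) (mx : ℝ) (hmx : s.rv 0 = mx) (hx : ∀ i < E.n, E.x i ≤ mx) (hn : 1 ≤ E.n) :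
    wp partsStmt s (fun s' => Parts (E.u mx) E.n s' ∧ s'.tm ≤ s.tm + 20 * E.n) := by
  simp only [partsStmt, wp_seq, wp_prim, Prim.Ok, Prim.run, NExp.Ok, NExp.eval, RExp.Ok, RExp.eval,
    true_and]
  refine wp_loop (fun s' => s'.nv 1 ≤ E.n ∧ Parts (E.u mx) (s'.nv 1) s' ∧ s'.rv 0 = mx)
    (fun s' => 11 * (E.n - s'.nv 1)) ?_ ?_ ?_
  · refine ⟨by simp, ?_, by simp [hmx]⟩
    constructor
    · constructor
      · simp [hs.size]
      · exact hs.pow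
      · exact hs.head
    all_goals simp
  · rintro s' ⟨h1, h2, h3⟩
    refine ⟨by simp, fun h => ?_⟩
    simp only [Cond.Holds, NExp.eval, h2.size] at h
    have key : 0 ≤ E.u mx (s'.nv 1) ∧ E.u mx (s'.nv 1) ≤ E.n := by
      refine ⟨le_max_right _ _, max_le ?_ (by positivity)⟩
      have := hx _ h; linarith
    have hfl : ⌊E.u mx (s'.nv 1)⌋₊ ≤ E.n := Nat.floor_le_of_le key.2
    have hpow : (E.n : ℝ) < 2 ^ (E.w * E.k) := by exact_mod_cast (show E.n < _ by omega)
    refine wp.seq (R := fun s'' => s''.nv = s'.nv ∧ s''.na = s'.na ∧ s''.ra = s'.ra ∧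
      s''.rv 0 = mx ∧ s''.rv 1 = E.x (s'.nv 1) - mx + E.n ∧ s''.rv 2 = s'.rv 2 ∧
      s''.tm = s'.tm + 2) (by simp [h, h3, h2.size]; omega) ?_
    rintro s1 ⟨g1, g2, g3, g4, g5, g6, g7⟩
    refine wp.seq (R := fun s'' => s''.nv = s'.nv ∧ s''.na = s'.na ∧ s''.ra = s'.ra ∧
      s''.rv 0 = mx ∧ s''.rv 1 = E.u mx (s'.nv 1) ∧ s''.rv 2 = s'.rv 2 ∧
      s''.tm = s'.tm + 4) ?_ ?_
    · simp [g1, g2, g3, g4, g5, g6, g7]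
      exact ⟨fun h => by rw [Env.u, max_eq_right h.le], fun h => by rw [Env.u, max_eq_left h]⟩
    rintro s2 ⟨g1, g2, g3, g4, g5, g6, g7⟩
    have hp := h2.pow ⌊E.u mx (s'.nv 1)⌋₊ (by omega)
    simp [g1, g2, g3, g4, g5, g6, g7]
    refine ⟨⟨key.1, key.2.trans_lt hpow⟩, by omega, by omega, by omega, ⟨h, ?_⟩, by omega⟩
    constructor
    · constructor
      · simp [h2.size]
      · simpa using h2.pow
      · simpa using h2.head
    · intro i hi
      simp [Function.update_apply] at hi ⊢
      split_ifs with h'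
      · rw [h']
      · exact h2.int i (by omega)
    · intro i hi
      simp [Function.update_apply] at hi ⊢
      split_ifs with h'
      · rw [h']
      · exact h2.frac i (by omega)
    · intro i hi
      simp [Function.update_apply] at hi ⊢
      split_ifs with h'
      · rw [h']
      · exact h2.key i (by omega)
    · intro i hi
      simp [Function.update_apply] at hi ⊢
      split_ifs with h'
      · rw [h', hp]
      · exact h2.wt i (by omega)
    · simp [Finset.sum_range_succ, h2.sum, hp]
  · rintro s' ⟨h0, h1, h2⟩ h ht
    simp [h1.size] at h ht ⊢
    have : s'.nv 1 = E.n := by omega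
    rw [this] at h1
    exact ⟨⟨⟨h1.size, h1.pow, h1.head⟩, h1.int, h1.frac, h1.key, h1.wt, h1.sum⟩, by omega⟩

/-- Natural variable `3` becomes the logarithm, rounded up, of the sum of the powers of two, and
the selection problem is set up as the bottom of the stack. -/
def slackStmt : Stmt :=
  nset 3 (.lit 0) ;;
  loop (.rlt (.arr 0 (.var 3)) (.var 2)) (incr 3) ;;
  rput 4 (.lit 1) (.sub (.arr 0 (.var 3)) (.var 2)) ;;
  rput 5 (.lit 1) (.nat (.lit 1)) ;;
  nput 1 (.lit 1) (.lit 0) ;;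
  nput 2 (.lit 1) (.var 0) ;;
  nset 4 (.lit 1)

/-- The number `m₀` is the logarithm, rounded up, of the sum of the powers of two. -/
structure IsTop (n : ℕ) (u : ℕ → ℝ) (m₀ : ℕ) : Prop where
  le : ∑ i ∈ Finset.range n, (2 : ℝ) ^ ⌊u i⌋₊ ≤ 2 ^ m₀
  lt : ∀ m < m₀, (2 : ℝ) ^ m < ∑ i ∈ Finset.range n, 2 ^ ⌊u i⌋₊
  bound : m₀ ≤ 2 * n

theorem wp_slackStmt (hL : 1000 * E.n ≤ 2 ^ (E.w * E.k)) (hn : 1 ≤ E.n) (s : St E) (u : ℕ → ℝ)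
    (hu : ∀ i < E.n, u i ≤ E.n) (hs : Parts u E.n s) :
    wp slackStmt s (fun s' => Parts u E.n s' ∧ IsTop E.n u (s'.nv 3) ∧ s'.nv 4 = 1 ∧
      s'.na 1 1 = 0 ∧ s'.na 2 1 = E.n ∧
      s'.ra 4 1 = 2 ^ s'.nv 3 - ∑ i ∈ Finset.range E.n, 2 ^ ⌊u i⌋₊ ∧ s'.ra 5 1 = 1 ∧
      s'.tm ≤ s.tm + 20 * E.n) := by
  -- Each of the `n` terms is at most `2 ^ n`, and `n ≤ 2 ^ n`; hence the search for `m₀` stops by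
  -- `2 * n`.
  have htop : ∑ i ∈ Finset.range E.n, (2 : ℝ) ^ ⌊u i⌋₊ ≤ 2 ^ (2 * E.n) := by
    calc ∑ i ∈ Finset.range E.n, (2 : ℝ) ^ ⌊u i⌋₊ ≤ ∑ i ∈ Finset.range E.n, (2 : ℝ) ^ E.n :=
          Finset.sum_le_sum fun i hi => pow_le_pow_right₀ (by norm_num)
            (Nat.floor_le_of_le (hu i (Finset.mem_range.1 hi)))
      _ = E.n * 2 ^ E.n := by simp
      _ ≤ 2 ^ E.n * 2 ^ E.n := by
          gcongr; exact_mod_cast (Nat.lt_two_pow_self (n := E.n)).le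
      _ = 2 ^ (2 * E.n) := by rw [← pow_add]; congr 1; omega
  refine wp.seq (R := fun s' => Parts u E.n s' ∧ s'.nv 3 = 0 ∧ s'.tm = s.tm + 1) ?_ ?_
  · simp
    exact ⟨⟨by simp [hs.size], hs.pow, hs.head⟩, hs.int, hs.frac, hs.key, hs.wt, hs.sum⟩
  rintro s1 ⟨hs1, h3, ht1⟩
  refine wp.seq (R := fun s' => Parts u E.n s' ∧ IsTop E.n u (s'.nv 3) ∧
    s'.tm ≤ s.tm + 6 * E.n + 2) ?_ ?_
  · refine wp_loop (fun s' => Parts u E.n s' ∧ s'.nv 3 ≤ 2 * E.n ∧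
      ∀ m < s'.nv 3, (2 : ℝ) ^ m < ∑ i ∈ Finset.range E.n, 2 ^ ⌊u i⌋₊)
      (fun s' => 3 * (2 * E.n - s'.nv 3)) ?_ ?_ ?_
    · exact ⟨hs1, by omega, by simp [h3]⟩
    · rintro s' ⟨h0, h1, h2⟩
      have hp := h0.pow (s'.nv 3) h1
      simp [h0.sum, hp]
      refine ⟨by omega, fun h => ?_⟩
      have hlt : s'.nv 3 < 2 * E.n := by
        by_contra hc
        have : s'.nv 3 = 2 * E.n := by omega
        rw [this] at h
        linarith
      refine ⟨⟨⟨⟨by simp [h0.size], h0.pow, h0.head⟩, h0.int, h0.frac, h0.key, h0.wt, h0.sum⟩,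
        by omega, fun m hm => ?_⟩, by omega⟩
      rcases hm.lt_or_eq with hm | rfl
      · exact h2 m hm
      · exact h
    · rintro s' ⟨h0, h1, h2⟩ h ht
      have hp := h0.pow (s'.nv 3) h1
      simp [h0.sum, hp] at h ht ⊢
      exact ⟨⟨⟨h0.size, h0.pow, h0.head⟩, h0.int, h0.frac, h0.key, h0.wt, h0.sum⟩,
        ⟨h, h2, h1⟩, by omega⟩
  · rintro s2 ⟨hs2, htp, ht2⟩
    have hp := hs2.pow (s2.nv 3) htp.bound
    simp [hs2.sum, hp, hs2.size]
    have hb := htp.bound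
    refine ⟨⟨by omega, by omega⟩, by omega, ?_, htp, by omega⟩
    exact ⟨⟨by simp [hs2.size], by simpa using hs2.pow, by simpa using hs2.head⟩,
      by simpa using hs2.int, by simpa using hs2.frac, by simpa using hs2.key,
      by simpa using hs2.wt, by simpa using hs2.sum⟩

/-! ### Weighted selection: mathematics -/

/-- The total weight of the items with key greater than `p`. -/
noncomputable def sumGt (L : List (ℝ × ℝ)) (p : ℝ) : ℝ :=
  ((L.filter (fun y => p < y.1)).map Prod.snd).sum

/-- The total weight of the items with key at least `p`. -/
noncomputable def sumGe (L : List (ℝ × ℝ)) (p : ℝ) : ℝ :=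
  ((L.filter (fun y => ¬ y.1 < p)).map Prod.snd).sum

theorem sumGt_append (L L' : List (ℝ × ℝ)) (p : ℝ) :
    sumGt (L ++ L') p = sumGt L p + sumGt L' p := by
  simp [sumGt]

theorem sumGe_append (L L' : List (ℝ × ℝ)) (p : ℝ) :
    sumGe (L ++ L') p = sumGe L p + sumGe L' p := by
  simp [sumGe]

theorem sumGt_anti {L : List (ℝ × ℝ)} (hL : ∀ y ∈ L, 0 ≤ y.2) {p q : ℝ} (h : p ≤ q) :
    sumGt L q ≤ sumGt L p := by
  induction L with
  | nil => simp [sumGt]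
  | cons y L ih =>
    have ih := ih fun z hz => hL z (by simp [hz])
    have := hL y (by simp)
    simp only [sumGt, List.filter_cons] at ih ⊢
    by_cases h1 : q < y.1
    · simp [h1, h.trans_lt h1, ih]
    · by_cases h2 : p < y.1 <;> simp [h1, h2] <;> linarith

/-- All items with key at least `p` count for a candidate `a < p`. This is why the bound drops by
`sumGe L p` when they are discarded. -/
theorem sumGt_filter_lt (L : List (ℝ × ℝ)) {p a : ℝ} (h : a < p) :
    sumGt L a = sumGt (L.filter (fun y => y.1 < p)) a + sumGe L p := by
  induction L with
  | nil => simp [sumGt, sumGe]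
  | cons y L ih =>
    simp only [sumGt, sumGe, List.filter_cons] at ih ⊢
    by_cases h1 : y.1 < p
    · by_cases h2 : a < y.1
      · simp [h1, h2] at ih ⊢; rw [ih]; ring
      · simp [h1, h2] at ih ⊢; rw [ih]
    · have h2 : a < y.1 := by linarith
      simp [h1, h2] at ih ⊢; rw [ih]; ring

theorem sumGt_filter_gt (L : List (ℝ × ℝ)) {p a : ℝ} (h : p ≤ a) :
    sumGt (L.filter (fun y => p < y.1)) a = sumGt L a := by
  rw [sumGt, sumGt, List.filter_filter]
  congr 2
  apply List.filter_congr
  intro y _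
  by_cases h1 : a < y.1
  · simp [h1, h.trans_lt h1]
  · simp [h1]

/-- `a` is the smallest among `hi` and the keys `p` in `L` for which the items with key greater
than `p` have total weight at most `B`. -/
def Ans (L : List (ℝ × ℝ)) (B hi a : ℝ) : Prop :=
  (a = hi ∨ ∃ y ∈ L, y.1 = a ∧ sumGt L a ≤ B) ∧ ∀ y ∈ L, y.1 < a → B < sumGt L y.1

/-- An exhausted problem is answered by `hi`, which pruning sets to the last pivot that met the
bound. -/
theorem ans_nil (B hi : ℝ) : Ans [] B hi hi := by simp [Ans]

/-- The pivot meets the bound, so it becomes the fallback and only smaller keys can improve on it.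
The discarded items exceed every remaining candidate and are charged to the bound once and for all.
-/
theorem Ans.of_filter_lt {L : List (ℝ × ℝ)} {B hi a p : ℝ} (hp : ∃ y ∈ L, y.1 = p)
    (hB : sumGt L p ≤ B) (h : Ans (L.filter (fun y => y.1 < p)) (B - sumGe L p) p a) :
    Ans L B hi a := by
  obtain ⟨h1, h2⟩ := h
  have hap : a ≤ p := by
    rcases h1 with rfl | ⟨y, hy, rfl, -⟩
    · exact le_rfl
    · simp at hy; exact hy.2.le
  constructor
  · right
    rcases h1 with rfl | ⟨y, hy, rfl, h3⟩
    · obtain ⟨y, hy, rfl⟩ := hp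
      exact ⟨y, hy, rfl, hB⟩
    · simp at hy
      refine ⟨y, hy.1, rfl, ?_⟩
      rw [sumGt_filter_lt L hy.2]; linarith
  · intro y hy hya
    have := h2 y (by simp [hy]; linarith) hya
    rw [sumGt_filter_lt L (hya.trans_le hap)]; linarith

/-- By monotonicity no key up to `p` meets the bound, and items with such keys never count for a
candidate above `p`. -/
theorem Ans.of_filter_gt {L : List (ℝ × ℝ)} (hL : ∀ y ∈ L, 0 ≤ y.2) {B hi a p : ℝ}
    (hB : B < sumGt L p) (h : Ans (L.filter (fun y => p < y.1)) B hi a) : Ans L B hi a := by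
  obtain ⟨h1, h2⟩ := h
  constructor
  · refine h1.imp_right ?_
    rintro ⟨y, hy, rfl, h3⟩
    simp at hy
    exact ⟨y, hy.1, rfl, by rwa [sumGt_filter_gt L hy.2.le] at h3⟩
  · intro y hy hya
    by_cases h : p < y.1
    · have := h2 y (by simp [hy, h]) hya
      rwa [sumGt_filter_gt L h.le] at this
    · exact hB.trans_le (sumGt_anti hL (not_lt.1 h))

/-- The answer is a key if the bound is nonnegative and `hi` exceeds all keys. -/
theorem Ans.mem {L : List (ℝ × ℝ)} (hne : L ≠ []) {B hi a : ℝ} (hB : 0 ≤ B)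
    (hhi : ∀ y ∈ L, y.1 < hi) (h : Ans L B hi a) : ∃ y ∈ L, y.1 = a ∧ sumGt L a ≤ B := by
  rcases h.1 with rfl | h1
  -- Nothing exceeds the largest key, so it meets every nonnegative bound and `hi` cannot be the
  -- answer.
  · obtain ⟨y, hy, hmax⟩ := Finset.exists_max_image L.toFinset Prod.fst (by simpa using hne)
    simp only [List.mem_toFinset] at hy hmax
    have h2 := h.2 y hy (hhi y hy)
    have h3 : L.filter (fun z => y.1 < z.1) = [] := by
      simpa [List.filter_eq_nil_iff] using fun p q hz => hmax (p, q) hz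
    rw [sumGt, h3] at h2
    simp at h2
    linarith
  · exact h1

/-- The items with key at least the answer have total weight greater than the bound, if all items
together do. -/
theorem Ans.lt_sumGe {L : List (ℝ × ℝ)} {B hi a : ℝ} (h : Ans L B hi a)
    (htot : B < (L.map Prod.snd).sum) : B < sumGe L a := by
  by_cases hne : L.filter (fun y => y.1 < a) = []
  · rw [List.filter_eq_nil_iff] at hne
    rwa [sumGe, List.filter_eq_self.2]
    simpa using hne
  -- The largest key below `a` violates the bound, and the keys exceeding it are exactly those from
  -- `a` on.
  · obtain ⟨y, hy, hmax⟩ := Finset.exists_max_image (L.filter (fun y => y.1 < a)).toFinset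
      Prod.fst (by simpa only [List.toFinset_nonempty_iff] using hne)
    simp only [List.mem_toFinset, List.mem_filter, decide_eq_true_eq] at hy hmax
    refine (h.2 y hy.1 hy.2).trans_eq ?_
    rw [sumGt, sumGe]
    congr 2
    apply List.filter_congr
    intro z hz
    by_cases hza : z.1 < a
    · simp [hza, hmax z ⟨hz, hza⟩]
    · simp [hza, hy.2.trans_le (not_lt.1 hza)]

/-! ### Medians of five and the quality of their median as a pivot -/

/-- The number of items with key at least `a`. -/
noncomputable def cntGe (L : List (ℝ × ℝ)) (a : ℝ) : ℕ := L.countP (fun y => a ≤ y.1)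

/-- The number of items with key at most `a`. -/
noncomputable def cntLe (L : List (ℝ × ℝ)) (a : ℝ) : ℕ := L.countP (fun y => y.1 ≤ a)

theorem cntGe_append (L L' : List (ℝ × ℝ)) (a : ℝ) :
    cntGe (L ++ L') a = cntGe L a + cntGe L' a := by simp [cntGe]

theorem cntLe_append (L L' : List (ℝ × ℝ)) (a : ℝ) :
    cntLe (L ++ L') a = cntLe L a + cntLe L' a := by simp [cntLe]

theorem sumGe_eq_cntGe {L : List (ℝ × ℝ)} {g : ℝ} (h : ∀ y ∈ L, y.2 = g) (a : ℝ) :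
    sumGe L a = g * cntGe L a := by
  induction L with
  | nil => simp [sumGe, cntGe]
  | cons y L ih =>
    have ih := ih fun z hz => h z (by simp [hz])
    have hy := h y (by simp)
    simp only [sumGe, cntGe, List.filter_cons, List.countP_cons] at ih ⊢
    by_cases h1 : y.1 < a
    · simp [h1, not_le.2 h1] at ih ⊢; exact ih
    · simp [h1, not_lt.1 h1] at ih ⊢; rw [ih, hy]; ring

theorem sumGt_eq_cntLe {L : List (ℝ × ℝ)} {g : ℝ} (h : ∀ y ∈ L, y.2 = g) (a : ℝ) :
    sumGt L a = g * (L.length - cntLe L a) := by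
  induction L with
  | nil => simp [sumGt, cntLe]
  | cons y L ih =>
    have ih := ih fun z hz => h z (by simp [hz])
    have hy := h y (by simp)
    simp only [sumGt, cntLe, List.filter_cons, List.countP_cons] at ih ⊢
    by_cases h1 : a < y.1
    · simp [h1, not_le.2 h1] at ih ⊢; rw [ih, hy]; ring
    · simp [h1, not_lt.1 h1] at ih ⊢; rw [ih]

theorem length_filter_lt (L : List (ℝ × ℝ)) (a : ℝ) :
    (L.filter (fun y => y.1 < a)).length + cntGe L a = L.length := by
  rw [cntGe, L.length_eq_countP_add_countP (fun y => decide (y.1 < a))]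
  rw [← List.countP_eq_length_filter]; congr 1; apply List.countP_congr; intro; simp

theorem length_filter_gt (L : List (ℝ × ℝ)) (a : ℝ) :
    (L.filter (fun y => a < y.1)).length + cntLe L a = L.length := by
  rw [cntLe, L.length_eq_countP_add_countP (fun y => decide (a < y.1))]
  rw [← List.countP_eq_length_filter]; congr 1; apply List.countP_congr; intro; simp

/-- The pivot `a` is a key, and at most about seven tenths of the keys lie on either side. -/
structure GoodPivot (L : List (ℝ × ℝ)) (a : ℝ) : Prop where
  mem : ∃ y ∈ L, y.1 = a
  lt : 10 * (L.filter (fun y => y.1 < a)).length ≤ 7 * L.length + 12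
  gt : 10 * (L.filter (fun y => a < y.1)).length ≤ 7 * L.length + 12

/-- Medians of five. -/
structure Medians (L M : List (ℝ × ℝ)) : Prop where
  wt : ∀ y ∈ M, y.2 = 2
  mem : ∀ y ∈ M, ∃ z ∈ L, z.1 = y.1
  ge : ∀ a, 3 * cntGe M a ≤ cntGe L a
  le : ∀ a, 3 * cntLe M a ≤ cntLe L a

theorem Medians.nil : Medians [] [] := by constructor <;> simp [cntGe, cntLe]

theorem Medians.append_right {L M : List (ℝ × ℝ)} (h : Medians L M) (L' : List (ℝ × ℝ)) :
    Medians (L ++ L') M where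
  wt := h.wt
  mem y hy := by
    obtain ⟨z, hz, hzy⟩ := h.mem y hy
    exact ⟨z, by simp [hz], hzy⟩
  ge a := by rw [cntGe_append]; have := h.ge a; omega
  le a := by rw [cntLe_append]; have := h.le a; omega

/-- With unit weights and bound `2`, the answer for five keys has at least three of them on either
side, itself included. `T'` is `T` with its weights reset to `1`, because the median of a group
ignores the weights of the items. -/
theorem Medians.append {L M : List (ℝ × ℝ)} (h : Medians L M) {T T' : List (ℝ × ℝ)}
    (hT : T'.length = 5) (hT2 : ∀ y ∈ T', y.2 = 1) (hTT : T.map Prod.fst = T'.map Prod.fst)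
    (hT1 : ∀ y ∈ T', y.1 < 1) {b : ℝ} (hb : Ans T' 2 1 b) :
    Medians (L ++ T) (M ++ [(b, 2)]) := by
  have cge : ∀ a, cntGe T a = cntGe T' a := fun a => by
    have := congrArg (List.countP (fun y : ℝ => a ≤ y)) hTT
    simpa [List.countP_map, cntGe, Function.comp_def] using this
  have cle : ∀ a, cntLe T a = cntLe T' a := fun a => by
    have := congrArg (List.countP (fun y : ℝ => y ≤ a)) hTT
    simpa [List.countP_map, cntLe, Function.comp_def] using this
  obtain ⟨y, hy, rfl, h1⟩ := hb.mem (by rintro rfl; simp at hT) (by norm_num) hT1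
  have h2 := hb.lt_sumGe (by
    rw [List.map_congr_left (g := fun _ => (1 : ℝ)) hT2]
    simp [hT]; norm_num)
  rw [sumGe_eq_cntGe hT2] at h2
  rw [sumGt_eq_cntLe hT2, hT] at h1
  have h3 : 3 ≤ cntGe T' y.1 := by
    have : (2 : ℝ) < cntGe T' y.1 := by linarith
    exact_mod_cast this
  have h4 : 3 ≤ cntLe T' y.1 := by
    have : (3 : ℝ) ≤ cntLe T' y.1 := by push_cast at h1; linarith
    exact_mod_cast this
  constructor
  · intro z hz
    simp at hz
    rcases hz with hz | rfl
    · exact h.wt z hz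
    · rfl
  · intro z hz
    simp at hz
    rcases hz with hz | rfl
    · obtain ⟨z', hz', e⟩ := h.mem z hz
      exact ⟨z', by simp [hz'], e⟩
    · have : y.1 ∈ T.map Prod.fst := by rw [hTT]; exact List.mem_map_of_mem hy
      obtain ⟨z, hz, e⟩ := List.mem_map.1 this
      exact ⟨z, by simp [hz], e⟩
  · intro a
    rw [cntGe_append, cntGe_append, cge]
    have h5 := h.ge a
    by_cases hay : a ≤ y.1
    · have h6 : cntGe [(y.1, (2 : ℝ))] a = 1 := by simp [cntGe, hay]
      have h7 : cntGe T' y.1 ≤ cntGe T' a :=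
        List.countP_mono_left fun z _ hz => by simp at hz ⊢; exact hay.trans hz
      omega
    · have h6 : cntGe [(y.1, (2 : ℝ))] a = 0 := by simp [cntGe]; linarith
      omega
  · intro a
    rw [cntLe_append, cntLe_append, cle]
    have h5 := h.le a
    by_cases hay : y.1 ≤ a
    · have h6 : cntLe [(y.1, (2 : ℝ))] a = 1 := by simp [cntLe, hay]
      have h7 : cntLe T' y.1 ≤ cntLe T' a :=
        List.countP_mono_left fun z _ hz => by simp at hz ⊢; exact hz.trans hay
      omega
    · have h6 : cntLe [(y.1, (2 : ℝ))] a = 0 := by simp [cntLe]; linarith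
      omega

/-- Weight `2` per median and bound `M.length` express the median of `M` without halving. At least
half of `M` lies on either side of it, inclusively, and each of these medians stands for three
items, so at least `3 * M.length / 2` items do. With `5 * M.length ≥ L.length - 4`, at most `(7 *
L.length + 12) / 10` items remain strictly on the other side. -/
theorem Medians.goodPivot {L M : List (ℝ × ℝ)} (h : Medians L M) (hM : 1 ≤ M.length)
    (hLM : L.length < 5 * M.length + 5) {hi a : ℝ} (hhi : ∀ y ∈ L, y.1 < hi)
    (ha : Ans M M.length hi a) : GoodPivot L a := by
  obtain ⟨y, hy, rfl, h1⟩ := ha.mem (by rintro rfl; simp at hM) (by positivity) (by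
    intro y hy
    obtain ⟨z, hz, e⟩ := h.mem y hy
    exact e ▸ hhi z hz)
  have h2 := ha.lt_sumGe (by
    rw [List.map_congr_left (g := fun _ => (2 : ℝ)) h.wt]
    have : (1 : ℝ) ≤ M.length := by exact_mod_cast hM
    simp; linarith)
  rw [sumGe_eq_cntGe h.wt] at h2
  rw [sumGt_eq_cntLe h.wt] at h1
  have h3 : M.length < 2 * cntGe M y.1 := by exact_mod_cast h2
  have h4 : M.length ≤ 2 * cntLe M y.1 := by
    have : (M.length : ℝ) ≤ 2 * cntLe M y.1 := by linarith
    exact_mod_cast this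
  have h5 := h.ge y.1
  have h6 := h.le y.1
  have h7 := length_filter_lt L y.1
  have h8 := length_filter_gt L y.1
  exact ⟨h.mem y hy, by omega, by omega⟩

/-! ### Weighted selection: pruning the items at the top of the stack -/

/-- The items in the cells `o, …, o + m - 1`. -/
def seg (F G : ℕ → ℝ) (o m : ℕ) : List (ℝ × ℝ) :=
  (List.range m).map fun i => (F (o + i), G (o + i))

theorem seg_succ (F G : ℕ → ℝ) (o m : ℕ) :
    seg F G o (m + 1) = seg F G o m ++ [(F (o + m), G (o + m))] := by
  simp [seg, List.range_succ]

@[simp] theorem length_seg (F G : ℕ → ℝ) (o m : ℕ) : (seg F G o m).length = m := by simp [seg]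

theorem seg_congr {F G F' G' : ℕ → ℝ} {o m : ℕ} (hF : ∀ q, o ≤ q → q < o + m → F q = F' q)
    (hG : ∀ q, o ≤ q → q < o + m → G q = G' q) : seg F G o m = seg F' G' o m := by
  apply List.map_congr_left
  intro i hi
  rw [List.mem_range] at hi
  rw [hF _ (by omega) (by omega), hG _ (by omega) (by omega)]

theorem seg_add (F G : ℕ → ℝ) (o m m' : ℕ) :
    seg F G o (m + m') = seg F G o m ++ seg F G (o + m) m' := by
  induction m' with
  | zero => simp [seg]
  | succ m' ih => rw [← add_assoc, seg_succ, ih, seg_succ, List.append_assoc, add_assoc]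

/-- The item with index in natural variable `1` lies above (`d = true`) or below the pivot in
real variable `3`. -/
def keepCond : Bool → Cond
  | true => .rlt (.var 3) (.arr 2 (.add (.var 5) (.var 1)))
  | false => .rlt (.arr 2 (.add (.var 5) (.var 1))) (.var 3)

/-- The corresponding predicate. -/
noncomputable def keepPred (p : ℝ) : Bool → ℝ × ℝ → Bool
  | true, y => decide (p < y.1)
  | false, y => decide (y.1 < p)

/-- Keep only the items on one side of the pivot. -/
def compactStmt (d : Bool) : Stmt :=
  nset 1 (.lit 0) ;; nset 2 (.lit 0) ;;
  loop (.nlt (.var 1) (.var 6))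
    (ite (keepCond d)
      (rput 2 (.add (.var 5) (.var 2)) (.arr 2 (.add (.var 5) (.var 1))) ;;
        rput 3 (.add (.var 5) (.var 2)) (.arr 3 (.add (.var 5) (.var 1))) ;;
        incr 2) skip ;;
    incr 1)

/-- Everything but the item arrays and the natural variables `1`, `2` is unchanged. -/
structure SameButItems (s s' : St E) : Prop where
  nv : ∀ i, i ≠ 1 → i ≠ 2 → s'.nv i = s.nv i
  rv : s'.rv = s.rv
  na : s'.na = s.na
  ra : ∀ j, j ≠ 2 → j ≠ 3 → s'.ra j = s.ra j

/-- The copying is done in place: the write index (variable `2`) never overtakes the read index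
(variable `1`), so cells from the read index on still hold the original items. -/
theorem wp_compactStmt (hL : 1000 * E.n ≤ 2 ^ (E.w * E.k)) (d : Bool) (s : St E)
    (hm : s.nv 5 + s.nv 6 ≤ 2 * E.n) :
    wp (compactStmt d) s (fun s' => SameButItems s s' ∧
      (∀ q < s.nv 5, s'.ra 2 q = s.ra 2 q ∧ s'.ra 3 q = s.ra 3 q) ∧
      seg (s'.ra 2) (s'.ra 3) (s.nv 5) (s'.nv 2) =
        (seg (s.ra 2) (s.ra 3) (s.nv 5) (s.nv 6)).filter (keepPred (s.rv 3) d) ∧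
      s'.tm ≤ s.tm + 6 * s.nv 6 + 3) := by
  simp only [compactStmt, wp_seq, wp_prim, Prim.Ok, Prim.run, NExp.Ok, NExp.eval, true_and]
  refine wp_loop (fun s' => SameButItems s s' ∧ s'.nv 2 ≤ s'.nv 1 ∧ s'.nv 1 ≤ s.nv 6 ∧
    (∀ q < s.nv 5, s'.ra 2 q = s.ra 2 q ∧ s'.ra 3 q = s.ra 3 q) ∧
    (∀ q ≥ s.nv 5 + s'.nv 1, s'.ra 2 q = s.ra 2 q ∧ s'.ra 3 q = s.ra 3 q) ∧
      seg (s'.ra 2) (s'.ra 3) (s.nv 5) (s'.nv 2) =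
        (seg (s.ra 2) (s.ra 3) (s.nv 5) (s'.nv 1)).filter (keepPred (s.rv 3) d))
    (fun s' => 6 * (s.nv 6 - s'.nv 1)) ?_ ?_ ?_
  · refine ⟨⟨?_, rfl, rfl, fun _ _ _ => rfl⟩, ?_⟩
    · intro i h1 h2; simp [h1, h2]
    · simp [seg]
  · rintro s1 ⟨hS, h1, h2, h3, h4, h5⟩
    refine ⟨by simp, fun h => ?_⟩
    have e5 := hS.nv 5 (by norm_num) (by norm_num)
    have e6 := hS.nv 6 (by norm_num) (by norm_num)
    simp only [Cond.Holds, NExp.eval, e6] at h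
    obtain ⟨g1, g2⟩ := h4 (s.nv 5 + s1.nv 1) le_rfl
    have hc : (keepCond d).Ok s1.tick ∧ ((keepCond d).Holds s1.tick ↔
        keepPred (s.rv 3) d (s.ra 2 (s.nv 5 + s1.nv 1), s.ra 3 (s.nv 5 + s1.nv 1)) = true) := by
      cases d <;> simp [keepCond, keepPred, e5, g1, hS.rv] <;> omega
    rw [wp_seq, wp_ite, hc.2]
    refine ⟨hc.1, fun hk => ?_, fun hk => ?_⟩
    · have n2 : ∀ q ≠ s.nv 5 + s1.nv 2, Function.update (s1.ra 2) (s.nv 5 + s1.nv 2)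
          (s.ra 2 (s.nv 5 + s1.nv 1)) q = s1.ra 2 q := fun q hq => Function.update_of_ne hq _ _
      have n3 : ∀ q ≠ s.nv 5 + s1.nv 2, Function.update (s1.ra 3) (s.nv 5 + s1.nv 2)
          (s.ra 3 (s.nv 5 + s1.nv 1)) q = s1.ra 3 q := fun q hq => Function.update_of_ne hq _ _
      simp [e5, g1, g2]
      refine ⟨⟨by omega, by omega⟩, ⟨⟨?_, hS.rv, hS.na, ?_⟩, h1, h, ?_, ?_, ?_⟩, by omega⟩
      · intro i i1 i2; simp [i1, i2, hS.nv i i1 i2]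
      · intro j j1 j2; simp [j1, j2, hS.ra j j1 j2]
      · intro q hq
        rw [n2 q (by omega), n3 q (by omega)]; exact h3 q hq
      · intro q hq
        rw [n2 q (by omega), n3 q (by omega)]; exact h4 q (by omega)
      · rw [seg_succ, seg_succ, List.filter_append, ← h5]
        congr 1
        · exact seg_congr (fun q _ hq => n2 q (by omega)) (fun q _ hq => n3 q (by omega))
        · simp [hk]
    · simp
      refine ⟨⟨⟨?_, hS.rv, hS.na, hS.ra⟩, by omega, h, h3, ?_, ?_⟩, by omega⟩
      · intro i i1 i2; simp [i1, hS.nv i i1 i2]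
      · intro q hq; exact h4 q (by omega)
      · rw [h5, seg_succ, List.filter_append]; simp [hk]
  · rintro s1 ⟨hS, h1, h2, h3, h4, h5⟩ h ht
    have e6 := hS.nv 6 (by norm_num) (by norm_num)
    simp [e6] at h ht ⊢
    have : s1.nv 1 = s.nv 6 := by omega
    rw [this] at h5
    exact ⟨⟨hS.nv, hS.rv, hS.na, hS.ra⟩, h3, h5, by omega⟩

/-- Discard the items of the top level on one side of the pivot in real variable `3`. -/
def pruneStmt : Stmt :=
  (nset 5 (.arr 1 (.var 4)) ;; nset 6 (.arr 2 (.var 4)) ;; rset 5 (.nat (.lit 0)) ;;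
    rset 6 (.nat (.lit 0)) ;; nset 1 (.lit 0) ;;
  loop (.nlt (.var 1) (.var 6))
    (ite (.rlt (.var 3) (.arr 2 (.add (.var 5) (.var 1))))
        (rset 5 (.add (.var 5) (.arr 3 (.add (.var 5) (.var 1))))) skip ;;
      ite (.rlt (.arr 2 (.add (.var 5) (.var 1))) (.var 3)) skip
        (rset 6 (.add (.var 6) (.arr 3 (.add (.var 5) (.var 1))))) ;;
      incr 1)) ;;
  ite (.rlt (.arr 4 (.var 4)) (.var 5))
    (compactStmt true)
    (compactStmt false ;; rput 4 (.var 4) (.sub (.arr 4 (.var 4)) (.var 6)) ;;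
      rput 5 (.var 4) (.var 3)) ;;
  nput 2 (.var 4) (.var 2)

/-- The items of level `i` of the stack. -/
def lvl (s : St E) (i : ℕ) : List (ℝ × ℝ) := seg (s.ra 2) (s.ra 3) (s.na 1 i) (s.na 2 i)

/-- What is not touched by the selection. -/
structure Keep (s s' : St E) : Prop where
  size : s'.nv 0 = s.nv 0
  top : s'.nv 3 = s.nv 3
  na : ∀ j, j ≠ 1 → j ≠ 2 → s'.na j = s.na j
  ra : ∀ j, j = 0 ∨ j = 1 → s'.ra j = s.ra j

theorem Keep.refl (s : St E) : Keep s s := ⟨rfl, rfl, fun _ _ _ => rfl, fun _ _ => rfl⟩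

theorem Keep.trans {s s' s'' : St E} (h : Keep s s') (h' : Keep s' s'') : Keep s s'' :=
  ⟨h'.size.trans h.size, h'.top.trans h.top, fun j h1 h2 => (h'.na j h1 h2).trans (h.na j h1 h2),
    fun j hj => (h'.ra j hj).trans (h.ra j hj)⟩

/-- The levels below `l` and their items are unchanged. -/
structure SameBelow (l : ℕ) (s s' : St E) : Prop where
  off : s'.na 1 = s.na 1
  top : s'.nv 4 = s.nv 4
  size : ∀ i ≠ l, s'.na 2 i = s.na 2 i
  bound : ∀ i ≠ l, s'.ra 4 i = s.ra 4 i
  hi : ∀ i ≠ l, s'.ra 5 i = s.ra 5 i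
  item : ∀ q < s.na 1 l, s'.ra 2 q = s.ra 2 q ∧ s'.ra 3 q = s.ra 3 q

/-- One scan collects `sumGt` and `sumGe` at the pivot in real variables `5` and `6`. The two
outcomes have the shape required by `Ans.of_filter_lt` and `Ans.of_filter_gt`. -/
theorem wp_pruneStmt (hL : 1000 * E.n ≤ 2 ^ (E.w * E.k)) (hn : 1 ≤ E.n) (s : St E)
    (hl : s.nv 4 ≤ 2 * E.n + 1) (hm : s.na 1 (s.nv 4) + s.na 2 (s.nv 4) ≤ 2 * E.n) :
    wp pruneStmt s (fun s' => Keep s s' ∧ SameBelow (s.nv 4) s s' ∧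
      ((sumGt (lvl s (s.nv 4)) (s.rv 3) ≤ s.ra 4 (s.nv 4) ∧
        lvl s' (s.nv 4) = (lvl s (s.nv 4)).filter (fun y => y.1 < s.rv 3) ∧
        s'.ra 4 (s.nv 4) = s.ra 4 (s.nv 4) - sumGe (lvl s (s.nv 4)) (s.rv 3) ∧
        s'.ra 5 (s.nv 4) = s.rv 3) ∨
      (s.ra 4 (s.nv 4) < sumGt (lvl s (s.nv 4)) (s.rv 3) ∧
        lvl s' (s.nv 4) = (lvl s (s.nv 4)).filter (fun y => s.rv 3 < y.1) ∧
        s'.ra 4 (s.nv 4) = s.ra 4 (s.nv 4) ∧ s'.ra 5 (s.nv 4) = s.ra 5 (s.nv 4))) ∧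
      s'.tm ≤ s.tm + 20 * s.na 2 (s.nv 4) + 20) := by
  set l := s.nv 4 with hldef
  refine wp.seq (R := fun s' => s'.nv 0 = s.nv 0 ∧ s'.nv 3 = s.nv 3 ∧ s'.nv 4 = l ∧
    s'.nv 5 = s.na 1 l ∧ s'.nv 6 = s.na 2 l ∧ s'.na = s.na ∧ s'.ra = s.ra ∧ s'.rv 3 = s.rv 3 ∧
    s'.rv 5 = sumGt (lvl s l) (s.rv 3) ∧ s'.rv 6 = sumGe (lvl s l) (s.rv 3) ∧
    s'.tm ≤ s.tm + 6 * s.na 2 l + 7) ?_ ?_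
  · simp only [wp_seq, wp_prim, Prim.Ok, Prim.run, NExp.Ok, NExp.eval, RExp.Ok, RExp.eval, true_and]
    refine ⟨by omega, by simp; omega, ?_⟩
    refine wp_loop (fun s' => s'.nv 0 = s.nv 0 ∧ s'.nv 3 = s.nv 3 ∧ s'.nv 4 = l ∧
      s'.nv 5 = s.na 1 l ∧ s'.nv 6 = s.na 2 l ∧ s'.na = s.na ∧ s'.ra = s.ra ∧ s'.rv 3 = s.rv 3 ∧
      s'.rv 5 = sumGt (seg (s.ra 2) (s.ra 3) (s.na 1 l) (s'.nv 1)) (s.rv 3) ∧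
      s'.rv 6 = sumGe (seg (s.ra 2) (s.ra 3) (s.na 1 l) (s'.nv 1)) (s.rv 3) ∧
      s'.nv 1 ≤ s.na 2 l)
      (fun s' => 6 * (s.na 2 l - s'.nv 1)) ?_ ?_ ?_
    · simp [sumGt, sumGe, seg, hldef]
    · rintro s1 ⟨h0, h3, h4, h5, h6, hna, hra, hp, hgt, hge, hi⟩
      refine ⟨by simp, fun h => ?_⟩
      simp only [Cond.Holds, NExp.eval, h6] at h
      refine wp.seq (R := fun s' => s'.nv = s1.nv ∧ s'.na = s.na ∧ s'.ra = s.ra ∧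
        s'.rv 3 = s.rv 3 ∧ s'.rv 6 = s1.rv 6 ∧
        s'.rv 5 = sumGt (seg (s.ra 2) (s.ra 3) (s.na 1 l) (s1.nv 1 + 1)) (s.rv 3) ∧
        s'.tm = s1.tm + 3) ?_ ?_
      · simp [h5, hra, hna, hp, hgt, seg_succ, sumGt_append]
        refine ⟨by omega, fun hlt => ⟨by omega, by simp [sumGt, hlt]⟩, fun hlt => ?_⟩
        simp [sumGt, hlt]
      rintro s2 ⟨g1, g2, g3, g4, g5, g6, g7⟩
      refine wp.seq (R := fun s' => s'.nv = s1.nv ∧ s'.na = s.na ∧ s'.ra = s.ra ∧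
        s'.rv 3 = s.rv 3 ∧ s'.rv 5 = s2.rv 5 ∧
        s'.rv 6 = sumGe (seg (s.ra 2) (s.ra 3) (s.na 1 l) (s1.nv 1 + 1)) (s.rv 3) ∧
        s'.tm = s1.tm + 5) ?_ ?_
      · simp [g1, g2, g3, g4, g5, g7, h5, hge, seg_succ, sumGe_append]
        refine ⟨by omega, fun hlt => ?_, fun hlt => ⟨by omega, by simp [sumGe, hlt]⟩⟩
        simp [sumGe, hlt]
      rintro s3 ⟨f1, f2, f3, f4, f5, f6, f7⟩
      simp [f1, f2, f3, f4, f5, f6, f7, g6, h0, h3, h4, h5, h6]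
      omega
    · rintro s1 ⟨h0, h3, h4, h5, h6, hna, hra, hp, hgt, hge, hi⟩ h ht
      simp [h6] at h ht ⊢
      have : s1.nv 1 = s.na 2 l := by omega
      rw [this] at hgt hge
      exact ⟨h0, h3, h4, h5, hna, hra, hp, hgt, hge, by omega⟩
  rintro s1 ⟨h0, h3, h4, h5, h6, hna, hra, hp, hgt, hge, ht1⟩
  have hlv : seg (s1.ra 2) (s1.ra 3) (s1.nv 5) (s1.nv 6) = lvl s l := by
    rw [hra, h5, h6, lvl]
  rw [wp_seq, wp_ite]
  simp only [Cond.Ok, Cond.Holds, RExp.Ok, RExp.eval, NExp.Ok, NExp.eval, true_and, and_true, h4,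
    hra, hgt]
  refine ⟨by omega, fun h => ?_, fun h => ?_⟩
  · refine (wp_compactStmt hL true s1.tick (by simp [h5, h6]; omega)).mono ?_
    rintro s2 ⟨⟨k1, k2, k3, k4⟩, c2, c3, c4⟩
    simp only [St.tick, hlv] at k1 k2 k3 k4 c2 c3 c4
    have e4 : s2.nv 4 = l := by rw [k1 4 (by norm_num) (by norm_num), h4]
    simp [e4]
    rw [h5, hra] at c2
    refine ⟨by omega, ?_, ?_, ?_, by omega⟩
    · refine ⟨?_, ?_, ?_, ?_⟩
      · rw [← h0]; exact k1 0 (by norm_num) (by norm_num)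
      · rw [← h3]; exact k1 3 (by norm_num) (by norm_num)
      · intro j j1 j2; simp [j2, k3, hna]
      · rintro j (rfl | rfl)
        · rw [← hra]; exact k4 0 (by decide) (by decide)
        · rw [← hra]; exact k4 1 (by decide) (by decide)
    · refine ⟨?_, ?_, ?_, ?_, ?_, ?_⟩
      · simp [k3, hna]
      · simp [e4, hldef]
      · intro i hi; simp [hi, k3, hna]
      · intro i hi; simp [k4, hra]
      · intro i hi; simp [k4, hra]
      · exact c2
    · right
      refine ⟨h, ?_, by simp [k4, hra], by simp [k4, hra]⟩
      simp [lvl, k3, hna]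
      rw [h5, hp] at c3
      exact c3
  · rw [wp_seq]
    refine (wp_compactStmt hL false s1.tick (by simp [h5, h6]; omega)).mono ?_
    rintro s2 ⟨⟨k1, k2, k3, k4⟩, c2, c3, c4⟩
    simp only [St.tick, hlv] at k1 k2 k3 k4 c2 c3 c4
    have e4 : s2.nv 4 = l := by rw [k1 4 (by norm_num) (by norm_num), h4]
    have e5 := k4 4 (by decide) (by decide)
    simp [e4, e5, k2, hp, hge, hra]
    rw [h5, hra] at c2
    refine ⟨by omega, ?_, ?_, ?_, by omega⟩
    · refine ⟨?_, ?_, ?_, ?_⟩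
      · rw [← h0]; exact k1 0 (by norm_num) (by norm_num)
      · rw [← h3]; exact k1 3 (by norm_num) (by norm_num)
      · intro j j1 j2; simp [j2, k3, hna]
      · rintro j (rfl | rfl)
        · simp [k4, hra]
        · simp [k4, hra]
    · refine ⟨?_, ?_, ?_, ?_, ?_, ?_⟩
      · simp [k3, hna]
      · simp [e4, hldef]
      · intro i hi; simp [hi, k3, hna]
      · intro i hi; simp [k4, hra, hi]
      · intro i hi; simp [k4, hra, hi]
      · simpa using c2
    · left
      refine ⟨not_lt.1 h, ?_⟩
      simp [lvl, k3, hna]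
      rw [h5, hp] at c3
      exact c3

/-! ### Weighted selection: medians of five -/

/-- Real variable `7` becomes the median of the five keys from index `i` on, where `i` is the sum
of natural variables `5` and `1`. -/
def medianStmt : Stmt :=
  rset 7 (.nat (.lit 1)) ;; nset 7 (.lit 0) ;;
  loop (.nlt (.var 7) (.lit 5))
    ((nset 8 (.lit 0) ;; rset 8 (.arr 2 (.add (.add (.var 5) (.var 1)) (.var 7))) ;;
      nset 9 (.lit 0) ;;
      loop (.nlt (.var 9) (.lit 5))
        (ite (.rlt (.var 8) (.arr 2 (.add (.add (.var 5) (.var 1)) (.var 9)))) (incr 8) skip ;;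
          incr 9)) ;;
    ite (.nlt (.var 8) (.lit 3)) (ite (.rlt (.var 8) (.var 7)) (rset 7 (.var 8)) skip) skip ;;
    incr 7)

/-- Only natural variables from `7` on and real variables from `7` on have changed. -/
structure SameButScratch (s s' : St E) : Prop where
  nv : ∀ i < 7, s'.nv i = s.nv i
  na : s'.na = s.na
  ra : s'.ra = s.ra

/-- Brute force over 25 comparisons: count the larger keys for each of the five, and keep the
smallest key with fewer than three of them, starting from the default `1`. -/
theorem wp_medianStmt (hL : 1000 * E.n ≤ 2 ^ (E.w * E.k)) (s : St E)
    (hi : s.nv 5 + s.nv 1 + 5 ≤ 2 * E.n) :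
    wp medianStmt s (fun s' => SameButScratch s s' ∧
      Ans (seg (s.ra 2) (fun _ => 1) (s.nv 5 + s.nv 1) 5) 2 1 (s'.rv 7) ∧
      s'.tm ≤ s.tm + 170) := by
  set o := s.nv 5 + s.nv 1 with ho
  set T := seg (s.ra 2) (fun _ => 1) o 5 with hT
  simp only [medianStmt, wp_seq (a := rset 7 _), wp_seq (a := nset 7 _), wp_prim, Prim.Ok, Prim.run,
    NExp.Ok, NExp.eval, RExp.Ok, RExp.eval, true_and]
  refine wp_loop (fun s' => SameButScratch s s' ∧ s'.nv 7 ≤ 5 ∧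
    (s'.rv 7 = 1 ∨ ∃ y ∈ T, y.1 = s'.rv 7 ∧ sumGt T (s'.rv 7) ≤ 2) ∧
    ∀ i < s'.nv 7, s.ra 2 (o + i) < s'.rv 7 → 2 < sumGt T (s.ra 2 (o + i)))
    (fun s' => 33 * (5 - s'.nv 7)) ?_ ?_ ?_
  · refine ⟨⟨?_, rfl, rfl⟩, by simp, by simp, by simp⟩
    intro i hi; simp [show i ≠ 7 by omega]
  · rintro s1 ⟨hS, h7, hb, hk⟩
    refine ⟨by simp, fun h => ?_⟩
    simp only [Cond.Holds, NExp.eval] at h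
    refine wp.seq (R := fun s' => SameButScratch s s' ∧ s'.nv 7 = s1.nv 7 ∧ s'.rv 7 = s1.rv 7 ∧
      s'.rv 8 = s.ra 2 (o + s1.nv 7) ∧ (s'.nv 8 : ℝ) = sumGt T (s.ra 2 (o + s1.nv 7)) ∧
      s'.tm ≤ s1.tm + 25) ?_ ?_
    · simp only [wp_seq (a := rset 8 _), wp_seq (a := nset _ _), wp_prim, Prim.Ok, Prim.run,
        NExp.Ok, NExp.eval, RExp.Ok, RExp.eval, true_and]
      refine ⟨?_, ?_⟩
      · simp [hS.nv 5, hS.nv 1]; omega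
      refine wp_loop (fun s' => SameButScratch s s' ∧ s'.nv 7 = s1.nv 7 ∧ s'.rv 7 = s1.rv 7 ∧
        s'.rv 8 = s.ra 2 (o + s1.nv 7) ∧ s'.nv 9 ≤ 5 ∧ (s'.nv 8 : ℝ) =
          sumGt (seg (s.ra 2) (fun _ => 1) o (s'.nv 9)) (s.ra 2 (o + s1.nv 7)))
        (fun s' => 4 * (5 - s'.nv 9)) ?_ ?_ ?_
      · refine ⟨⟨?_, ?_, ?_⟩, ?_⟩
        · intro i hi
          simp [show i ≠ 8 by omega, show i ≠ 9 by omega, hS.nv i hi]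
        · exact hS.na
        · exact hS.ra
        · simp [hS.nv 5, hS.nv 1, hS.ra, sumGt, seg, ho]
      · rintro s2 ⟨hS2, g7, gr7, gr8, g9, g8⟩
        refine ⟨by simp, fun h => ?_⟩
        simp only [Cond.Holds, NExp.eval] at h
        refine wp.seq (R := fun s' => SameButScratch s s' ∧ s'.nv 7 = s1.nv 7 ∧
          s'.rv 7 = s1.rv 7 ∧ s'.nv 9 = s2.nv 9 ∧
          s'.rv 8 = s.ra 2 (o + s1.nv 7) ∧ (s'.nv 8 : ℝ) =
            sumGt (seg (s.ra 2) (fun _ => 1) o (s2.nv 9 + 1)) (s.ra 2 (o + s1.nv 7)) ∧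
          s'.tm = s2.tm + 3) ?_ ?_
        · simp [hS2.nv 5, hS2.nv 1, gr8, hS2.ra, ← ho, seg_succ, sumGt_append, g8, g7, gr7]
          refine ⟨by omega, fun hlt => ⟨⟨?_, hS2.na, rfl⟩, ?_⟩,
            fun hlt => ⟨⟨hS2.nv, hS2.na, rfl⟩, ?_⟩⟩
          · intro i hi; simp [show i ≠ 8 by omega, hS2.nv i hi]
          · simp [sumGt, hlt]
          · simp [sumGt, hlt]
        · rintro s3 ⟨hS3, f7, fr7, f9, fr8, f8, ft⟩
          simp [f7, fr7, fr8, f8, f9, ft]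
          refine ⟨⟨⟨?_, hS3.na, hS3.ra⟩, h⟩, by omega⟩
          intro i hi; simp [show i ≠ 9 by omega, hS3.nv i hi]
      · rintro s2 ⟨hS2, g7, gr7, gr8, g9, g8⟩ h ht
        simp at h ht ⊢
        have : s2.nv 9 = 5 := by omega
        rw [this] at g8
        exact ⟨⟨hS2.nv, hS2.na, hS2.ra⟩, g7, gr7, gr8, g8, by omega⟩
    · rintro s2 ⟨hS2, g7, gr7, gr8, g8, gt⟩
      have hmem : (s.ra 2 (o + s1.nv 7), (1 : ℝ)) ∈ T := by
        rw [hT, seg, List.mem_map]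
        exact ⟨s1.nv 7, by simpa using h, rfl⟩
      have h3 : s2.nv 8 < 3 ↔ sumGt T (s.ra 2 (o + s1.nv 7)) ≤ 2 := by
        rw [← g8]
        constructor
        · intro h; exact_mod_cast Nat.le_of_lt_succ h
        · intro h; exact Nat.lt_succ_of_le (by exact_mod_cast h)
      refine wp.seq (R := fun s' => SameButScratch s s' ∧ s'.nv 7 = s1.nv 7 ∧
        s'.tm ≤ s1.tm + 29 ∧
        (s'.rv 7 = 1 ∨ ∃ y ∈ T, y.1 = s'.rv 7 ∧ sumGt T (s'.rv 7) ≤ 2) ∧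
        ∀ i < s1.nv 7 + 1, s.ra 2 (o + i) < s'.rv 7 → 2 < sumGt T (s.ra 2 (o + i))) ?_ ?_
      · rw [wp_ite, wp_ite]
        refine ⟨by simp, fun hc => ⟨by simp, fun hc2 => ?_, fun hc2 => ?_⟩, fun hc => ?_⟩
        · simp [gr8, gr7, g7] at hc hc2 ⊢
          refine ⟨⟨hS2.nv, hS2.na, hS2.ra⟩, by omega, Or.inr ⟨⟨_, hmem⟩, h3.1 hc⟩, ?_⟩
          intro i hi hlt
          rcases hi.lt_or_eq with hi | rfl
          · exact hk i hi (hlt.trans hc2)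
          · exact absurd hlt (lt_irrefl _)
        · simp [gr8, gr7, g7] at hc hc2 ⊢
          refine ⟨⟨hS2.nv, hS2.na, hS2.ra⟩, by omega, by simpa using hb, ?_⟩
          intro i hi hlt
          rcases hi.lt_or_eq with hi | rfl
          · exact hk i hi hlt
          · linarith
        · simp [gr7, g7] at hc ⊢
          refine ⟨⟨hS2.nv, hS2.na, hS2.ra⟩, by omega, by simpa using hb, ?_⟩
          intro i hi hlt
          rcases hi.lt_or_eq with hi | rfl
          · exact hk i hi hlt
          · exact not_le.1 fun hle => by have := h3.2 hle; omega
      · rintro s3 ⟨hS3, f7, ft, fb, fk⟩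
        simp [f7]
        refine ⟨⟨⟨?_, hS3.na, hS3.ra⟩, h, by simpa using fb, fun i hi => fk i (by omega)⟩, by omega⟩
        intro i hi; simp [show i ≠ 7 by omega, hS3.nv i hi]
  · rintro s1 ⟨hS, h7, hb, hk⟩ h ht
    simp at h ht
    refine ⟨⟨hS.nv, hS.na, hS.ra⟩, ⟨hb, ?_⟩, by simp; omega⟩
    intro y hy hlt
    rw [hT, seg, List.mem_map] at hy
    obtain ⟨i, hi, rfl⟩ := hy
    exact hk i (by simp at hi; omega) hlt

/-- Put the medians of groups of five items of the top level on a new level. -/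
def pushStmt : Stmt :=
  (nset 5 (.arr 1 (.var 4)) ;; nset 6 (.arr 2 (.var 4)) ;; nset 1 (.lit 0) ;; nset 2 (.lit 0) ;;
  loop (.nlt (.add (.var 1) (.lit 4)) (.var 6))
    (medianStmt ;;
      rput 2 (.add (.add (.var 5) (.var 6)) (.var 2)) (.var 7) ;;
      rput 3 (.add (.add (.var 5) (.var 6)) (.var 2)) (.nat (.lit 2)) ;;
      incr 2 ;;
      nset 1 (.add (.var 1) (.lit 5)))) ;;
  incr 4 ;;
  nput 1 (.var 4) (.add (.var 5) (.var 6)) ;;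
  nput 2 (.var 4) (.var 2) ;;
  rput 4 (.var 4) (.nat (.var 2)) ;;
  rput 5 (.var 4) (.nat (.lit 1))

/-- The medians are stored right behind the items of the old top level. An incomplete last group is
skipped, whence the strict bound with `+ 5`. By `hkey` the default `1` of the median search exceeds
all keys. -/
theorem wp_pushStmt (hL : 1000 * E.n ≤ 2 ^ (E.w * E.k)) (hn : 1 ≤ E.n) (s : St E)
    (hl : s.nv 4 ≤ 2 * E.n + 1)
    (hm : s.na 1 (s.nv 4) + 2 * s.na 2 (s.nv 4) ≤ 2 * E.n)
    (hkey : ∀ y ∈ lvl s (s.nv 4), y.1 < 1) :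
    wp pushStmt s (fun s' => Keep s s' ∧ s'.nv 4 = s.nv 4 + 1 ∧
      (∀ i ≠ s.nv 4 + 1, s'.na 1 i = s.na 1 i ∧ s'.na 2 i = s.na 2 i ∧ s'.ra 4 i = s.ra 4 i ∧
        s'.ra 5 i = s.ra 5 i) ∧
      (∀ q < s.na 1 (s.nv 4) + s.na 2 (s.nv 4), s'.ra 2 q = s.ra 2 q ∧ s'.ra 3 q = s.ra 3 q) ∧
      s'.na 1 (s.nv 4 + 1) = s.na 1 (s.nv 4) + s.na 2 (s.nv 4) ∧
      Medians (lvl s (s.nv 4)) (lvl s' (s.nv 4 + 1)) ∧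
      5 * s'.na 2 (s.nv 4 + 1) ≤ s.na 2 (s.nv 4) ∧
      s.na 2 (s.nv 4) < 5 * s'.na 2 (s.nv 4 + 1) + 5 ∧
      s'.ra 4 (s.nv 4 + 1) = s'.na 2 (s.nv 4 + 1) ∧ s'.ra 5 (s.nv 4 + 1) = 1 ∧
      s'.tm ≤ s.tm + 60 * s.na 2 (s.nv 4) + 60) := by
  set l := s.nv 4 with hldef
  set o := s.na 1 l with ho
  set m := s.na 2 l with hmdef
  refine wp.seq (R := fun s' => s'.nv 0 = s.nv 0 ∧ s'.nv 3 = s.nv 3 ∧ s'.nv 4 = l ∧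
    s'.nv 5 = o ∧ s'.nv 6 = m ∧ s'.na = s.na ∧ (∀ j, j ≠ 2 → j ≠ 3 → s'.ra j = s.ra j) ∧
    (∀ q < o + m, s'.ra 2 q = s.ra 2 q ∧ s'.ra 3 q = s.ra 3 q) ∧
    5 * s'.nv 2 ≤ m ∧ m < 5 * s'.nv 2 + 5 ∧
    Medians (seg (s.ra 2) (s.ra 3) o m) (seg (s'.ra 2) (s'.ra 3) (o + m) (s'.nv 2)) ∧
    s'.tm ≤ s.tm + 36 * m + 5) ?_ ?_
  · simp only [wp_seq, wp_prim, Prim.Ok, Prim.run, NExp.Ok, NExp.eval, true_and]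
    refine ⟨by omega, by simp; omega, ?_⟩
    refine wp_loop (fun s' => s'.nv 0 = s.nv 0 ∧ s'.nv 3 = s.nv 3 ∧ s'.nv 4 = l ∧
      s'.nv 5 = o ∧ s'.nv 6 = m ∧ s'.na = s.na ∧ (∀ j, j ≠ 2 → j ≠ 3 → s'.ra j = s.ra j) ∧
      (∀ q < o + m, s'.ra 2 q = s.ra 2 q ∧ s'.ra 3 q = s.ra 3 q) ∧
      s'.nv 1 = 5 * s'.nv 2 ∧ s'.nv 1 ≤ m ∧
      Medians (seg (s.ra 2) (s.ra 3) o (s'.nv 1)) (seg (s'.ra 2) (s'.ra 3) (o + m) (s'.nv 2)))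
      (fun s' => 36 * (m - s'.nv 1)) ?_ ?_ ?_
    · simp [hldef, ho, hmdef, seg, Medians.nil]
    · rintro s1 ⟨h0, h3, h4, h5, h6, hna, hra, hit, h1, h1m, hM⟩
      refine ⟨by simp, fun h => ?_⟩
      simp only [Cond.Holds, NExp.eval, h6] at h
      refine wp.seq (wp_medianStmt hL s1.tick (by simp [h5]; omega)) ?_
      rintro s2 ⟨⟨g1, g2, g3⟩, g4, g5⟩
      simp only [St.tick, h5] at g1 g2 g3 g4 g5
      have n2 : ∀ q ≠ o + m + s1.nv 2, Function.update (s1.ra 2) (o + m + s1.nv 2)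
          (s2.rv 7) q = s1.ra 2 q := fun q hq => Function.update_of_ne hq _ _
      have n3 : ∀ q ≠ o + m + s1.nv 2, Function.update (s1.ra 3) (o + m + s1.nv 2)
          (2 : ℝ) q = s1.ra 3 q := fun q hq => Function.update_of_ne hq _ _
      simp [g1, h5, h6, g3, g2]
      refine ⟨by omega, ⟨h0, h3, h4, hna, ?_, ?_, by omega, by omega, ?_⟩, by omega⟩
      · intro j j2 j3; simp [j2, j3, hra j j2 j3]
      · intro q hq; rw [n2 q (by omega), n3 q (by omega)]; exact hit q hq
      · have hT : seg (s1.ra 2) (fun _ => 1) (o + s1.nv 1) 5 =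
            seg (s.ra 2) (fun _ => 1) (o + s1.nv 1) 5 :=
          seg_congr (fun q _ hq => (hit q (by omega)).1) (fun _ _ _ => rfl)
        rw [hT] at g4
        have := hM.append (T := seg (s.ra 2) (s.ra 3) (o + s1.nv 1) 5) (by simp)
          (by intro y hy; simp [seg] at hy; obtain ⟨i, -, rfl⟩ := hy; rfl)
          (by simp [seg]) ?_ g4
        · rw [← seg_add] at this
          convert this using 1
          rw [seg_succ]
          congr 1
          · exact seg_congr (fun q _ hq => n2 q (by omega)) (fun q _ hq => n3 q (by omega))
          · simp
        · intro y hy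
          simp only [seg, List.mem_map, List.mem_range] at hy
          obtain ⟨i, hi, rfl⟩ := hy
          refine hkey (s.ra 2 (o + s1.nv 1 + i), s.ra 3 (o + s1.nv 1 + i)) ?_
          rw [lvl, seg, List.mem_map]
          exact ⟨s1.nv 1 + i, by simp; omega, by rw [add_assoc]⟩
    · rintro s1 ⟨h0, h3, h4, h5, h6, hna, hra, hit, h1, h1m, hM⟩ h ht
      simp [h6] at h ht ⊢
      refine ⟨h0, h3, h4, h5, hna, hra, hit, by omega, by omega, ?_, by omega⟩
      have := hM.append_right (seg (s.ra 2) (s.ra 3) (o + s1.nv 1) (m - s1.nv 1))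
      rwa [← seg_add, Nat.add_sub_cancel' h1m] at this
  · rintro s1 ⟨h0, h3, h4, h5, h6, hna, hra, hit, h1, h1m, hM, ht⟩
    simp [h4, h5, h6, lvl, hna, hra]
    refine ⟨by omega, ⟨?_, ?_, ?_, ?_⟩, ?_, hit, hM, h1, h1m, by omega⟩
    · simp [h0]
    · simp [h3]
    · intro j j1 j2; simp [j1, j2]
    · rintro j (rfl | rfl) <;> simp [hra]
    · intro i hi; simp [hi]

/-! ### Weighted selection: the main loop -/

/-- Weighted selection with a stack of levels in place of recursion; natural variable `4` is the
number of levels, and the answer is put into real variable `3`. -/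
def selectStmt : Stmt :=
  loop (.nlt (.lit 0) (.var 4))
    (ite (.nlt (.arr 2 (.var 4)) (.lit 1))
      (rset 3 (.arr 5 (.var 4)) ;; nset 4 (.sub (.var 4) (.lit 1)) ;;
        ite (.nlt (.lit 0) (.var 4)) pruneStmt skip)
      (ite (.nlt (.arr 2 (.var 4)) (.lit 60))
        (rset 3 (.arr 2 (.arr 1 (.var 4))) ;; pruneStmt)
        pushStmt))

/-- The invariant of the selection loop: the levels are consecutive, the answer of each level but
the first is a good pivot for the level below it, and the answer of the first has the property
that is wanted. -/
structure Stack (R : ℝ → Prop) (s : St E) : Prop where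
  -- The first inequality bounds the number of levels, which keeps their tables addressable; the
  -- second leaves room for the medians of the level.
  size : ∀ i, 1 ≤ i → i ≤ s.nv 4 → i ≤ s.na 1 i + 1 ∧ s.na 1 i + 2 * s.na 2 i ≤ 2 * E.n
  sep : ∀ i j, 1 ≤ i → i < j → j ≤ s.nv 4 → s.na 1 i + s.na 2 i ≤ s.na 1 j
  item : ∀ i, 1 ≤ i → i ≤ s.nv 4 → ∀ y ∈ lvl s i, y.1 < 1 ∧ 0 ≤ y.2
  pivot : ∀ i, 1 ≤ i → i < s.nv 4 → ∀ a,
    Ans (lvl s (i + 1)) (s.ra 4 (i + 1)) (s.ra 5 (i + 1)) a → GoodPivot (lvl s i) a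
  bot : 1 ≤ s.nv 4 → ∀ a, Ans (lvl s 1) (s.ra 4 1) (s.ra 5 1) a → R a
  fin : s.nv 4 = 0 → R (s.rv 3)

theorem length_lvl (s : St E) (i : ℕ) : (lvl s i).length = s.na 2 i := length_seg ..

/-- Every answer for the pruned top level is also one for the top level before pruning, so `pivot`
and `bot` persist. -/
theorem Stack.wp_pruneStmt {R : ℝ → Prop} (hL : 1000 * E.n ≤ 2 ^ (E.w * E.k)) (hn : 1 ≤ E.n)
    {s : St E} (h : Stack R s) (hl : 1 ≤ s.nv 4) (hp : ∃ y ∈ lvl s (s.nv 4), y.1 = s.rv 3) :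
    wp pruneStmt s (fun s' => Stack R s' ∧ Keep s s' ∧ s'.nv 4 = s.nv 4 ∧
      (∀ i ≠ s.nv 4, s'.na 2 i = s.na 2 i) ∧
      (s'.na 2 (s.nv 4) = ((lvl s (s.nv 4)).filter (fun y => y.1 < s.rv 3)).length ∨
        s'.na 2 (s.nv 4) = ((lvl s (s.nv 4)).filter (fun y => s.rv 3 < y.1)).length) ∧
      s'.tm ≤ s.tm + 20 * s.na 2 (s.nv 4) + 20) := by
  obtain ⟨hs1, hs2⟩ := h.size (s.nv 4) hl le_rfl
  refine (RealRAM.wp_pruneStmt hL hn s (by omega) (by omega)).mono ?_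
  rintro s' ⟨hK, ⟨o, top, hsz, hbd, hhi, hit⟩, hans, ht⟩
  have hlen : s'.na 2 (s.nv 4) = ((lvl s (s.nv 4)).filter (fun y => y.1 < s.rv 3)).length ∨
      s'.na 2 (s.nv 4) = ((lvl s (s.nv 4)).filter (fun y => s.rv 3 < y.1)).length := by
    rw [← length_lvl]
    rcases hans with ⟨-, e, -⟩ | ⟨-, e, -⟩ <;> rw [e] <;> simp
  have hle : s'.na 2 (s.nv 4) ≤ s.na 2 (s.nv 4) := by
    rw [← length_lvl s]
    rcases hlen with e | e <;> rw [e] <;> exact List.length_filter_le _ _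
  have hsub : ∀ y ∈ lvl s' (s.nv 4), y ∈ lvl s (s.nv 4) := by
    intro y hy
    rcases hans with ⟨-, e, -⟩ | ⟨-, e, -⟩ <;> rw [e] at hy <;> exact List.mem_of_mem_filter hy
  have hlvl : ∀ i, 1 ≤ i → i < s.nv 4 → lvl s' i = lvl s i := by
    intro i h1 h2
    have := h.sep i _ h1 h2 le_rfl
    rw [lvl, lvl, o, hsz i (by omega)]
    exact seg_congr (fun q _ hq => (hit q (by omega)).1) (fun q _ hq => (hit q (by omega)).2)
  have hAns : ∀ a, Ans (lvl s' (s.nv 4)) (s'.ra 4 (s.nv 4)) (s'.ra 5 (s.nv 4)) a →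
      Ans (lvl s (s.nv 4)) (s.ra 4 (s.nv 4)) (s.ra 5 (s.nv 4)) a := by
    intro a ha
    rcases hans with ⟨h1, e1, e2, e3⟩ | ⟨h1, e1, e2, e3⟩
    · rw [e1, e2, e3] at ha
      exact ha.of_filter_lt hp h1
    · rw [e1, e2, e3] at ha
      exact ha.of_filter_gt (fun y hy => (h.item _ hl le_rfl y hy).2) h1
  refine ⟨⟨?_, ?_, ?_, ?_, ?_, by omega⟩, hK, top, hsz, hlen, ht⟩
  · intro i h1 h2
    rw [top] at h2
    rw [o]
    obtain ⟨h3, h4⟩ := h.size i h1 h2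
    by_cases hi : i = s.nv 4
    · subst hi; omega
    · rw [hsz i hi]; omega
  · intro i j h1 h2 h3
    rw [top] at h3
    rw [o, hsz i (by omega)]
    exact h.sep i j h1 h2 h3
  · intro i h1 h2 y hy
    rw [top] at h2
    by_cases hi : i = s.nv 4
    · subst hi; exact h.item _ h1 h2 y (hsub y hy)
    · rw [hlvl i h1 (by omega)] at hy
      exact h.item i h1 h2 y hy
  · intro i h1 h2 a ha
    rw [top] at h2
    rw [hlvl i h1 h2]
    apply h.pivot i h1 h2
    by_cases hi : i + 1 = s.nv 4
    · rw [hi] at ha ⊢; exact hAns a ha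
    · rwa [hlvl _ (by omega) (by omega), hbd _ hi, hhi _ hi] at ha
  · intro _ a ha
    apply h.bot hl
    by_cases hi : 1 = s.nv 4
    · rw [hi] at ha ⊢; exact hAns a ha
    · rwa [hlvl _ (by omega) (by omega), hbd _ hi, hhi _ hi] at ha

/-- Pay for the steps of the selection on `l` levels of the given sizes. -/
def pot (z : ℕ → ℕ) : ℕ → ℕ
  | 0 => 0
  -- A waiting level of size `z` will shrink to at most `(7 * z + 12) / 10` items, which costs `1400
  -- * z + 2410` as a new top; the rest of its share pays for the scan with `20 * z + 20` steps and
  -- for the tests.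
  | l + 1 => ∑ i ∈ Finset.range l, (1430 * z (i + 1) + 2440) + (2000 * z (l + 1) + 10)

theorem pot_congr {z z' : ℕ → ℕ} {l : ℕ} (h : ∀ i, 1 ≤ i → i < l → z i = z' i) (hl : 1 ≤ l) :
    pot z l + 2000 * z' l = pot z' l + 2000 * z l := by
  obtain ⟨l, rfl⟩ := Nat.exists_eq_add_of_le' hl
  have : ∑ i ∈ Finset.range l, (1430 * z (i + 1) + 2440) =
      ∑ i ∈ Finset.range l, (1430 * z' (i + 1) + 2440) :=
    Finset.sum_congr rfl fun i hi => by
      rw [Finset.mem_range] at hi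
      rw [h _ (by omega) (by omega)]
  simp only [pot, this]
  omega

/-- Making the top level wait releases `570 * z`. A push spends at most `400 * z` on the potential
of its medians and `60 * z` on its steps; the surplus `110 * z` covers all constants, as only levels
with at least `60` items are pushed. -/
theorem pot_succ {z : ℕ → ℕ} {l : ℕ} (hl : 1 ≤ l) :
    pot z (l + 1) + 570 * z l = pot z l + 2430 + 2000 * z (l + 1) + 10 := by
  obtain ⟨l, rfl⟩ := Nat.exists_eq_add_of_le' hl
  simp only [pot, Finset.sum_range_succ]
  omega

theorem wp_selectStmt {R : ℝ → Prop} (hL : 1000 * E.n ≤ 2 ^ (E.w * E.k)) (hn : 1 ≤ E.n) (s : St E)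
    (hs : Stack R s) :
    wp selectStmt s (fun s' => Keep s s' ∧ R (s'.rv 3) ∧
      s'.tm ≤ s.tm + pot (s.na 2) (s.nv 4) + 1) := by
  refine wp_loop (fun s' => Keep s s' ∧ Stack R s') (fun s' => pot (s'.na 2) (s'.nv 4))
    ⟨.refl s, hs⟩ ?_ ?_
  · rintro s1 ⟨hK, h⟩
    refine ⟨by simp, fun hc => ?_⟩
    simp only [Cond.Holds, NExp.eval] at hc
    obtain ⟨hs1, hs2⟩ := h.size (s1.nv 4) hc le_rfl
    simp only [wp_ite, Cond.Ok, Cond.Holds, NExp.Ok, NExp.eval, true_and, and_true, St.tick]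
    refine ⟨by omega, fun hz => ?_, fun hz => ⟨by omega, fun hz2 => ?_, fun hz2 => ?_⟩⟩
    -- The `hi` of the empty top level answers it, hence is a good pivot for the level below or, at
    -- the bottom, the result.
    · have hemp : lvl s1 (s1.nv 4) = [] := by
        rw [← List.length_eq_zero_iff, length_lvl]; omega
      refine wp.seq (R := fun s' => s'.nv = s1.nv ∧ s'.na = s1.na ∧ s'.ra = s1.ra ∧
        s'.rv 3 = s1.ra 5 (s1.nv 4) ∧ s'.tm = s1.tm + 3) (by simp; omega) ?_
      rintro s2 ⟨g1, g2, g3, g4, g5⟩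
      refine wp.seq (R := fun s' => (Keep s s' ∧ Stack R s') ∧ s'.na = s1.na ∧
        s'.nv 4 + 1 = s1.nv 4 ∧
        (1 ≤ s'.nv 4 → GoodPivot (lvl s' (s'.nv 4)) (s'.rv 3)) ∧ s'.tm = s1.tm + 4) ?_ ?_
      · simp [g1, g2, g3, g4, g5]
        have hl : ∀ i (v : ℕ → ℕ) (r : ℕ → ℝ) (t : ℕ), lvl
            ({ nv := v, rv := r, na := s1.na, ra := s1.ra, out := s2.out, tm := t } : St E) i =
            lvl s1 i := fun _ _ _ _ => rfl
        refine ⟨hc, ⟨?_, ?_⟩, by omega, ?_⟩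
        · exact hK.trans ⟨by simp, by simp, fun _ _ _ => rfl, fun _ _ => rfl⟩
        · constructor
          · intro i h1 h2
            simp at h2 ⊢
            exact h.size i h1 (by omega)
          · intro i j h1 h2 h3
            simp at h3 ⊢
            exact h.sep i j h1 h2 (by omega)
          · intro i h1 h2 y hy
            simp [hl] at h2 hy
            exact h.item i h1 (by omega) y hy
          · intro i h1 h2 a ha
            simp [hl] at h2 ha ⊢
            exact h.pivot i h1 (by omega) a ha
          · intro h2 a ha
            simp [hl] at h2 ha ⊢
            exact h.bot (by omega) a ha
          · intro h2
            simp [g4] at h2 ⊢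
            have h4 : s1.nv 4 = 1 := by omega
            apply h.bot hc
            rw [h4] at hemp ⊢
            rw [hemp]
            exact ans_nil _ _
        · intro h1
          rw [hl]
          have h4 : s1.nv 4 - 1 + 1 = s1.nv 4 := by omega
          apply h.pivot (s1.nv 4 - 1) (by omega) (by omega)
          rw [h4, hemp]
          exact ans_nil _ _
      · rintro s3 ⟨⟨fK, fS⟩, fna, f4, fp, ft⟩
        simp only [wp_ite, Cond.Ok, Cond.Holds, NExp.Ok, NExp.eval, true_and, St.tick]
        refine ⟨fun hl => ?_, fun hl => ?_⟩
        · have hgp := fp hl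
          have fS' : Stack R (s3.tick) := ⟨fS.size, fS.sep, fS.item, fS.pivot, fS.bot, fS.fin⟩
          refine (fS'.wp_pruneStmt hL hn hl hgp.mem).mono ?_
          rintro s4 ⟨k1, k2, k3, k4, k5, k6⟩
          simp only [St.tick] at k1 k2 k3 k4 k5 k6
          refine ⟨⟨fK.trans ⟨k2.size, k2.top, k2.na, k2.ra⟩, k1⟩, ?_⟩
          have e1 := hgp.lt
          have e2 := hgp.gt
          rw [length_lvl] at e1 e2
          have e3 : 10 * s4.na 2 (s3.nv 4) ≤ 7 * s3.na 2 (s3.nv 4) + 12 := by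
            rcases k5 with k5 | k5
            · exact (congrArg (10 * ·) k5).le.trans e1
            · exact (congrArg (10 * ·) k5).le.trans e2
          have e4 := pot_congr (z := s4.na 2) (z' := s3.na 2) (l := s3.nv 4)
            (fun i _ hi => k4 i (by omega)) hl
          have e5 := pot_succ (z := s3.na 2) hl
          rw [k3, ← f4, ← fna]
          omega
        · simp
          refine ⟨⟨⟨fK.size, fK.top, fK.na, fK.ra⟩,
            ⟨fS.size, fS.sep, fS.item, fS.pivot, fS.bot, fS.fin⟩⟩, ?_⟩
          have e0 : s3.nv 4 = 0 := by omega
          rw [← f4, e0]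
          simp [pot]
          omega
    -- The pivot is an item of the level and is itself removed, so the potential drops by at least
    -- `2000`. This pays for scanning fewer than `60` items.
    · refine wp.seq (R := fun s' => s'.nv = s1.nv ∧ s'.na = s1.na ∧ s'.ra = s1.ra ∧
        s'.rv 3 = s1.ra 2 (s1.na 1 (s1.nv 4)) ∧ s'.tm = s1.tm + 4) (by simp; omega) ?_
      rintro s2 ⟨g1, g2, g3, g4, g5⟩
      have hl : ∀ i, lvl s2 i = lvl s1 i := fun i => by rw [lvl, lvl, g2, g3]
      have hS2 : Stack R s2 := by
        constructor
        · rw [g1, g2]; exact h.size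
        · rw [g1, g2]; exact h.sep
        · intro i; rw [g1, hl]; exact h.item i
        · intro i; rw [g1, hl, hl, g3]; exact h.pivot i
        · rw [g1, hl, g3]; exact h.bot
        · rw [g1]; omega
      have hmem : (s1.ra 2 (s1.na 1 (s1.nv 4)), s1.ra 3 (s1.na 1 (s1.nv 4))) ∈
          lvl s1 (s1.nv 4) := by
        rw [lvl, seg, List.mem_map]
        exact ⟨0, by simp; omega, rfl⟩
      refine (hS2.wp_pruneStmt hL hn (by rw [g1]; exact hc)
        ⟨_, by rw [g1, hl]; exact hmem, g4.symm⟩).mono ?_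
      rintro s4 ⟨k1, k2, k3, k4, k5, k6⟩
      have hK2 : Keep s1 s2 := ⟨by rw [g1], by rw [g1], fun _ _ _ => by rw [g2],
        fun _ _ => by rw [g3]⟩
      refine ⟨⟨hK.trans (hK2.trans k2), k1⟩, ?_⟩
      rw [g1, hl, g4] at k5
      have e1 := length_filter_lt (lvl s1 (s1.nv 4)) (s1.ra 2 (s1.na 1 (s1.nv 4)))
      have e2 := length_filter_gt (lvl s1 (s1.nv 4)) (s1.ra 2 (s1.na 1 (s1.nv 4)))
      have e3 : 1 ≤ cntGe (lvl s1 (s1.nv 4)) (s1.ra 2 (s1.na 1 (s1.nv 4))) :=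
        List.countP_pos_iff.2 ⟨_, hmem, by simp⟩
      have e4 : 1 ≤ cntLe (lvl s1 (s1.nv 4)) (s1.ra 2 (s1.na 1 (s1.nv 4))) :=
        List.countP_pos_iff.2 ⟨_, hmem, by simp⟩
      rw [length_lvl] at e1 e2
      have e5 : s4.na 2 (s1.nv 4) + 1 ≤ s1.na 2 (s1.nv 4) := by
        rcases k5 with k5 | k5 <;> rw [k5] <;> omega
      rw [g1, g2] at k4 k6
      have e6 := pot_congr (z := s4.na 2) (z' := s1.na 2) (l := s1.nv 4)
        (fun i _ hi => k4 i (by omega)) hc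
      rw [k3, g1]
      omega
    · refine (wp_pushStmt hL hn { s1 with tm := s1.tm + 1 + 1 + 1 }
        (by show s1.nv 4 ≤ _; omega) hs2
        (fun y hy => (h.item _ hc le_rfl y hy).1)).mono ?_
      rintro s2 ⟨k1, k2, k3, k4, k5, k6, k7, k8, k9, k10, k11⟩
      dsimp only at k2 k3 k4 k5 k7 k8 k9 k10 k11
      have hl : ∀ i, 1 ≤ i → i ≤ s1.nv 4 → lvl s2 i = lvl s1 i := by
        intro i h1 h2
        have hle : s1.na 1 i + s1.na 2 i ≤ s1.na 1 (s1.nv 4) + s1.na 2 (s1.nv 4) := by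
          rcases h2.lt_or_eq with h3 | rfl
          · have := h.sep i _ h1 h3 le_rfl; omega
          · exact le_rfl
        obtain ⟨j1, j2, -⟩ := k3 i (by omega)
        rw [lvl, lvl, j1, j2]
        exact seg_congr (fun q _ hq => (k4 q (by omega)).1) (fun q _ hq => (k4 q (by omega)).2)
      refine ⟨⟨hK.trans ⟨k1.size, k1.top, k1.na, k1.ra⟩, ?_⟩, ?_⟩
      · constructor
        · intro i h1 h2
          rw [k2] at h2
          by_cases hi : i = s1.nv 4 + 1
          · rw [hi, k5]; omega
          · rw [(k3 i hi).1, (k3 i hi).2.1]; exact h.size i h1 (by omega)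
        · intro i j h1 h2 h3
          rw [k2] at h3
          rw [(k3 i (by omega)).1, (k3 i (by omega)).2.1]
          by_cases hj : j = s1.nv 4 + 1
          · rw [hj, k5]
            by_cases hi : i = s1.nv 4
            · rw [hi]
            · have := h.sep i (s1.nv 4) h1 (by omega) le_rfl; omega
          · rw [(k3 j hj).1]; exact h.sep i j h1 h2 (by omega)
        · intro i h1 h2 y hy
          rw [k2] at h2
          by_cases hi : i = s1.nv 4 + 1
          · rw [hi] at hy
            obtain ⟨z, hz, e⟩ := k6.mem y hy
            exact ⟨e ▸ (h.item _ hc le_rfl z hz).1, by rw [k6.wt y hy]; norm_num⟩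
          · rw [hl i h1 (by omega)] at hy
            exact h.item i h1 (by omega) y hy
        · intro i h1 h2 a ha
          rw [k2] at h2
          rw [hl i h1 (by omega)]
          by_cases hi : i = s1.nv 4
          · rw [hi, k9, k10] at ha
            rw [hi]
            have q1 : 1 ≤ s2.na 2 (s1.nv 4 + 1) := by omega
            refine k6.goodPivot (by rw [length_lvl]; exact q1) ?_
              (fun y hy => (h.item _ hc le_rfl y hy).1) (by rw [length_lvl]; exact ha)
            rw [length_lvl, length_lvl]; exact k8
          · rw [hl _ (by omega) (by omega), (k3 _ (by omega)).2.2.1,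
              (k3 _ (by omega)).2.2.2] at ha
            exact h.pivot i h1 (by omega) a ha
        · intro _ a ha
          rw [hl _ le_rfl hc, (k3 _ (by omega)).2.2.1, (k3 _ (by omega)).2.2.2] at ha
          exact h.bot hc a ha
        · omega
      · have e1 := pot_congr (z := s2.na 2) (z' := s1.na 2) (l := s1.nv 4)
          (fun i _ hi => (k3 i (by omega)).2.1) hc
        have e2 := pot_succ (z := s2.na 2) hc
        have e3 := (k3 (s1.nv 4) (by omega)).2.1
        rw [k2]
        omega
  · rintro s1 ⟨hK, h⟩ hc ht
    simp only [Cond.Holds, NExp.eval] at hc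
    refine ⟨⟨hK.size, hK.top, hK.na, hK.ra⟩, h.fin (by omega), ?_⟩
    have e0 : s1.nv 4 = 0 := by omega
    have e1 : pot (s1.na 2) 0 = 0 := rfl
    rw [e0, e1] at ht
    simp
    omega

theorem sumGt_seg (F G : ℕ → ℝ) (n : ℕ) (p : ℝ) :
    sumGt (seg F G 0 n) p = ∑ i ∈ Finset.range n, if p < F i then G i else 0 := by
  induction n with
  | zero => simp [seg, sumGt]
  | succ n ih =>
    rw [seg_succ, sumGt_append, ih, Finset.sum_range_succ]
    by_cases h : p < F n <;> simp [sumGt, h]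

end RealRAM

namespace BinTree

/-! ### Lower bound for the weight of a tree -/

theorem leaves_map {α β : Type*} (f : α → β) (t : BinTree α) :
    (t.map f).leaves = t.leaves.map f := by
  induction t with
  | leaf => simp [map, leaves]
  | one t ih => simpa [map, leaves] using ih
  | two l r ihl ihr => simp [map, leaves, ihl, ihr]

theorem one_le_card_leaves {α : Type*} (t : BinTree α) : 1 ≤ t.leaves.card := by
  induction t with
  | leaf => simp [leaves]
  | one t ih => simpa [leaves] using ih
  | two l r ihl ihr => simp [leaves]; omega

theorem le_weight {t : BinTree ℝ} {x : ℝ} (h : x ∈ t.leaves) : x ≤ t.weight := by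
  induction t with
  | leaf => simp [leaves] at h; simp [weight, h]
  | one t ih => have := ih h; rw [weight]; linarith
  | two l r ihl ihr =>
    rw [weight]
    rcases Multiset.mem_add.1 h with h | h
    · have := (ihl h).trans (le_max_left _ r.weight); linarith
    · have := (ihr h).trans (le_max_right l.weight _); linarith

theorem weight_map_mono {α : Type*} (t : BinTree α) {f g : α → ℝ} {c : ℝ}
    (h : ∀ a, f a + c ≤ g a) : (t.map f).weight + c ≤ (t.map g).weight := by
  induction t with
  | leaf a => exact h a
  | one t ih => simp only [map, weight]; linarith
  | two l r ihl ihr =>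
    have h1 := ihl.trans (le_max_left _ (r.map g).weight)
    have h2 := ihr.trans (le_max_right (l.map g).weight _)
    have : max (l.map f).weight (r.map f).weight ≤ max (l.map g).weight (r.map g).weight - c :=
      max_le (by linarith) (by linarith)
    simp only [map, weight]; linarith

/-- Small leaf weights can be replaced by zero if the weight of the root is large. -/
theorem exists_clamp (c : ℝ) (t : BinTree ℝ) :
    ∃ t' : BinTree ℝ, t'.leaves = t.leaves.map (fun r => max (r + c) 0) ∧
      t'.weight ≤ max (t.weight + c) (t.leaves.card - 1) := by
  induction t with
  | leaf x => exact ⟨leaf (max (x + c) 0), by simp [leaves], by simp [leaves, weight]⟩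
  | one t ih =>
    obtain ⟨t', h1, h2⟩ := ih
    -- Unary nodes are dropped; otherwise a clamped leaf could push the weight beyond the number of
    -- leaves.
    refine ⟨t', h1, h2.trans (max_le_max ?_ le_rfl)⟩
    rw [weight]; linarith
  | two l r ihl ihr =>
    obtain ⟨l', hl1, hl2⟩ := ihl
    obtain ⟨r', hr1, hr2⟩ := ihr
    refine ⟨two l' r', by simp [leaves, hl1, hr1], ?_⟩
    have hl : (1 : ℝ) ≤ l.leaves.card := by exact_mod_cast one_le_card_leaves l
    have hr : (1 : ℝ) ≤ r.leaves.card := by exact_mod_cast one_le_card_leaves r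
    have h1 := le_max_left l.weight r.weight
    have h2 := le_max_right l.weight r.weight
    simp only [leaves, weight, Multiset.card_add, Nat.cast_add]
    -- The heavier child decides. If it is bounded by its number of leaves, its sibling supplies the
    -- additional leaf that pays for the new node.
    rcases le_max_iff.1 hl2 with hl2 | hl2 <;> rcases le_max_iff.1 hr2 with hr2 | hr2
    · apply le_max_of_le_left
      have : max l'.weight r'.weight ≤ max l.weight r.weight + c :=
        max_le (by linarith) (by linarith)
      linarith
    · rcases le_total l'.weight r'.weight with h | h
      · apply le_max_of_le_right; rw [max_eq_right h]; linarith
      · apply le_max_of_le_left; rw [max_eq_left h]; linarith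
    · rcases le_total l'.weight r'.weight with h | h
      · apply le_max_of_le_left; rw [max_eq_right h]; linarith
      · apply le_max_of_le_right; rw [max_eq_left h]; linarith
    · apply le_max_of_le_right
      have : max l'.weight r'.weight ≤ l.leaves.card + r.leaves.card - 2 :=
        max_le (by linarith) (by linarith)
      linarith

/-- A form of Kraft's inequality. -/
theorem sum_zpow_le (t : BinTree ℝ) (p : ℝ) :
    (t.leaves.map fun r => (2 : ℝ) ^ ⌈r - p⌉).sum ≤ 2 ^ ⌈t.weight - p⌉ := by
  have key : ∀ v w : ℝ, v ≤ w → (2 : ℝ) ^ ⌈v - p⌉ ≤ 2 ^ ⌈w - p⌉ := fun v w h =>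
    zpow_le_zpow_right₀ (by norm_num) (Int.ceil_le_ceil (by linarith))
  induction t with
  | leaf x => simp [leaves, weight]
  | one t ih => exact ih.trans (key _ _ (by rw [weight]; linarith))
  | two l r ihl ihr =>
    have h1 := ihl.trans (key _ _ (le_max_left l.weight r.weight))
    have h2 := ihr.trans (key _ _ (le_max_right l.weight r.weight))
    -- The `+ 1` of the node passes through the ceiling and doubles the power, which makes room for
    -- both subtrees.
    rw [leaves, Multiset.map_add, Multiset.sum_add, weight,
      show max l.weight r.weight + 1 - p = max l.weight r.weight - p + 1 by ring, Int.ceil_add_one,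
      zpow_add_one₀ (by norm_num)]
    linarith

end BinTree

namespace RealRAM

open WordRAM Stmt

variable {E : Env}

/-- This turns the exponents in Kraft's inequality into the levels `lev u p i`. -/
theorem ceil_sub {u p : ℝ} (hu : 0 ≤ u) (h0 : 0 ≤ p) (h1 : p < 1) :
    ⌈u - p⌉ = ((⌊u⌋₊ + if p < u - ⌊u⌋₊ then 1 else 0 : ℕ) : ℤ) := by
  have h2 := Nat.floor_le hu
  have h3 := Nat.lt_floor_add_one u
  rw [Int.ceil_eq_iff]
  split_ifs with h <;> push_cast <;> constructor <;> linarith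

/-- The items of the selection problem. -/
noncomputable def items (n : ℕ) (u : ℕ → ℝ) : List (ℝ × ℝ) :=
  seg (fun i => u i - ⌊u i⌋₊) (fun i => 2 ^ ⌊u i⌋₊) 0 n

/-- The level of a leaf: its weight rounded up after subtraction of `φ`. -/
noncomputable def lev (u : ℕ → ℝ) (φ : ℝ) (i : ℕ) : ℕ :=
  ⌊u i⌋₊ + if φ < u i - ⌊u i⌋₊ then 1 else 0

/-- Raising an item by one level doubles its power, so each item above `φ` contributes its weight
once more. -/
theorem sum_lev (n : ℕ) (u : ℕ → ℝ) (φ : ℝ) :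
    ∑ i ∈ Finset.range n, (2 : ℝ) ^ lev u φ i =
      ∑ i ∈ Finset.range n, 2 ^ ⌊u i⌋₊ + sumGt (items n u) φ := by
  rw [items, sumGt_seg, ← Finset.sum_add_distrib]
  refine Finset.sum_congr rfl fun i _ => ?_
  rw [lev]
  split_ifs <;> simp [pow_succ]; ring

/-- The fractional part `φ` of the optimum solves the selection problem. -/
def IsFrac (n : ℕ) (u : ℕ → ℝ) (m₀ : ℕ) (φ : ℝ) : Prop :=
  Ans (items n u) (2 ^ m₀ - ∑ i ∈ Finset.range n, 2 ^ ⌊u i⌋₊) 1 φ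

section Optimum

variable {n : ℕ} {u : ℕ → ℝ} {m₀ : ℕ} {φ : ℝ}

theorem mem_items {y : ℝ × ℝ} (hu : ∀ i < n, 0 ≤ u i) (h : y ∈ items n u) :
    0 ≤ y.1 ∧ y.1 < 1 ∧ 0 ≤ y.2 := by
  rw [items, seg, List.mem_map] at h
  obtain ⟨i, hi, rfl⟩ := h
  have hi : i < n := by simpa using hi
  simp only [zero_add]
  have h2 := Nat.floor_le (hu i hi)
  have h3 := Nat.lt_floor_add_one (u i)
  refine ⟨by linarith, by linarith, by positivity⟩

theorem IsFrac.mem_Icc (hu : ∀ i < n, 0 ≤ u i) (h : IsFrac n u m₀ φ) : 0 ≤ φ ∧ φ ≤ 1 := by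
  rcases h.1 with rfl | ⟨y, hy, rfl, -⟩
  · norm_num
  · exact ⟨(mem_items hu hy).1, (mem_items hu hy).2.1.le⟩

/-- If the fallback `1` is the answer, no item is raised and the choice of `m₀` suffices; otherwise
the answer meets the bound by definition. -/
theorem IsFrac.sum_le (hu : ∀ i < n, 0 ≤ u i) (hm : IsTop n u m₀) (h : IsFrac n u m₀ φ) :
    ∑ i ∈ Finset.range n, (2 : ℝ) ^ lev u φ i ≤ 2 ^ m₀ := by
  rw [sum_lev]
  rcases h.1 with rfl | ⟨y, hy, -, h1⟩
  · have : sumGt (items n u) 1 = 0 := by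
      rw [sumGt, List.filter_eq_nil_iff.2]
      · simp
      · intro y hy; simpa using (mem_items hu hy).2.1.le
    rw [this, add_zero]; exact hm.le
  · linarith

/-- Minimality of `m₀`, with an integer exponent to include `m₀ = 0`, where it holds because a
nonempty sum is at least `1`. -/
theorem IsTop.zpow_lt (hn : 1 ≤ n) (hm : IsTop n u m₀) :
    (2 : ℝ) ^ ((m₀ : ℤ) - 1) < ∑ i ∈ Finset.range n, 2 ^ ⌊u i⌋₊ := by
  rcases Nat.eq_zero_or_pos m₀ with rfl | h0
  · have : (1 : ℝ) ≤ ∑ i ∈ Finset.range n, 2 ^ ⌊u i⌋₊ :=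
      (one_le_pow₀ (by norm_num : (1 : ℝ) ≤ 2) (n := ⌊u 0⌋₊)).trans
        (Finset.single_le_sum (f := fun i => (2 : ℝ) ^ ⌊u i⌋₊) (fun i _ => by positivity)
          (Finset.mem_range.2 hn))
    refine lt_of_lt_of_le ?_ this
    norm_num
  · have := hm.lt (m₀ - 1) (by omega)
    rwa [← zpow_natCast, Nat.cast_sub h0, Nat.cast_one] at this

/-- No tree has weight less than `m₀ + φ`. -/
theorem IsFrac.le_weight (hn : 1 ≤ n) (hu : ∀ i < n, 0 ≤ u i) (hm : IsTop n u m₀)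
    (h : IsFrac n u m₀ φ) (t : BinTree ℝ)
    (ht : t.leaves = Finset.univ.val.map fun i : Fin n => u i) :
    m₀ + φ ≤ t.weight := by
  have kraft : ∀ p, 0 ≤ p → p < 1 → ∑ i ∈ Finset.range n, (2 : ℝ) ^ ⌊u i⌋₊ +
      sumGt (items n u) p ≤ 2 ^ ⌈t.weight - p⌉ := by
    intro p h0 h1
    refine le_of_eq_of_le ?_ (t.sum_zpow_le p)
    rw [← sum_lev, ht, Multiset.map_map, ← Fin.sum_univ_eq_sum_range (fun i => (2 : ℝ) ^ lev u p i)]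
    refine Finset.sum_congr rfl fun i _ => ?_
    simp only [Function.comp]
    rw [ceil_sub (hu i i.2) h0 h1, zpow_natCast, lev]
  have hz := hm.zpow_lt hn
  obtain ⟨hφ0, hφ1⟩ := h.mem_Icc hu
  by_contra! hlt
  by_cases hM : (m₀ : ℝ) ≤ t.weight
  -- With this `p` the weight of the root is rounded to exactly `m₀`.
  · set p := t.weight - m₀ with hp
    have hpφ : p < φ := by linarith
    have hk := kraft p (by linarith) (by linarith)
    rw [show t.weight - p = ((m₀ : ℤ) : ℝ) by rw [hp]; push_cast; ring, Int.ceil_intCast,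
      zpow_natCast] at hk
    by_cases hne : (items n u).filter (fun y => y.1 ≤ p) = []
    -- No key is at most `p`, so every item is raised; the doubled sum is at most `2 ^ m₀`, against
    -- the minimality of `m₀`.
    · have : sumGt (items n u) p = ∑ i ∈ Finset.range n, 2 ^ ⌊u i⌋₊ := by
        rw [items, sumGt_seg]
        refine Finset.sum_congr rfl fun i hi => if_pos ?_
        rw [List.filter_eq_nil_iff] at hne
        have := hne (u i - ⌊u i⌋₊, 2 ^ ⌊u i⌋₊) (by
          rw [items, seg, List.mem_map]
          exact ⟨i, by simpa using hi, by simp⟩)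
        simpa only [decide_eq_true_eq, not_le] using this
      have e : (2 : ℝ) ^ m₀ = 2 * 2 ^ ((m₀ : ℤ) - 1) := by
        rw [← zpow_one_add₀ (by norm_num)]
        rw [← zpow_natCast]; congr 1; ring
      rw [this, e] at hk
      linarith
    -- The largest key up to `p` has the same items above it as `p`, so it meets the bound although
    -- it is smaller than `φ`.
    · obtain ⟨y, hy, hmax⟩ := Finset.exists_max_image
        ((items n u).filter (fun y => y.1 ≤ p)).toFinset Prod.fst
        (by simpa only [List.toFinset_nonempty_iff] using hne)
      simp only [List.mem_toFinset, List.mem_filter, decide_eq_true_eq] at hy hmax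
      have h1 := h.2 y hy.1 (hy.2.trans_lt hpφ)
      have h2 : sumGt (items n u) y.1 = sumGt (items n u) p := by
        rw [sumGt, sumGt]
        congr 2
        apply List.filter_congr
        intro z hz
        by_cases hza : p < z.1
        · simp [hza, hy.2.trans_lt hza]
        · simp [hza, hmax z ⟨hz, not_lt.1 hza⟩]
      rw [h2] at h1
      linarith
  -- The weight is below `m₀`: removing its fractional part leaves an exponent of at most `m₀ - 1`,
  -- while the unraised sum is already too large.
  · have hk := kraft (Int.fract t.weight) (Int.fract_nonneg _) (Int.fract_lt_one _)
    rw [show t.weight - Int.fract t.weight = (⌊t.weight⌋ : ℝ) from Int.self_sub_fract _,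
      Int.ceil_intCast] at hk
    have h1 : ⌊t.weight⌋ ≤ (m₀ : ℤ) - 1 := by
      have : ⌊t.weight⌋ < (m₀ : ℤ) := Int.floor_lt.2 (by push_cast; linarith)
      omega
    have h2 : (2 : ℝ) ^ ⌊t.weight⌋ ≤ 2 ^ ((m₀ : ℤ) - 1) :=
      zpow_le_zpow_right₀ (by norm_num) h1
    have h3 : 0 ≤ sumGt (items n u) (Int.fract t.weight) := by
      rw [items, sumGt_seg]
      exact Finset.sum_nonneg fun i _ => by split_ifs <;> positivity
    linarith

end Optimum

/-- A tree of weight at most `m₀ + φ` for the shifted weights is a minimax tree. -/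
theorem IsFrac.isMinimax {n : ℕ} (hn : 1 ≤ n) {x : ℕ → ℝ} {mx : ℝ} (hx : ∃ i < n, x i = mx)
    {m₀ : ℕ} {φ : ℝ} (hm : IsTop n (fun i => max (x i - mx + n) 0) m₀)
    (h : IsFrac n (fun i => max (x i - mx + n) 0) m₀ φ) (t : BinTree (Fin n))
    (ht : t.leaves = Finset.univ.val)
    (hw : (t.map fun i : Fin n => max (x i - mx + n) 0).weight ≤ m₀ + φ) :
    (t.map fun i : Fin n => x i).IsMinimax (Finset.univ.val.map fun i : Fin n => x i) := by
  refine ⟨by rw [BinTree.leaves_map, ht], fun t' ht' => ?_⟩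
  obtain ⟨s, hs1, hs2⟩ := BinTree.exists_clamp (n - mx) t'
  have h1 := h.le_weight hn (fun i _ => le_max_right _ _) hm s (by
    rw [hs1, ht', Multiset.map_map]
    refine Multiset.map_congr rfl fun i _ => ?_
    simp only [Function.comp]; congr 1; ring)
  have h2 := t.weight_map_mono (f := fun i : Fin n => x i)
    (g := fun i : Fin n => max (x i - mx + n) 0)
    (c := n - mx) (fun i => le_max_of_le_left (by linarith))
  obtain ⟨i, hi, rfl⟩ := hx
  -- The shift moves the largest weight to `n`, so every tree weighs at least `n` afterwards and the
  -- alternative `n - 1` in `exists_clamp` is void.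
  have h3 : x i ≤ t'.weight := BinTree.le_weight (by
    rw [ht']; exact Multiset.mem_map.2 ⟨⟨i, hi⟩, by simp, rfl⟩)
  have h4 : t'.leaves.card = n := by rw [ht']; simp
  rw [h4, max_eq_left (by linarith)] at hs2
  linarith

/-! ### Building the tree -/

/-- The linked list starting with `h` consists of the given nodes; links are shifted by one, and
`0` stands for the empty list. -/
def IsList (nxt : ℕ → ℕ) : ℕ → List ℕ → Prop
  | h, [] => h = 0
  | h, a :: l => h = a + 1 ∧ IsList nxt (nxt a) l

theorem IsList.congr {nxt nxt' : ℕ → ℕ} {h : ℕ} {l : List ℕ} (hl : IsList nxt h l)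
    (hn : ∀ a ∈ l, nxt' a = nxt a) : IsList nxt' h l := by
  induction l generalizing h with
  | nil => exact hl
  | cons a l ih =>
    refine ⟨hl.1, ?_⟩
    rw [hn a (by simp)]
    exact ih hl.2 fun b hb => hn b (by simp [hb])

theorem IsList.eq_nil {nxt : ℕ → ℕ} {h : ℕ} {l : List ℕ} (hl : IsList nxt h l) :
    h = 0 ↔ l = [] := by
  cases l with
  | nil => simpa [IsList] using hl
  | cons a l => simp [hl.1]

/-- The tables of kinds and children describe node `a` of the forest `tr`. -/
def Node {n : ℕ} (kd lc rc : ℕ → ℕ) (tr : ℕ → BinTree (Fin n)) (a : ℕ) : Prop :=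
  (kd a = 0 ∧ ∃ i, tr a = .leaf i ∧ lc a = i) ∨
  (kd a = 1 ∧ lc a < a ∧ tr a = .one (tr (lc a))) ∨
  (kd a = 2 ∧ lc a < a ∧ rc a < a ∧ tr a = .two (tr (lc a)) (tr (rc a)))

theorem Node.congr {n : ℕ} {kd lc rc kd' lc' rc' : ℕ → ℕ} {tr tr' : ℕ → BinTree (Fin n)} {a : ℕ}
    (h : Node kd lc rc tr a) (h1 : kd' a = kd a) (h2 : lc' a = lc a) (h3 : rc' a = rc a)
    (h4 : ∀ b ≤ a, tr' b = tr b) : Node kd' lc' rc' tr' a := by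
  rw [Node, h1, h2, h3, h4 a le_rfl]
  refine h.imp id (Or.imp ?_ ?_)
  · rintro ⟨e1, e2, e3⟩
    exact ⟨e1, e2, by rw [h4 _ e2.le, e3]⟩
  · rintro ⟨e1, e2, e3, e4⟩
    exact ⟨e1, e2, e3, by rw [h4 _ e2.le, h4 _ e3.le, e4]⟩

/-- The state holds a forest with nodes `0, …, c - 1`; the roots are distributed to linked lists,
and a tree at level `v` has weight at most `v + φ`. -/
structure Forest (u : ℕ → ℝ) (φ : ℝ) (c : ℕ) (ls : ℕ → List ℕ) (tr : ℕ → BinTree (Fin E.n))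
    (s : St E) : Prop where
  head : ∀ v, IsList (s.na 4) (s.na 3 v) (ls v)
  lt : ∀ v, ∀ a ∈ ls v, a < c
  node : ∀ a < c, Node (s.na 5) (s.na 6) (s.na 7) tr a
  wt : ∀ v, ∀ a ∈ ls v, ((tr a).map fun i : Fin E.n => u i).weight ≤ v + φ

theorem Forest.congr {u : ℕ → ℝ} {φ : ℝ} {c : ℕ} {ls : ℕ → List ℕ} {tr : ℕ → BinTree (Fin E.n)}
    {s s' : St E} (h : Forest u φ c ls tr s) (hna : s'.na = s.na) : Forest u φ c ls tr s' :=
  ⟨by rw [hna]; exact h.head, h.lt, by rw [hna]; exact h.node, h.wt⟩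

/-- Add a node to a list. -/
theorem Forest.push {u : ℕ → ℝ} {φ : ℝ} {c : ℕ} {ls : ℕ → List ℕ} {tr : ℕ → BinTree (Fin E.n)}
    {s s' : St E} (h : Forest u φ c ls tr s) {v : ℕ} {T : BinTree (Fin E.n)}
    (h3 : s'.na 3 = Function.update (s.na 3) v (c + 1))
    (h4 : s'.na 4 = Function.update (s.na 4) c (s.na 3 v))
    (h5 : ∀ a < c, s'.na 5 a = s.na 5 a ∧ s'.na 6 a = s.na 6 a ∧ s'.na 7 a = s.na 7 a)
    (hN : Node (s'.na 5) (s'.na 6) (s'.na 7) (Function.update tr c T) c)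
    (hT : (T.map fun i : Fin E.n => u i).weight ≤ v + φ) :
    Forest u φ (c + 1) (Function.update ls v (c :: ls v)) (Function.update tr c T) s' := by
  have hl : ∀ v', IsList (s'.na 4) (s.na 3 v') (ls v') := fun v' =>
    (h.head v').congr fun a ha => by
      rw [h4, Function.update_of_ne (h.lt v' a ha).ne]
  constructor
  · intro v'
    by_cases hv : v' = v
    · subst hv
      rw [h3, Function.update_self, Function.update_self]
      refine ⟨rfl, ?_⟩
      have := hl v'
      rwa [show s'.na 4 c = s.na 3 v' by rw [h4, Function.update_self]]
    · rw [h3, Function.update_of_ne hv, Function.update_of_ne hv]; exact hl v'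
  · intro v' a ha
    by_cases hv : v' = v
    · subst hv
      rw [Function.update_self, List.mem_cons] at ha
      rcases ha with rfl | ha
      · omega
      · have := h.lt _ a ha; omega
    · rw [Function.update_of_ne hv] at ha
      have := h.lt _ a ha; omega
  · intro a ha
    rcases Nat.lt_succ_iff_lt_or_eq.1 ha with ha | rfl
    · obtain ⟨e1, e2, e3⟩ := h5 a ha
      exact (h.node a ha).congr e1 e2 e3 fun b hb => Function.update_of_ne (by omega) _ _
    · exact hN
  · intro v' a ha
    by_cases hv : v' = v
    · subst hv
      rw [Function.update_self, List.mem_cons] at ha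
      rcases ha with rfl | ha
      · rwa [Function.update_self]
      · rw [Function.update_of_ne (h.lt _ a ha).ne]; exact h.wt _ a ha
    · rw [Function.update_of_ne hv] at ha
      rw [Function.update_of_ne (h.lt _ a ha).ne]; exact h.wt _ a ha

/-- Replace a list by a part of it. -/
theorem Forest.pop {u : ℕ → ℝ} {φ : ℝ} {c : ℕ} {ls : ℕ → List ℕ} {tr : ℕ → BinTree (Fin E.n)}
    {s s' : St E} (h : Forest u φ c ls tr s) {v p : ℕ} {l : List ℕ}
    (h3 : s'.na 3 = Function.update (s.na 3) v p) (h4 : s'.na 4 = s.na 4)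
    (h5 : ∀ a < c, s'.na 5 a = s.na 5 a ∧ s'.na 6 a = s.na 6 a ∧ s'.na 7 a = s.na 7 a)
    (hp : IsList (s.na 4) p l) (hl : l ⊆ ls v) :
    Forest u φ c (Function.update ls v l) tr s' := by
  have hsub : ∀ v', Function.update ls v l v' ⊆ ls v' := by
    intro v'
    by_cases hv : v' = v
    · subst hv; rwa [Function.update_self]
    · rw [Function.update_of_ne hv]; exact fun _ => id
  constructor
  · intro v'
    rw [h3, h4]
    by_cases hv : v' = v
    · subst hv; rwa [Function.update_self, Function.update_self]
    · rw [Function.update_of_ne hv, Function.update_of_ne hv]; exact h.head v'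
  · exact fun v' a ha => h.lt v' a (hsub v' ha)
  · intro a ha
    obtain ⟨e1, e2, e3⟩ := h5 a ha
    exact (h.node a ha).congr e1 e2 e3 fun _ _ => rfl
  · exact fun v' a ha => h.wt v' a (hsub v' ha)

/-- The sum over all roots up to level `m`. -/
def total {M : Type*} [AddCommMonoid M] (m : ℕ) (f : ℕ → ℕ → M) (ls : ℕ → List ℕ) : M :=
  ∑ v ∈ Finset.range (m + 1), ((ls v).map (f v)).sum

/-- Stated for commutative monoids so that it serves the multiset of leaves, the Kraft sum and the
number of roots alike. -/
theorem total_cons {M : Type*} [AddCommMonoid M] {m : ℕ} (f : ℕ → ℕ → M) (ls : ℕ → List ℕ) {v : ℕ}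
    (hv : v ≤ m) (a : ℕ) (l : List ℕ) :
    total m f (Function.update ls v (a :: l)) = f v a + total m f (Function.update ls v l) := by
  have hv : v ∈ Finset.range (m + 1) := by simp; omega
  rw [total, total, ← Finset.add_sum_erase _ _ hv, ← Finset.add_sum_erase _ _ hv]
  simp only [Function.update_self, List.map_cons, List.sum_cons, add_assoc]
  congr 2
  refine Finset.sum_congr rfl fun w hw => ?_
  rw [Function.update_of_ne (Finset.ne_of_mem_erase hw),
    Function.update_of_ne (Finset.ne_of_mem_erase hw)]

theorem total_congr {M : Type*} [AddCommMonoid M] {m : ℕ} {f g : ℕ → ℕ → M} {ls : ℕ → List ℕ}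
    (h : ∀ v, ∀ a ∈ ls v, f v a = g v a) : total m f ls = total m g ls :=
  Finset.sum_congr rfl fun v _ => by rw [List.map_congr_left (h v)]

/-! ### Distributing the leaves to their levels -/

/-- Put the leaves into the lists of their levels. -/
def leavesStmt : Stmt :=
  nset 1 (.lit 0) ;;
  loop (.nlt (.var 1) (.var 0))
    ((nset 2 (.arr 0 (.var 1)) ;; ite (.rlt (.var 3) (.arr 1 (.var 1))) (incr 2) skip) ;;
      nput 4 (.var 1) (.arr 3 (.var 2)) ;; nput 3 (.var 2) (.add (.var 1) (.lit 1)) ;;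
      nput 5 (.var 1) (.lit 0) ;; nput 6 (.var 1) (.var 1) ;; incr 1)

/-- A forest together with the totals of its leaves, of the powers of two for the levels, and of
its roots. -/
structure Totals (m₀ : ℕ) (ls : ℕ → List ℕ) (tr : ℕ → BinTree (Fin E.n))
    (L : Multiset (Fin E.n)) (K N : ℕ) : Prop where
  leaves : total m₀ (fun _ a => (tr a).leaves) ls = L
  kraft : total m₀ (fun v _ => 2 ^ v) ls = K
  live : total m₀ (fun _ _ => 1) ls = N

theorem lev_le {n : ℕ} {u : ℕ → ℝ} {φ : ℝ} {m₀ : ℕ}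
    (h : ∑ i ∈ Finset.range n, (2 : ℝ) ^ lev u φ i ≤ 2 ^ m₀) {i : ℕ} (hi : i < n) :
    lev u φ i ≤ m₀ := by
  have h1 : (2 : ℝ) ^ lev u φ i ≤ 2 ^ m₀ :=
    (Finset.single_le_sum (f := fun i => (2 : ℝ) ^ lev u φ i) (fun i _ => by positivity)
      (Finset.mem_range.2 hi)).trans h
  exact (pow_le_pow_iff_right₀ (by norm_num)).1 h1

theorem le_lev_add {u : ℕ → ℝ} {φ : ℝ} (hφ : 0 ≤ φ) (i : ℕ) : u i ≤ lev u φ i + φ := by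
  have := Nat.lt_floor_add_one (u i)
  rw [lev]
  split_ifs with h
  · push_cast; linarith
  · push_cast; linarith

/-- Leaf `i` becomes node `i` and enters the list of level `lev u φ i`. Levels are at most `m₀`
because a single term cannot exceed the Kraft sum, so the lists act as buckets and no sorting is
needed. -/
theorem wp_leavesStmt (hL : 1000 * E.n ≤ 2 ^ (E.w * E.k)) (hn : 1 ≤ E.n) (s : St E) {u : ℕ → ℝ}
    {φ : ℝ} {m₀ : ℕ} (hφ : 0 ≤ φ)
    (hsum : ∑ i ∈ Finset.range E.n, (2 : ℝ) ^ lev u φ i ≤ 2 ^ m₀) (hm : m₀ ≤ 2 * E.n)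
    (h0 : s.nv 0 = E.n) (h3 : s.nv 3 = m₀) (hp : s.rv 3 = φ) (hint : ∀ i < E.n, s.na 0 i = ⌊u i⌋₊)
    (hfrac : ∀ i < E.n, s.ra 1 i = u i - ⌊u i⌋₊) (hhead : ∀ v, s.na 3 v = 0) :
    wp leavesStmt s (fun s' => s'.nv 0 = E.n ∧ s'.nv 3 = m₀ ∧ (∃ ls tr K, Forest u φ E.n ls tr s' ∧
      Totals m₀ ls tr Finset.univ.val K E.n ∧ K ≤ 2 ^ m₀ ∧ ∀ v > m₀, ls v = []) ∧
      s'.tm ≤ s.tm + 20 * E.n) := by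
  simp only [leavesStmt, wp_seq (a := nset 1 _), wp_prim, Prim.Ok, Prim.run, NExp.Ok, NExp.eval,
    true_and]
  refine wp_loop (fun s' => s'.nv 0 = E.n ∧ s'.nv 3 = m₀ ∧ s'.rv 3 = φ ∧ s'.nv 1 ≤ E.n ∧
    s'.na 0 = s.na 0 ∧ s'.ra 1 = s.ra 1 ∧ ∃ ls tr, Forest u φ (s'.nv 1) ls tr s' ∧
      Totals m₀ ls tr (Finset.univ.filter fun i : Fin E.n => i.val < s'.nv 1).val
        (∑ i ∈ Finset.range (s'.nv 1), 2 ^ lev u φ i) (s'.nv 1) ∧ ∀ v > m₀, ls v = [])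
    (fun s' => 9 * (E.n - s'.nv 1)) ?_ ?_ ?_
  · refine ⟨by simp [h0], by simp [h3], hp, by simp, rfl, rfl, fun _ => [],
      fun _ => .leaf ⟨0, hn⟩, ?_, ?_, fun _ _ => rfl⟩
    · constructor <;> simp [IsList, hhead]
    · constructor <;> simp [total]
  · rintro s1 ⟨g0, g3, gp, g1, gA, gF, ls, tr, hF, hT, hls⟩
    refine ⟨by simp, fun h => ?_⟩
    simp only [Cond.Holds, NExp.eval, g0] at h
    have hlev := lev_le hsum h
    refine wp.seq (R := fun s' => s'.nv 0 = E.n ∧ s'.nv 3 = m₀ ∧ s'.rv 3 = φ ∧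
      s'.nv 1 = s1.nv 1 ∧ s'.nv 2 = lev u φ (s1.nv 1) ∧ s'.na = s1.na ∧ s'.ra 1 = s.ra 1 ∧
      s'.tm = s1.tm + 4) ?_ ?_
    · simp [g0, g3, gp, gA, gF, hint _ h, hfrac _ h]
      refine ⟨by omega, fun hlt => ?_, fun hlt => ?_⟩
      · rw [lev, if_pos (by linarith)]
      · rw [lev, if_neg (by linarith), add_zero]
    rintro s2 ⟨f0, f3, fp, f1, f2, fna, fra, ft⟩
    simp [f0, f1, f2, f3, fp, fna, fra, gA]
    refine ⟨⟨by omega, by omega⟩, by omega, by omega, ⟨h, ?_⟩, by omega⟩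
    refine ⟨_, Function.update tr (s1.nv 1) (.leaf ⟨s1.nv 1, h⟩),
      hF.push (v := lev u φ (s1.nv 1)) (T := .leaf ⟨s1.nv 1, h⟩) ?_ ?_ ?_ ?_ ?_, ⟨?_, ?_, ?_⟩, ?_⟩
    · simp
    · simp
    · intro a ha; simp [ha.ne]
    · left; simp
    · simpa [BinTree.map, BinTree.weight] using le_lev_add hφ (s1.nv 1)
    · rw [total_cons _ _ hlev, Function.update_eq_self, total_congr
        (g := fun _ a => (tr a).leaves) fun v a ha => by
          rw [Function.update_of_ne (hF.lt v a ha).ne], hT.leaves, Function.update_self]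
      have : (Finset.univ.filter fun i : Fin E.n => i.val < s1.nv 1 + 1) =
          Finset.cons ⟨s1.nv 1, h⟩ (Finset.univ.filter fun i : Fin E.n => i.val < s1.nv 1)
            (by simp) := by
        ext i; simp [Fin.ext_iff]; omega
      simp only [Order.lt_add_one_iff] at this
      refine Eq.trans ?_ (congrArg Finset.val this.symm)
      rw [Finset.cons_val, BinTree.leaves, Multiset.singleton_add]
    · rw [total_cons _ _ hlev, Function.update_eq_self, hT.kraft, Finset.sum_range_succ, add_comm]
    · rw [total_cons _ _ hlev, Function.update_eq_self, hT.live, add_comm]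
    · intro v hv
      rw [Function.update_of_ne (by omega), hls v hv]
  · rintro s1 ⟨g0, g3, gp, g1, gA, gF, ls, tr, hF, hT, hls⟩ h ht
    simp [g0] at h ht ⊢
    have e : s1.nv 1 = E.n := by omega
    rw [e] at hF hT
    refine ⟨g3, ⟨ls, tr, hF.congr rfl, ∑ i ∈ Finset.range E.n, 2 ^ lev u φ i, ?_, ?_, hls⟩,
      by omega⟩
    · simpa using hT
    · exact_mod_cast hsum

/-! ### Pairing the roots level by level -/

/-- Make one tree of the first two trees (or the only tree) of a list. -/
def joinStmt : Stmt :=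
  nset 5 (.sub (.arr 3 (.var 1)) (.lit 1)) ;; nset 6 (.arr 4 (.var 5)) ;;
  nput 6 (.var 2) (.var 5) ;;
  ite (.nlt (.var 6) (.lit 1)) (nput 5 (.var 2) (.lit 1))
    (nput 5 (.var 2) (.lit 2) ;; nput 7 (.var 2) (.sub (.var 6) (.lit 1)) ;;
      nset 6 (.arr 4 (.sub (.var 6) (.lit 1))))

/-- Pair the trees of each level, and move them up by one level. -/
def pairStmt : Stmt :=
  nset 1 (.lit 0) ;; nset 2 (.var 0) ;;
  loop (.nlt (.var 1) (.var 3))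
    (ite (.nlt (.arr 3 (.var 1)) (.lit 1)) (incr 1)
      (joinStmt ;;
        nput 3 (.var 1) (.var 6) ;; nput 4 (.var 2) (.arr 3 (.add (.var 1) (.lit 1))) ;;
        nput 3 (.add (.var 1) (.lit 1)) (.add (.var 2) (.lit 1)) ;; incr 2))

/-- All trees are at level `v` or above, and there is room for the further steps. -/
structure Paired (u : ℕ → ℝ) (φ : ℝ) (m₀ : ℕ) (ls : ℕ → List ℕ) (tr : ℕ → BinTree (Fin E.n))
    (K N : ℕ) (s : St E) : Prop where
  top : s.nv 3 = m₀
  le : s.nv 1 ≤ m₀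
  forest : Forest u φ (s.nv 2) ls tr s
  totals : Totals m₀ ls tr Finset.univ.val K N
  low : ∀ v < s.nv 1, ls v = []
  high : ∀ v > m₀, ls v = []
  -- Every new node is paid for: joining two roots lowers `N`, a unary node empties its list and
  -- uses up the last summand, and going up a level frees `2`, enough for the next list. Initially
  -- the sum is at most `2 * n + 4 * n + 1`.
  room : s.nv 2 + N + 2 * (m₀ - s.nv 1) + (if ls (s.nv 1) = [] then 0 else 1) ≤ 6 * E.n + 1
  -- All roots lie at the current level `v` or above, so `K` is a multiple of `2 ^ v` and the first
  -- alternative says `K ≤ 2 ^ m₀`; the strict form avoids divisibility. Lifting a leftover root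
  -- adds `2 ^ v`, which the second alternative admits until the level rises.
  kraft : K < 2 ^ m₀ + 2 ^ s.nv 1 ∨ (ls (s.nv 1) = [] ∧ K < 2 ^ m₀ + 2 ^ (s.nv 1 + 1))

/-- The trees of the two smallest roots of the list at level `v` become one tree `T`. -/
structure Joined (u : ℕ → ℝ) (φ : ℝ) (m₀ : ℕ) (ls : ℕ → List ℕ) (tr : ℕ → BinTree (Fin E.n))
    (K N v c : ℕ) (l : List ℕ) (T : BinTree (Fin E.n)) (s s' : St E) : Prop where
  na3 : s'.na 3 = s.na 3
  na4 : s'.na 4 = s.na 4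
  below : ∀ a < c, s'.na 5 a = s.na 5 a ∧ s'.na 6 a = s.na 6 a ∧ s'.na 7 a = s.na 7 a
  list : IsList (s.na 4) (s'.nv 6) l
  sub : l ⊆ ls v
  node : Node (s'.na 5) (s'.na 6) (s'.na 7) (Function.update tr c T) c
  wt : (T.map fun i : Fin E.n => u i).weight ≤ (v + 1 : ℕ) + φ
  leaves : T.leaves + total m₀ (fun _ a => (tr a).leaves) (Function.update ls v l) =
    Finset.univ.val
  kraft : (l = [] ∧ K = 2 ^ v + total m₀ (fun v _ => 2 ^ v) (Function.update ls v l) ∧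
      N = 1 + total m₀ (fun _ _ => 1) (Function.update ls v l)) ∨
    (K = 2 ^ (v + 1) + total m₀ (fun v _ => 2 ^ v) (Function.update ls v l) ∧
      N = 2 + total m₀ (fun _ _ => 1) (Function.update ls v l))

theorem Joined.congr {u : ℕ → ℝ} {φ : ℝ} {m₀ : ℕ} {ls : ℕ → List ℕ}
    {tr : ℕ → BinTree (Fin E.n)} {K N v c : ℕ} {l : List ℕ} {T : BinTree (Fin E.n)} {s s' s2 : St E}
    (h : Joined u φ m₀ ls tr K N v c l T s s') (hna : s2.na = s.na) :
    Joined u φ m₀ ls tr K N v c l T s2 s' :=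
  ⟨hna ▸ h.na3, hna ▸ h.na4, hna ▸ h.below, hna ▸ h.list, h.sub, h.node, h.wt, h.leaves, h.kraft⟩

theorem Paired.congr {u : ℕ → ℝ} {φ : ℝ} {m₀ : ℕ} {ls : ℕ → List ℕ}
    {tr : ℕ → BinTree (Fin E.n)} {K N : ℕ} {s s' : St E} (h : Paired u φ m₀ ls tr K N s)
    (hnv : s'.nv = s.nv) (hna : s'.na = s.na) : Paired u φ m₀ ls tr K N s' :=
  ⟨hnv ▸ h.top, hnv ▸ h.le, hnv ▸ h.forest.congr hna, h.totals, hnv ▸ h.low, h.high, hnv ▸ h.room,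
    hnv ▸ h.kraft⟩

theorem Paired.joinOne {u : ℕ → ℝ} {φ : ℝ} {m₀ : ℕ} {ls : ℕ → List ℕ}
    {tr : ℕ → BinTree (Fin E.n)} {K N : ℕ} {s s' : St E} (h : Paired u φ m₀ ls tr K N s) {a : ℕ}
    (ha : ls (s.nv 1) = [a]) (h3 : s'.na 3 = s.na 3) (h4 : s'.na 4 = s.na 4)
    (h5 : s'.na 5 = Function.update (s.na 5) (s.nv 2) 1)
    (h6 : s'.na 6 = Function.update (s.na 6) (s.nv 2) a) (h7 : s'.na 7 = s.na 7)
    (hv6 : s'.nv 6 = 0) :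
    Joined u φ m₀ ls tr K N (s.nv 1) (s.nv 2) [] (.one (tr a)) s s' := by
  have hac : a < s.nv 2 := h.forest.lt _ a (by rw [ha]; simp)
  have hls : ls = Function.update ls (s.nv 1) [a] := by rw [← ha, Function.update_eq_self]
  have hT := h.totals
  have e1 := hT.leaves
  have e2 := hT.kraft
  have e3 := hT.live
  rw [hls, total_cons _ _ h.le] at e1 e2 e3
  refine ⟨h3, h4, fun b hb => ?_, hv6, List.nil_subset _, ?_, ?_, e1, .inl ⟨rfl, e2.symm, e3.symm⟩⟩
  · rw [h5, h6, h7, Function.update_of_ne hb.ne, Function.update_of_ne hb.ne]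
    exact ⟨rfl, rfl, rfl⟩
  · right; left
    rw [h5, h6]
    simp [hac, hac.ne]
  · have := h.forest.wt _ a (by rw [ha]; simp)
    simp only [BinTree.map, BinTree.weight]
    push_cast; linarith

theorem Paired.joinTwo {u : ℕ → ℝ} {φ : ℝ} {m₀ : ℕ} {ls : ℕ → List ℕ}
    {tr : ℕ → BinTree (Fin E.n)} {K N : ℕ} {s s' : St E} (h : Paired u φ m₀ ls tr K N s) {a b : ℕ}
    {l : List ℕ} (ha : ls (s.nv 1) = a :: b :: l) (h3 : s'.na 3 = s.na 3) (h4 : s'.na 4 = s.na 4)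
    (h5 : s'.na 5 = Function.update (s.na 5) (s.nv 2) 2)
    (h6 : s'.na 6 = Function.update (s.na 6) (s.nv 2) a)
    (h7 : s'.na 7 = Function.update (s.na 7) (s.nv 2) b)
    (hv6 : s'.nv 6 = s.na 4 b) :
    Joined u φ m₀ ls tr K N (s.nv 1) (s.nv 2) l (.two (tr a) (tr b)) s s' := by
  have hac : a < s.nv 2 := h.forest.lt _ a (by rw [ha]; simp)
  have hbc : b < s.nv 2 := h.forest.lt _ b (by rw [ha]; simp)
  have hls : ls = Function.update ls (s.nv 1) (a :: b :: l) := by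
    rw [← ha, Function.update_eq_self]
  have hlist := h.forest.head (s.nv 1)
  rw [ha] at hlist
  have hT := h.totals
  have e1 := hT.leaves
  have e2 := hT.kraft
  have e3 := hT.live
  rw [hls, total_cons _ _ h.le, total_cons _ _ h.le, ← add_assoc] at e1 e2 e3
  refine ⟨h3, h4, fun c hc => ?_, by rw [hv6]; exact hlist.2.2, ?_, ?_, ?_, e1,
    .inr ⟨by rw [← e2, pow_succ, mul_two], e3.symm⟩⟩
  · rw [h5, h6, h7, Function.update_of_ne hc.ne, Function.update_of_ne hc.ne,
      Function.update_of_ne hc.ne]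
    exact ⟨rfl, rfl, rfl⟩
  · rw [ha]; exact fun x hx => by simp [hx]
  · right; right
    rw [h5, h6, h7]
    simp [hac, hac.ne, hbc, hbc.ne]
  · have h1 := h.forest.wt _ a (by rw [ha]; simp)
    have h2 := h.forest.wt _ b (by rw [ha]; simp)
    simp only [BinTree.map, BinTree.weight]
    push_cast
    have := max_le h1 h2
    linarith

theorem Paired.up {u : ℕ → ℝ} {φ : ℝ} {m₀ : ℕ} {ls : ℕ → List ℕ}
    {tr : ℕ → BinTree (Fin E.n)} {K N : ℕ} {s s' : St E} (h : Paired u φ m₀ ls tr K N s)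
    (hl : ls (s.nv 1) = []) (hlt : s.nv 1 < m₀) (hna : s'.na = s.na) (h1 : s'.nv 1 = s.nv 1 + 1)
    (h2 : s'.nv 2 = s.nv 2) (h3 : s'.nv 3 = s.nv 3) : Paired u φ m₀ ls tr K N s' := by
  have hr := h.room
  have hk := h.kraft
  rw [hl] at hr hk
  refine ⟨h3.trans h.top, by omega, by rw [h2]; exact h.forest.congr hna, h.totals, ?_, h.high,
    ?_, ?_⟩
  · intro v hv
    rcases Nat.lt_succ_iff_lt_or_eq.1 (h1 ▸ hv) with hv | rfl
    · exact h.low v hv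
    · exact hl
  · simp at hr
    rw [h1, h2]
    split_ifs <;> omega
  · rw [h1, pow_succ]
    rw [pow_succ] at hk
    left
    omega

theorem Paired.join {u : ℕ → ℝ} {φ : ℝ} {m₀ : ℕ} {ls : ℕ → List ℕ}
    {tr : ℕ → BinTree (Fin E.n)} {K N : ℕ} {s s' s2 : St E} (h : Paired u φ m₀ ls tr K N s)
    (hl : ls (s.nv 1) ≠ []) (hlt : s.nv 1 < m₀) {l : List ℕ} {T : BinTree (Fin E.n)}
    (hj : Joined u φ m₀ ls tr K N (s.nv 1) (s.nv 2) l T s s')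
    (h3 : s2.na 3 = Function.update (Function.update (s'.na 3) (s.nv 1) (s'.nv 6)) (s.nv 1 + 1)
      (s.nv 2 + 1))
    (h4 : s2.na 4 = Function.update (s'.na 4) (s.nv 2) (s'.na 3 (s.nv 1 + 1)))
    (h5 : s2.na 5 = s'.na 5) (h6 : s2.na 6 = s'.na 6) (h7 : s2.na 7 = s'.na 7)
    (g1 : s2.nv 1 = s.nv 1) (g2 : s2.nv 2 = s.nv 2 + 1) (g3 : s2.nv 3 = s.nv 3) :
    ∃ ls tr K N, Paired u φ m₀ ls tr K N s2 := by
  set v := s.nv 1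
  set c := s.nv 2
  -- An auxiliary state: the used roots have left their list, and `T` has not yet entered its own.
  let sm : St E := { s with na := Function.update s'.na 3 (Function.update (s'.na 3) v (s'.nv 6)) }
  have hF1 : Forest u φ c (Function.update ls v l) tr sm := by
    refine h.forest.pop (v := v) (p := s'.nv 6) ?_ ?_ ?_ hj.list hj.sub
    · simp [sm, hj.na3]
    · simp [sm, hj.na4]
    · intro a ha; simpa [sm] using hj.below a ha
  have hF2 := hF1.push (s' := s2) (v := v + 1) (T := T) (by rw [h3]; simp [sm])
    (by rw [h4]; simp [sm]) (fun a _ => by rw [h5, h6, h7]; simp [sm])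
    (by rw [h5, h6, h7]; exact hj.node) hj.wt
  have hv : v + 1 ≤ m₀ := hlt
  refine ⟨_, _, _, _, ⟨g3.trans h.top, g1 ▸ h.le, g2 ▸ hF2, ⟨?_, rfl, rfl⟩, ?_, ?_, ?_, ?_⟩⟩
  · rw [total_cons _ _ hv, Function.update_eq_self, Function.update_self, total_congr
      (g := fun _ a => (tr a).leaves) fun w a ha => by
        rw [Function.update_of_ne (hF1.lt w a ha).ne]]
    exact hj.leaves
  · intro w hw
    rw [g1] at hw
    rw [Function.update_of_ne (by omega), Function.update_of_ne (by omega), h.low w hw]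
  · intro w hw
    rw [Function.update_of_ne (by omega), Function.update_of_ne (by omega), h.high w hw]
  · have hr := h.room
    rw [if_neg hl] at hr
    rw [total_cons _ _ hv, Function.update_eq_self, g1, g2, Function.update_of_ne (by omega),
      Function.update_self]
    rcases hj.kraft with ⟨e, -, e2⟩ | ⟨-, e2⟩
    · rw [if_pos e]; omega
    · split_ifs <;> omega
  · rw [total_cons _ _ hv, Function.update_eq_self, g1, Function.update_of_ne (by omega),
      Function.update_self]
    have hk : K < 2 ^ m₀ + 2 ^ v := h.kraft.resolve_right fun e => hl e.1
    rcases hj.kraft with ⟨e, e2, -⟩ | ⟨e2, -⟩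
    · right
      refine ⟨e, ?_⟩
      rw [pow_succ]; omega
    · left; omega

theorem Paired.wp_joinStmt (hL : 1000 * E.n ≤ 2 ^ (E.w * E.k)) {u : ℕ → ℝ} {φ : ℝ} {m₀ : ℕ}
    (hm : m₀ ≤ 2 * E.n) {ls : ℕ → List ℕ}
    {tr : ℕ → BinTree (Fin E.n)} {K N : ℕ} {s : St E} (hs : Paired u φ m₀ ls tr K N s)
    (hlt : s.nv 1 < m₀) (hl : ls (s.nv 1) ≠ []) (hn : 1 ≤ E.n) :
    wp joinStmt s
      (fun s' => (∃ l T, Joined u φ m₀ ls tr K N (s.nv 1) (s.nv 2) l T s s') ∧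
        s'.nv 0 = s.nv 0 ∧ s'.nv 1 = s.nv 1 ∧ s'.nv 2 = s.nv 2 ∧ s'.nv 3 = s.nv 3 ∧
        s'.tm ≤ s.tm + 7) := by
  have hr := hs.room
  obtain ⟨a, l, ha⟩ := List.exists_cons_of_ne_nil hl
  have hlist := hs.forest.head (s.nv 1)
  rw [ha] at hlist
  obtain ⟨e1, e2⟩ := hlist
  have hac : a < s.nv 2 := hs.forest.lt _ a (by rw [ha]; simp)
  have hbc : ∀ b ∈ l, b < s.nv 2 := fun b hb => hs.forest.lt _ b (by rw [ha]; simp [hb])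
  simp [joinStmt, e1]
  refine ⟨by omega, by omega, by omega, fun h0 => ?_, fun h0 => ?_⟩
  · rw [e2.eq_nil] at h0
    subst h0
    refine ⟨by omega, [], _, hs.joinOne ha (by simp) (by simp) (by simp) (by simp) (by simp)
      (by simpa [IsList] using e2)⟩
  · cases l with
    | nil => exact absurd e2 h0
    | cons b l =>
      have hb := hbc b (by simp)
      simp [e2.1]
      refine ⟨by omega, by omega, l, _, hs.joinTwo ha (by simp) (by simp) (by simp) (by simp)
        (by simp) (by simp)⟩

theorem wp_pairStmt (hL : 1000 * E.n ≤ 2 ^ (E.w * E.k)) (hn : 1 ≤ E.n) (s : St E) {u : ℕ → ℝ}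
    {φ : ℝ} {m₀ : ℕ} (hm : m₀ ≤ 2 * E.n) (h0 : s.nv 0 = E.n) (h3 : s.nv 3 = m₀)
    {ls : ℕ → List ℕ} {tr : ℕ → BinTree (Fin E.n)} {K : ℕ}
    (hF : Forest u φ E.n ls tr s) (hT : Totals m₀ ls tr Finset.univ.val K E.n) (hK : K ≤ 2 ^ m₀)
    (hls : ∀ v > m₀, ls v = []) :
    wp pairStmt s (fun s' => (∃ (tr : ℕ → BinTree (Fin E.n)) (r : ℕ),
      (∀ a < s'.nv 2, Node (s'.na 5) (s'.na 6) (s'.na 7) tr a) ∧ r < s'.nv 2 ∧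
      s'.nv 2 ≤ 6 * E.n + 1 ∧ s'.na 3 m₀ = r + 1 ∧ (tr r).leaves = Finset.univ.val ∧
      ((tr r).map fun i : Fin E.n => u i).weight ≤ m₀ + φ) ∧ s'.nv 3 = m₀ ∧
      s'.tm ≤ s.tm + 200 * E.n) := by
  simp only [pairStmt, wp_seq (a := nset 1 _), wp_seq (a := nset 2 _), wp_prim, Prim.Ok, Prim.run,
    NExp.Ok, NExp.eval, true_and]
  refine wp_loop (fun s' => ∃ ls tr K N, Paired u φ m₀ ls tr K N s')
    -- Each round either creates a node or goes up one level.
    (fun s' => 13 * (6 * E.n + 1 - s'.nv 2 + (m₀ - s'.nv 1))) ?_ ?_ ?_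
  · refine ⟨ls, tr, K, E.n, by simp [h3], by simp, ?_, hT, by simp, hls, ?_, .inl ?_⟩
    · refine Forest.congr (s := s) ?_ rfl
      simpa [h0] using hF
    · simp [h0]; split_ifs <;> omega
    · simp; omega
  · rintro s1 ⟨ls, tr, K, N, hs⟩
    have hle := hs.le
    have hr := hs.room
    simp [hs.top]
    intro hlt
    refine ⟨by omega, fun h => ?_, fun h => ?_⟩
    · rw [(hs.forest.head _).eq_nil] at h
      exact ⟨⟨ls, tr, K, N, hs.up h hlt rfl (by simp) (by simp) (by simp)⟩, by omega⟩
    · have hl : ls (s1.nv 1) ≠ [] := by rwa [Ne, ← (hs.forest.head _).eq_nil]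
      rw [if_neg hl] at hr
      refine wp.mono ((hs.congr (s' := { s1 with tm := s1.tm + 1 + 1 }) rfl rfl).wp_joinStmt hL hm
        hlt hl hn) ?_
      rintro s2 ⟨⟨l, T, hj⟩, -, f1, f2, f3, ft⟩
      simp at f1 f2 f3 ft hj
      simp [f1, f2]
      refine ⟨by omega, ⟨by omega, by omega⟩, by omega, ?_, by omega⟩
      exact hs.join hl hlt (hj.congr rfl) (by simp) (by simp) (by simp) (by simp) (by simp)
        (by simp [f1]) (by simp) (by simp [f3])
  · rintro s1 ⟨ls, tr, K, N, hs⟩ h ht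
    have hle := hs.le
    have hr := hs.room
    simp [hs.top] at h ht ⊢
    have e : s1.nv 1 = m₀ := le_antisymm hle h
    have hsum : ∀ {M : Type} [AddCommMonoid M] (f : ℕ → ℕ → M),
        total m₀ f ls = ((ls m₀).map (f m₀)).sum := fun f =>
      Finset.sum_eq_single _ (fun v hv hne => by
        rw [hs.low v (by rw [Finset.mem_range] at hv; omega)]; rfl) (by simp)
    have hlv := hs.totals.leaves
    have hkr := hs.totals.kraft
    rw [hsum] at hlv hkr
    obtain ⟨r, l, hrl⟩ : ∃ r l, ls m₀ = r :: l := by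
      refine List.exists_cons_of_ne_nil fun h0 => ?_
      rw [h0] at hlv
      have := congrArg Multiset.card hlv
      simp at this
      omega
    have hk := hs.kraft
    rw [e, hrl] at hk
    -- A second root at level `m₀` would make the Kraft sum at least `2 * 2 ^ m₀`.
    have hl : l = [] := by
      rw [hrl] at hkr
      cases l with
      | nil => rfl
      | cons b l =>
        simp only [List.map_cons, List.sum_cons] at hkr
        simp at hk
        omega
    subst hl
    have hhead := hs.forest.head m₀
    rw [hrl] at hhead hlv
    refine ⟨⟨tr, hs.forest.node, r, hs.forest.lt m₀ r (by rw [hrl]; simp), by omega, hhead.1, ?_,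
      hs.forest.wt m₀ r (by rw [hrl]; simp)⟩, by omega⟩
    simpa using hlv

/-! ### Writing the tree to the word memory -/

theorem readNum_congr {w : ℕ} {mem mem' : ℕ → BitVec w} (k a : ℕ)
    (h : ∀ j < k, mem' (a + j) = mem (a + j)) : readNum mem' k a = readNum mem k a := by
  induction k generalizing a with
  | zero => rfl
  | succ k ih =>
    rw [readNum, readNum, ih (a + 1) fun j hj => by
      rw [add_assoc, add_comm 1 j]; exact h (j + 1) (by omega)]
    have := h 0 (by omega)
    rw [add_zero] at this
    rw [this]

theorem readNum_digits {w : ℕ} {mem : ℕ → BitVec w} (k a v : ℕ)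
    (h : ∀ j < k, mem (a + j) = BitVec.ofNat w (v / 2 ^ (w * j))) :
    readNum mem k a = v % 2 ^ (w * k) := by
  induction k generalizing a v with
  | zero => simp [readNum, Nat.mod_one]
  | succ k ih =>
    have h0 := h 0 (by omega)
    rw [add_zero, mul_zero, pow_zero, Nat.div_one] at h0
    rw [readNum, h0, ih (a + 1) (v / 2 ^ w) fun j hj => by
      rw [add_assoc, add_comm 1 j, h (j + 1) (by omega), Nat.div_div_eq_div_mul, ← pow_add,
        mul_add, mul_one, add_comm w]]
    rw [BitVec.toNat_ofNat, mul_add, mul_one, add_comm _ w, pow_add, Nat.mod_mul]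

/-- Write `k` digits of variable `6` to the cells from the one given by variable `5` on. -/
def outNum : ℕ → Stmt
  | 0 => skip
  | k + 1 => outNum k ;; .prim (.out k (.add (.var 5) (.lit k)) (.var 6))

theorem wp_outNum {m : ℕ} (hm : m ≤ E.k) (s : St E) (h5 : s.nv 5 + m ≤ 2 ^ (E.w * E.k))
    (h6 : s.nv 6 < 2 ^ (E.w * E.k)) :
    wp (outNum m) s (fun s' => s'.nv = s.nv ∧ s'.na = s.na ∧ s'.tm = s.tm + (m + 1) ∧
      (∀ j < m, s'.out (s.nv 5 + j) = BitVec.ofNat E.w (s.nv 6 / 2 ^ (E.w * j))) ∧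
      ∀ c, (c < s.nv 5 ∨ s.nv 5 + m ≤ c) → s'.out c = s.out c) := by
  induction m with
  | zero => simp [outNum]
  | succ m ih =>
    refine wp.seq (ih (by omega) (by omega)) ?_
    rintro s1 ⟨e1, e2, e3, e4, e5⟩
    simp [e1, e2, e3, h6]
    refine ⟨by omega, by omega, fun j hj => ?_, fun c hc => ?_⟩
    · rcases Nat.le_iff_lt_or_eq.1 hj with hj | rfl
      · rw [Function.update_of_ne (by omega), e4 j hj]
      · rw [Function.update_self]
    · rw [Function.update_of_ne (by omega), e5 c (by omega)]

/-- The address of the record of node `a`. -/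
def recAdr (k a : ℕ) : ℕ := k + (2 * k + 2) * a

/-- There is a record with the given flags and fields at address `p`. -/
structure Rec {w : ℕ} (k : ℕ) (mem : ℕ → BitVec w) (p f g a b : ℕ) : Prop where
  flag₁ : mem p = BitVec.ofNat w f
  flag₂ : mem (p + 1) = BitVec.ofNat w g
  field₁ : readNum mem k (p + 2) = a
  field₂ : readNum mem k (p + 2 + k) = b

theorem Rec.congr {w : ℕ} {k : ℕ} {mem mem' : ℕ → BitVec w} {p f g a b : ℕ}
    (h : Rec k mem p f g a b) (hm : ∀ c, p ≤ c → c < p + (2 * k + 2) → mem' c = mem c) :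
    Rec k mem' p f g a b :=
  ⟨(hm _ le_rfl (by omega)).trans h.flag₁, (hm _ (by omega) (by omega)).trans h.flag₂,
    (readNum_congr _ _ fun j _ => hm _ (by omega) (by omega)).trans h.field₁,
    (readNum_congr _ _ fun j _ => hm _ (by omega) (by omega)).trans h.field₂⟩

/-- Write a record to the address in variable `4`, with flags in variables `7` and `8` and fields
in variables `6` and `9`. -/
def recStmt (k : ℕ) : Stmt :=
  .prim (.out 0 (.var 4) (.var 7)) ;; .prim (.out 0 (.add (.var 4) (.lit 1)) (.var 8)) ;;
  nset 5 (.add (.var 4) (.lit 2)) ;; outNum k ;;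
  nset 5 (.add (.var 5) (.lit k)) ;; nset 6 (.var 9) ;; outNum k

theorem wp_recStmt (hk : 0 < E.k) (s : St E) (h4 : s.nv 4 + (2 * E.k + 2) ≤ 2 ^ (E.w * E.k))
    (h6 : s.nv 6 < 2 ^ (E.w * E.k)) (h7 : s.nv 7 < 2 ^ (E.w * E.k)) (h8 : s.nv 8 < 2 ^ (E.w * E.k))
    (h9 : s.nv 9 < 2 ^ (E.w * E.k)) :
    wp (recStmt E.k) s (fun s' => s'.nv 1 = s.nv 1 ∧ s'.nv 2 = s.nv 2 ∧ s'.na = s.na ∧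
      s'.tm = s.tm + (2 * E.k + 7) ∧
      Rec E.k s'.out (s.nv 4) (s.nv 7) (s.nv 8) (s.nv 6) (s.nv 9) ∧
      ∀ c, (c < s.nv 4 ∨ s.nv 4 + (2 * E.k + 2) ≤ c) → s'.out c = s.out c) := by
  simp [recStmt, hk, h7, h8]
  refine ⟨by omega, by omega, wp.mono (wp_outNum le_rfl _ (by simp; omega) (by simpa using h6)) ?_⟩
  rintro s1 ⟨e1, e2, e3, e4, e5⟩
  simp at e1 e2 e3 e4 e5
  refine wp.mono (wp_outNum le_rfl _ (by simp [e1]; omega) (by simpa [e1] using h9)) ?_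
  rintro s2 ⟨f1, f2, f3, f4, f5⟩
  simp [e1, e2, e3] at f1 f2 f3 f4 f5
  simp [f1, f2]
  refine ⟨by omega, ⟨?_, ?_, ?_, ?_⟩, fun c hc => ?_⟩
  · rw [f5 _ (by omega), e5 _ (by omega), Function.update_of_ne (by omega), Function.update_self]
  · rw [f5 _ (by omega), e5 _ (by omega), Function.update_self]
  · rw [readNum_congr (mem := s1.out) _ _ fun j hj => f5 _ (by omega), readNum_digits _ _ _ e4,
      Nat.mod_eq_of_lt h6]
  · rw [readNum_digits _ _ _ f4, Nat.mod_eq_of_lt h9]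
  · rw [f5 _ (by omega), e5 _ (by omega), Function.update_of_ne (by omega),
      Function.update_of_ne (by omega)]

/-- The tables describe the record of node `a`. -/
def NodeRec {w : ℕ} (k : ℕ) (na : Fin 8 → ℕ → ℕ) (mem : ℕ → BitVec w) (a : ℕ) : Prop :=
  Rec k mem (recAdr k a) (if na 5 a < 1 then 0 else 1) (if na 5 a < 2 then 0 else 1)
    (if na 5 a < 1 then na 6 a else recAdr k (na 6 a))
    (if na 5 a < 2 then 0 else recAdr k (na 7 a))

/-- Children have smaller numbers than their parents, so induction on the number unfolds the tree. A
positive word length is needed for the flag `1` to be nonzero. -/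
theorem stores_of_nodeRec {w k n c : ℕ} (hw : 1 ≤ w) {na : Fin 8 → ℕ → ℕ} {mem : ℕ → BitVec w}
    {tr : ℕ → BinTree (Fin n)} (hN : ∀ a < c, Node (na 5) (na 6) (na 7) tr a)
    (hR : ∀ a < c, NodeRec k na mem a) (a : ℕ) (ha : a < c) :
    Stores k mem (recAdr k a) ((tr a).map Fin.val) := by
  have h1 : BitVec.ofNat w 1 ≠ 0 := by
    intro h
    have := congrArg BitVec.toNat h
    rw [BitVec.toNat_ofNat, Nat.mod_eq_of_lt (Nat.one_lt_two_pow (by omega))] at this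
    simp at this
  induction a using Nat.strong_induction_on with
  | _ a ih =>
    have hr := hR a ha
    rcases hN a ha with ⟨e, i, et, el⟩ | ⟨e, el, et⟩ | ⟨e, el, er, et⟩
    · simp only [NodeRec, e] at hr
      rw [et, BinTree.map, Stores, ← el]
      exact ⟨by simpa using hr.flag₁, by simpa using hr.field₁⟩
    · simp only [NodeRec, e] at hr
      rw [et, BinTree.map, Stores, hr.field₁]
      exact ⟨by rw [hr.flag₁]; exact h1, by simpa using hr.flag₂, ih _ el (by omega)⟩
    · simp only [NodeRec, e] at hr
      rw [et, BinTree.map, Stores, hr.field₁, hr.field₂]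
      exact ⟨by rw [hr.flag₁]; exact h1, by rw [hr.flag₂]; exact h1, ih _ el (by omega),
        ih _ er (by omega)⟩

/-- The address of the record of a node. -/
abbrev adrExp (k : ℕ) (a : NExp) : NExp := .add (.lit k) (.mulc (2 * k + 2) a)

/-- Write the record of the node with number in variable `1`. -/
def nodeStmt (k : ℕ) : Stmt :=
  nset 4 (adrExp k (.var 1)) ;; nset 6 (.arr 6 (.var 1)) ;; nset 7 (.lit 0) ;; nset 8 (.lit 0) ;;
  nset 9 (.lit 0) ;;
  ite (.nlt (.arr 5 (.var 1)) (.lit 1)) skip (nset 7 (.lit 1) ;; nset 6 (adrExp k (.var 6))) ;;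
  ite (.nlt (.arr 5 (.var 1)) (.lit 2)) skip
    (nset 8 (.lit 1) ;; nset 9 (adrExp k (.arr 7 (.var 1)))) ;;
  recStmt k

/-- Write the address of the root, then the records of all nodes. -/
def outputStmt (k : ℕ) : Stmt :=
  nset 5 (.lit 0) ;; nset 6 (adrExp k (.sub (.arr 3 (.var 3)) (.lit 1))) ;; outNum k ;;
  nset 1 (.lit 0) ;; loop (.nlt (.var 1) (.var 2)) (nodeStmt k ;; incr 1)

/-- The fields fit into `k` digits because labels are below `n` and `hA` bounds the addresses of all
children. The three kinds of nodes lead to the same final code, treated once in `key`. -/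
theorem wp_nodeStmt (hL : 1000 * E.n ≤ 2 ^ (E.w * E.k))
    (hA : recAdr E.k (6 * E.n + 2) ≤ 2 ^ (E.w * E.k)) (hk : 0 < E.k) (hn : 1 ≤ E.n) (s : St E)
    (h1 : s.nv 1 ≤ 6 * E.n) {tr : ℕ → BinTree (Fin E.n)}
    (hN : Node (s.na 5) (s.na 6) (s.na 7) tr (s.nv 1)) :
    wp (nodeStmt E.k) s (fun s' => s'.nv 1 = s.nv 1 ∧ s'.nv 2 = s.nv 2 ∧ s'.na = s.na ∧
      s'.tm ≤ s.tm + (2 * E.k + 18) ∧ NodeRec E.k s.na s'.out (s.nv 1) ∧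
      ∀ c, (c < recAdr E.k (s.nv 1) ∨ recAdr E.k (s.nv 1 + 1) ≤ c) → s'.out c = s.out c) := by
  have hadr : ∀ a ≤ 6 * E.n, recAdr E.k a + (2 * E.k + 2) ≤ 2 ^ (E.w * E.k) := by
    intro a ha
    refine le_trans ?_ hA
    have : (2 * E.k + 2) * (a + 1) ≤ (2 * E.k + 2) * (6 * E.n + 2) :=
      Nat.mul_le_mul_left _ (by omega)
    rw [mul_add, mul_one] at this
    simp only [recAdr]
    omega
  have hadr' : ∀ a ≤ 6 * E.n, recAdr E.k a < 2 ^ (E.w * E.k) := fun a ha => by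
    have := hadr a ha; omega
  have hb6 : (if s.na 5 (s.nv 1) < 1 then s.na 6 (s.nv 1) else recAdr E.k (s.na 6 (s.nv 1))) <
      2 ^ (E.w * E.k) := by
    rcases hN with ⟨e, i, et, el⟩ | ⟨e, el, et⟩ | ⟨e, el, er, et⟩
    · rw [e, el, if_pos (by omega)]; have := i.2; omega
    · rw [e, if_neg (by omega)]; exact hadr' _ (by omega)
    · rw [e, if_neg (by omega)]; exact hadr' _ (by omega)
  have hb9 : (if s.na 5 (s.nv 1) < 2 then 0 else recAdr E.k (s.na 7 (s.nv 1))) <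
      2 ^ (E.w * E.k) := by
    rcases hN with ⟨e, i, et, el⟩ | ⟨e, el, et⟩ | ⟨e, el, er, et⟩
    · rw [e, if_pos (by omega)]; omega
    · rw [e, if_pos (by omega)]; omega
    · rw [e, if_neg (by omega)]; exact hadr' _ (by omega)
  have key : ∀ s1 : St E, s1.nv 1 = s.nv 1 → s1.nv 2 = s.nv 2 → s1.na = s.na → s1.out = s.out →
      s1.tm ≤ s.tm + 11 → s1.nv 4 = recAdr E.k (s.nv 1) →
      s1.nv 7 = (if s.na 5 (s.nv 1) < 1 then 0 else 1) →
      s1.nv 8 = (if s.na 5 (s.nv 1) < 2 then 0 else 1) →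
      s1.nv 6 = (if s.na 5 (s.nv 1) < 1 then s.na 6 (s.nv 1) else recAdr E.k (s.na 6 (s.nv 1))) →
      s1.nv 9 = (if s.na 5 (s.nv 1) < 2 then 0 else recAdr E.k (s.na 7 (s.nv 1))) →
      wp (recStmt E.k) s1 (fun s' => s'.nv 1 = s.nv 1 ∧ s'.nv 2 = s.nv 2 ∧ s'.na = s.na ∧
        s'.tm ≤ s.tm + (2 * E.k + 18) ∧ NodeRec E.k s.na s'.out (s.nv 1) ∧
        ∀ c, (c < recAdr E.k (s.nv 1) ∨ recAdr E.k (s.nv 1 + 1) ≤ c) → s'.out c = s.out c) := by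
    intro s1 g1 g2 gn go gt g4 g7 g8 g6 g9
    refine wp.mono (wp_recStmt hk s1 (by rw [g4]; exact hadr _ h1) (by rw [g6]; exact hb6)
      (by rw [g7]; split_ifs <;> omega) (by rw [g8]; split_ifs <;> omega)
      (by rw [g9]; exact hb9)) ?_
    rintro s2 ⟨f1, f2, fn, ft, fr, fo⟩
    rw [g4] at fo
    rw [g4, g6, g7, g8, g9] at fr
    refine ⟨f1.trans g1, f2.trans g2, fn.trans gn, by omega, fr, fun c hc => ?_⟩
    rw [← go]
    exact fo c (hc.imp id fun h => by rw [recAdr] at h ⊢; rw [mul_add] at h; omega)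
  simp [nodeStmt]
  refine ⟨by omega, fun c0 => ⟨by omega, fun c1 => ?_, fun c1 => by omega⟩,
    fun c0 => ⟨by omega, fun c1 => ?_, fun c1 => ⟨by omega, ?_⟩⟩⟩
  · apply key <;> simp [recAdr, c0]
  · have h2 : s.na 5 (s.nv 1) < 2 := by omega
    apply key <;> simp [recAdr, c0, h2]
  · have h2 : ¬ s.na 5 (s.nv 1) < 2 := by omega
    apply key <;> simp [recAdr, c0, h2]

/-- Records are disjoint and begin behind the `k` cells of the root address, so later writes spare
earlier ones. Overwriting the digits of `n` is harmless, as they were copied to a real register at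
the start. -/
theorem wp_outputStmt (hL : 1000 * E.n ≤ 2 ^ (E.w * E.k))
    (hA : recAdr E.k (6 * E.n + 2) ≤ 2 ^ (E.w * E.k)) (hk : 0 < E.k) (hw : 1 ≤ E.w) (hn : 1 ≤ E.n)
    (s : St E) {m₀ : ℕ} (hm : m₀ ≤ 2 * E.n) (h3 : s.nv 3 = m₀) (h2 : s.nv 2 ≤ 6 * E.n + 1)
    {tr : ℕ → BinTree (Fin E.n)} {r : ℕ}
    (hN : ∀ a < s.nv 2, Node (s.na 5) (s.na 6) (s.na 7) tr a) (hr : r < s.nv 2)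
    (hhead : s.na 3 m₀ = r + 1) :
    wp (outputStmt E.k) s (fun s' =>
      Stores E.k s'.out (readNum s'.out E.k 0) ((tr r).map Fin.val) ∧
      s'.tm ≤ s.tm + (2 * E.k + 30) * (8 * E.n)) := by
  have hadr : recAdr E.k r < 2 ^ (E.w * E.k) := by
    refine lt_of_lt_of_le ?_ hA
    have : (2 * E.k + 2) * (r + 1) ≤ (2 * E.k + 2) * (6 * E.n + 2) :=
      Nat.mul_le_mul_left _ (by omega)
    rw [mul_add, mul_one] at this
    simp only [recAdr]
    omega
  have hkA : E.k ≤ 2 ^ (E.w * E.k) := (Nat.le_add_right _ _).trans hA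
  simp only [outputStmt, wp_seq, wp_prim, Prim.Ok, NExp.Ok, NExp.eval, Prim.run, true_and]
  refine ⟨?_, wp.mono (wp_outNum le_rfl _ ?_ ?_) ?_⟩
  · simp [h3, hhead]; omega
  · simpa using hkA
  · simpa [h3, hhead, recAdr] using hadr
  rintro s1 ⟨e1, e2, e3, e4, e5⟩
  simp [h3, hhead] at e1 e2 e3 e4 e5
  refine wp_loop (fun s' => s'.nv 1 ≤ s.nv 2 ∧ s'.nv 2 = s.nv 2 ∧ s'.na = s.na ∧
    readNum s'.out E.k 0 = recAdr E.k r ∧ ∀ a < s'.nv 1, NodeRec E.k s.na s'.out a)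
    (fun s' => (2 * E.k + 24) * (s.nv 2 - s'.nv 1)) ?_ ?_ ?_
  · simp [e1, e2]
    rw [readNum_digits _ _ (recAdr E.k r) (by simpa [recAdr] using e4), Nat.mod_eq_of_lt hadr]
  · rintro s2 ⟨f1, f2, f3, f4, f5⟩
    refine ⟨by simp, fun h => ?_⟩
    simp only [Cond.Holds, NExp.eval, f2] at h
    refine wp.seq (wp_nodeStmt hL hA hk hn s2.tick (by simp; omega) (tr := tr)
      (by simpa [f3] using hN _ h)) ?_
    rintro s3 ⟨g1, g2, g3, gt, g5, g6⟩
    simp [f2, f3] at g1 g2 g3 gt g5 g6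
    simp [g1, g2, g3]
    refine ⟨⟨h, ?_, fun a ha => ?_⟩, ?_⟩
    · rw [← f4]
      refine readNum_congr _ _ fun j hj => g6 _ (.inl ?_)
      rw [recAdr]; omega
    · rcases Nat.le_iff_lt_or_eq.1 ha with ha | rfl
      · refine (f5 a ha).congr fun c _ hc => g6 c (.inl (hc.trans_le ?_))
        have : (2 * E.k + 2) * (a + 1) ≤ (2 * E.k + 2) * s2.nv 1 :=
          Nat.mul_le_mul_left _ (by omega)
        rw [mul_add, mul_one] at this
        simp only [recAdr]
        omega
      · exact g5
    · obtain ⟨d, hd⟩ := Nat.exists_eq_add_of_lt h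
      rw [show s.nv 2 - s2.nv 1 = d + 1 by omega, show s.nv 2 - (s2.nv 1 + 1) = d by omega, mul_add]
      omega
  · rintro s2 ⟨f1, f2, f3, f4, f5⟩ h ht
    simp [f2] at h ht ⊢
    have e : s2.nv 1 = s.nv 2 := by omega
    rw [e] at f5
    refine ⟨?_, ?_⟩
    · rw [f4]; exact stores_of_nodeRec hw hN f5 r hr
    · have : (2 * E.k + 24) * s.nv 2 ≤ (2 * E.k + 24) * (6 * E.n + 1) :=
        Nat.mul_le_mul_left _ h2
      have h8 : (2 * E.k + 24) * (8 * E.n) =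
          (2 * E.k + 24) * (6 * E.n) + (2 * E.k + 24) * (2 * E.n) := by ring
      have h9 : (2 * E.k + 30) * (8 * E.n) = (2 * E.k + 24) * (8 * E.n) + 48 * E.n := by ring
      have h10 : (2 * E.k + 24) * 2 ≤ (2 * E.k + 24) * (2 * E.n) :=
        Nat.mul_le_mul_left _ (by omega)
      rw [mul_add] at this
      have h11 : (2 * E.k + 24) * (s.nv 2 - s2.nv 1) = 0 := by rw [e]; simp
      omega

/-! ### The whole algorithm -/

/-- Build a minimax tree. -/
def minimaxStmt (k : ℕ) : Stmt :=
  powersStmt ;; maxStmt ;; partsStmt ;; slackStmt ;; selectStmt ;; leavesStmt ;; pairStmt ;;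
  outputStmt k

/-- Initially the whole selection problem is the only level, with fallback `1` above all keys. -/
theorem Parts.stack {u : ℕ → ℝ} {s : St E} (hs : Parts u E.n s) (hu : ∀ i < E.n, 0 ≤ u i)
    (h4 : s.nv 4 = 1) (ho : s.na 1 1 = 0) (hz : s.na 2 1 = E.n)
    (hB : s.ra 4 1 = 2 ^ s.nv 3 - ∑ i ∈ Finset.range E.n, 2 ^ ⌊u i⌋₊) (hh : s.ra 5 1 = 1) :
    Stack (IsFrac E.n u (s.nv 3)) s := by
  have hl : lvl s 1 = items E.n u := by
    rw [lvl, ho, hz, items]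
    exact seg_congr (fun i _ hi => hs.key i (by omega)) (fun i _ hi => hs.wt i (by omega))
  constructor
  · intro i h1 hi
    rw [h4] at hi
    obtain rfl : i = 1 := by omega
    omega
  · intro i j h1 hij hj
    omega
  · intro i h1 hi
    rw [h4] at hi
    obtain rfl : i = 1 := by omega
    rw [hl]
    exact fun y hy => (mem_items hu hy).2
  · intro i h1 hi
    omega
  · intro _ a ha
    rwa [hl, hB, hh] at ha
  · intro h; omega

theorem wp_minimaxStmt (hL : 1000 * E.n ≤ 2 ^ (E.w * E.k))
    (hA : recAdr E.k (6 * E.n + 2) ≤ 2 ^ (E.w * E.k)) (hk : 0 < E.k) (hw : 1 ≤ E.w)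
    (hn : 1 ≤ E.n) :
    wp (minimaxStmt E.k) (init E) (fun s => s.tm ≤ (16 * E.k + 3000) * E.n ∧
      ∃ t : BinTree (Fin E.n), Stores E.k s.out (readNum s.out E.k 0) (t.map Fin.val) ∧
        t.leaves = Finset.univ.val ∧
        (t.map fun i : Fin E.n => E.x i).IsMinimax
          (Finset.univ.val.map fun i : Fin E.n => E.x i)) := by
  refine wp.seq (wp_powersStmt hL hn _ rfl fun _ => rfl) ?_
  rintro s1 ⟨h1, t1⟩
  refine wp.seq (wp_maxStmt hL hn s1 h1) ?_
  rintro s2 ⟨h2, ⟨hx, hmx⟩, t2⟩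
  refine wp.seq (wp_partsStmt hL s2 h2 _ rfl hx hn) ?_
  rintro s3 ⟨h3, t3⟩
  set mx := s2.rv 0
  have hu0 : ∀ i < E.n, 0 ≤ E.u mx i := fun i _ => le_max_right _ _
  refine wp.seq (wp_slackStmt hL hn s3 (E.u mx)
    (fun i hi => max_le (by have := hx i hi; linarith) (by positivity)) h3) ?_
  rintro s4 ⟨h4, htop, e1, e2, e3, e4, e5, t4⟩
  refine wp.seq (wp_selectStmt hL hn s4 (h4.stack hu0 e1 e2 e3 e4 e5)) ?_
  rintro s5 ⟨hK, hR, t5⟩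
  rw [e1, show pot (s4.na 2) 1 = 2000 * s4.na 2 1 + 10 by simp [pot], e3] at t5
  refine wp.seq (wp_leavesStmt hL hn s5 (u := E.u mx) (hR.mem_Icc hu0).1 (hR.sum_le hu0 htop)
    htop.bound (hK.size.trans h4.size) hK.top rfl
    (by rw [hK.na 0 (by decide) (by decide)]; exact h4.int)
    (by rw [hK.ra 1 (.inr rfl)]; exact h4.frac)
    (by rw [hK.na 3 (by decide) (by decide)]; exact h4.head)) ?_
  rintro s6 ⟨f0, f3, ⟨ls, tr, K, hF, hT, hKm, hls⟩, t6⟩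
  refine wp.seq (wp_pairStmt hL hn s6 htop.bound f0 f3 hF hT hKm hls) ?_
  rintro s7 ⟨⟨tr, r, hN, hr, hc, hhead, hlv, hwt⟩, g3, t7⟩
  refine (wp_outputStmt hL hA hk hw hn s7 htop.bound g3 hc hN hr hhead).mono ?_
  rintro s8 ⟨hS, t8⟩
  refine ⟨?_, tr r, hS, hlv, hR.isMinimax hn hmx htop _ hlv hwt⟩
  have e : (16 * E.k + 3000) * E.n = (2 * E.k + 30) * (8 * E.n) + 2760 * E.n := by ring
  have : (init E).tm = 0 := rfl
  omega

end RealRAM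

theorem mainTheorem1 (c : ℝ) (hc : 0 < c) :
    ∃ (P : WordRAM.Program) (k C : ℕ),
      ∀ (w n : ℕ) (x : Fin n → ℝ), 1 ≤ w → 1 ≤ n → c * Real.logb 2 (n : ℝ) ≤ (w : ℝ) →
        WordRAM.BuildsMinimaxTree P k w x (C * n) := by
  -- Since `logb 2 n ≤ w / c ≤ w * K`, the number `n` fits into about `K` digits.
  obtain ⟨K, hK⟩ := exists_nat_ge (1 / c)
  -- The other `K + 20` digits make room for the factor `34 * K + 1000`, which dominates both the
  -- array cells and the records; the latter end at `24 * K * n + 252 * n + 10 * K + 104`.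
  set k := K + (K + 20) with hk
  refine ⟨RealRAM.program k (RealRAM.minimaxStmt k), k, (RealRAM.prologue k).length +
    (RealRAM.minimaxStmt k).slow k * (16 * k + 3000), fun w n x hw hn hcw => ?_⟩
  have hn0 : (0 : ℝ) < n := by exact_mod_cast hn
  have h1 : n ≤ 2 ^ (w * K) := by
    have : Real.logb 2 (n : ℝ) ≤ (w * K : ℕ) := by
      rw [div_le_iff₀ hc] at hK
      have h0 : (0 : ℝ) ≤ w := by positivity
      rw [← mul_le_mul_iff_right₀ hc]
      push_cast
      nlinarith
    rw [Real.logb_le_iff_le_rpow (by norm_num) hn0, Real.rpow_natCast] at this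
    exact_mod_cast this
  have h2 : 34 * K + 1000 ≤ 2 ^ (w * (K + 20)) := by
    calc 34 * K + 1000 ≤ (K + 1) * 2 ^ 20 := by omega
      _ ≤ 2 ^ K * 2 ^ 20 := Nat.mul_le_mul_right _ Nat.lt_two_pow_self
      _ = 2 ^ (K + 20) := (pow_add ..).symm
      _ ≤ 2 ^ (w * (K + 20)) :=
        Nat.pow_le_pow_right (by norm_num) (Nat.le_mul_of_pos_left _ (by omega))
  have h3 : n * (34 * K + 1000) ≤ 2 ^ (w * k) := by
    rw [hk, mul_add w, pow_add]
    exact Nat.mul_le_mul h1 h2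
  have h4 : n * (34 * K + 1000) = 34 * (K * n) + 1000 * n := by ring
  have h5 : K ≤ K * n := Nat.le_mul_of_pos_right _ hn
  have hA : RealRAM.recAdr k (6 * n + 2) ≤ 2 ^ (w * k) := by
    have : RealRAM.recAdr k (6 * n + 2) = 24 * (K * n) + 252 * n + (10 * K + 104) := by
      rw [RealRAM.recAdr, hk]; ring
    omega
  have hkk : k ≤ 2 ^ (w * k) := (Nat.le_add_right _ _).trans hA
  obtain ⟨m, hm, hH, t, hS, hl, ht⟩ := RealRAM.program_halts x (RealRAM.minimaxStmt k) hw hkk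
    (T := (16 * k + 3000) * n)
    (Q := fun mem => ∃ t : BinTree (Fin n),
      WordRAM.Stores k mem (WordRAM.readNum mem k 0) (t.map Fin.val) ∧
      t.leaves = Finset.univ.val ∧
      (t.map fun i : Fin n => if h : i.val < n then x ⟨i, h⟩ else 0).IsMinimax
        (Finset.univ.val.map fun i : Fin n => if h : i.val < n then x ⟨i, h⟩ else 0))
    (by omega) (RealRAM.wp_minimaxStmt
      (E := ⟨k, w, n, fun a => if h : a < n then x ⟨a, h⟩ else 0⟩) (by simp only; omega) hA
      (by simp only; omega) hw hn)
  refine ⟨m, hm.trans ?_, hH, t, hS, hl, by simpa using ht⟩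
  rw [add_mul (RealRAM.prologue k).length, mul_assoc]
  exact Nat.add_le_add_right (Nat.le_mul_of_pos_right _ hn) _
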